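/- Let $d\in\mathbb{N}$. Let $a:\mathbb{R}^d\times\mathbb{R}^d\to\mathbb{R}$ be a real symbol of class $S^0_{0,0}(\mathbb{R}^d\times\mathbb{R}^d)$, i.e. a real-valued smooth function such that all its partial derivatives $\partial_x^\alpha\partial_\xi^\beta a$ (of every order, including zero) are bounded on $\mathbb{R}^d\times\mathbb{R}^d$. Let $F:\mathbb{R}^d\to\mathbb{R}^d$ be a smooth map all of whose derivatives of strictly positive order are bounded ($F$ itself may be unbounded). For $\delta\in\mathbb{R}$ with $|\delta|\le 1$ put $a[F]_\delta(x,\xi):=a\big(x+\delta F(x),\xi\big)$, and let $K_\delta$ be its Weyl quantization, i.e. the unique bounded operator on $L^2(\mathbb{R}^d)$ such that for all Schwartz functions $\varphi$ $$ (K_\delta\varphi)(x)=(2\pi)^{-d}\int_{\mathbb{R}^d}d\eta\int_{\mathbb{R}^d}dy\;e^{i\langle\eta,x-y\rangle}\,a[F]_\delta\big((x+y)/2,\eta\big)\,\varphi(y)\quad\text{for almost every }x $$ (such an operator exists for all $|\delta|\le1$). Denote by $\sigma(K)\subset\mathbb{C}$ the spectrum of $K$, and let $\mathbf{d}_{\mathbf{H}}(A,B):=\max\big\{\sup_{t\in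 A}\operatorname{dist}(t,B),\ \sup_{t\in B}\operatorname{dist}(t,A)\big\}$ be the Hausdorff distance of subsets of $\mathbb{C}$. Then there exists a constant $C(a,F)>0$ such that for all real $\delta$ with $|\delta|\le 1$ $$ \mathbf{d}_{\mathbf{H}}\big(\sigma(K_\delta),\sigma(K_0)\big)\le C(a,F)\sqrt{|\delta|}. $$ -/

import Mathlib

open MeasureTheory
open scoped ContDiff SchwartzMap

noncomputable section

namespace WeylSpectrum

/-- The Euclidean space `ℝ^d`. -/
abbrev Rn (d : ℕ) : Type := EuclideanSpace ℝ (Fin d)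

/-- The complex Hilbert space `L²(ℝ^d)` for Lebesgue measure. -/
abbrev L2 (d : ℕ) : Type := Lp ℂ 2 (volume : Measure (Rn d))

/-- The real symbol class `S^0_{0,0}(ℝ^d × ℝ^d)`: real-valued smooth functions of `(x, ξ)` all of
whose derivatives (of every order, including `0`) are bounded on `ℝ^d × ℝ^d`. -/
structure IsRealSymbol {d : ℕ} (a : Rn d × Rn d → ℝ) : Prop where
  smooth : ContDiff ℝ ∞ a
  bounded : ∀ n : ℕ, ∃ C : ℝ, ∀ z, ‖iteratedFDeriv ℝ n a z‖ ≤ C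

/-- The class `C^∞_1(ℝ^d; ℝ^d)`: smooth maps whose derivatives of every strictly positive order
are bounded. The map itself need not be bounded. -/
structure IsCInftyOne {d : ℕ} (F : Rn d → Rn d) : Prop where
  smooth : ContDiff ℝ ∞ F
  bounded : ∀ n : ℕ, 1 ≤ n → ∃ C : ℝ, ∀ x, ‖iteratedFDeriv ℝ n F x‖ ≤ C

/-- The perturbed symbol `a[F]_δ (x, ξ) = a (x + δ F(x), ξ)`. -/
def perturbedSymbol {d : ℕ} (a : Rn d × Rn d → ℝ) (F : Rn d → Rn d) (δ : ℝ) :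
    Rn d × Rn d → ℝ :=
  fun z => a (z.1 + δ • F z.1, z.2)

/-- The Weyl quantization on Schwartz functions, at the point `x`:
`(2π)^{-d} ∫∫ e^{i⟨η, x - y⟩} a((x + y)/2, η) φ(y) dy dη`.
The oscillatory integral is evaluated with the integral over `y` first: for a symbol with bounded
derivatives and a Schwartz function `φ` the inner integral converges absolutely and
decreases rapidly in `η`, so that the outer integral converges absolutely as well. -/
def weylIntegral {d : ℕ} (a : Rn d × Rn d → ℝ) (φ : 𝓢(Rn d, ℂ)) (x : Rn d) : ℂ :=
  (((2 * Real.pi) ^ d)⁻¹ : ℝ) *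
    ∫ η : Rn d, ∫ y : Rn d,
      Complex.exp (Complex.I * (inner ℝ η (x - y) : ℝ)) *
        (a ((1 / 2 : ℝ) • (x + y), η) : ℂ) * φ y

/-- `K` is a bounded operator on `L²(ℝ^d)` that extends the Weyl quantization of `a` from the
Schwartz functions. -/
def IsWeylQuantization {d : ℕ} (a : Rn d × Rn d → ℝ) (K : L2 d →L[ℂ] L2 d) : Prop :=
  ∀ φ : 𝓢(Rn d, ℂ), K (φ.toLp 2 volume) =ᵐ[volume] weylIntegral a φ

/-- There is at most one such extension, because the Schwartz functions are dense. -/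
theorem IsWeylQuantization.unique {d : ℕ} {a : Rn d × Rn d → ℝ} {K K' : L2 d →L[ℂ] L2 d}
    (hK : IsWeylQuantization a K) (hK' : IsWeylQuantization a K') : K = K' := by
  have hd : DenseRange (SchwartzMap.toLpCLM ℂ ℂ 2 (volume : Measure (Rn d))) :=
    SchwartzMap.denseRange_toLpCLM (by norm_num)
  apply ContinuousLinearMap.coeFn_injective
  refine hd.equalizer K.continuous K'.continuous ?_
  funext φ
  exact Lp.ext ((hK φ).trans (hK' φ).symm)

open Classical in
/-- The Weyl quantization `Op^w(a)` as a bounded operator on `L²(ℝ^d)`: the unique bounded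
extension of `weylIntegral a`. (The value is `0` if there is none.) -/
def weylOp {d : ℕ} (a : Rn d × Rn d → ℝ) : L2 d →L[ℂ] L2 d :=
  if h : ∃ K : L2 d →L[ℂ] L2 d, IsWeylQuantization a K then h.choose else 0

end WeylSpectrum

end

/-! All the operators involved are bounded and self-adjoint. For such an operator every spectral
value has approximate eigenvectors (`exists_approx_eigenvector`), and an approximate eigenvector of
relative error η for a real number r forces a spectral point within η of r
(`exists_mem_spectrum_of_approx_eigenvector`). It is therefore enough to convert approximate
eigenvectors of the perturbed operator into approximate eigenvectors of the unperturbed one, and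
back, with a loss O(√|δ|).

Since F may be unbounded, the perturbed symbol is not globally close to a. Near a point p, however,
x + δF(x) differs from the translation x + δF(p) by at most |δ|·L·|x - p|, where L is a Lipschitz
constant of F, and the quantization of a translated symbol is unitarily equivalent to that of a,
hence has the same spectrum. On the region |x - p| ≲ |δ|^(-1/2) the difference of the two symbols is
O(√|δ|) with all its derivatives (`unifLe_cutoff_mul_shiftMap_sub`), so the operators are
O(√|δ|)-close on functions living there (`exists_norm_sub_translConj_le`).

Localizing to scale 1/ε costs a commutator of size ε, which balances the previous error at ε = √|δ|.
Conjugation by a modulation of frequency q translates the symbol by q in ξ, so commutators with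
modulations are O(|q|) (`IsOp.commBound`). A cut-off χ(εx - s) is a superposition of modulations,
and its commutator applied to a fixed vector is, as a function of s, a Fourier transform. Plancherel
gives a bound O(ε) in mean square over s (`CommBound.lintegral_commutator_le`), and averaging over s
yields one good centre (`exists_localized_approx_eigenvector`).

The analytic input is the Calderón–Vaillancourt bound `exists_norm_integral_mul_wig_le`, in the weak
form that pairs a symbol with cross-Wigner functions. The symbol is expanded in Gaussian wave
packets on phase space. Each packet quantizes to an explicit rank-one form
(`integral_elemSymbol_wig`), which Cauchy–Schwarz and the Plancherel identity of the wave packet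
transform sum up.

In the direction from the unperturbed to the perturbed operator, the centre p must solve p + δF(p) =
c. This is a contraction problem for small |δ|; for the remaining δ the crude norm bound suffices,
as √|δ| is bounded below. -/

open MeasureTheory
open scoped ContDiff SchwartzMap
noncomputable section
namespace WeylSpectrum
open Filter
open scoped FourierTransform Topology ENNReal InnerProductSpace ComplexConjugate


/-! ### Plancherel for Hilbert-space-valued functions -/

section Plancherel

variable {V : Type*} [NormedAddCommGroup V] [InnerProductSpace ℝ V] [FiniteDimensional ℝ V]
  [MeasurableSpace V] [BorelSpace V]
  {H : Type*} [NormedAddCommGroup H] [InnerProductSpace ℂ H] [CompleteSpace H]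

/-- The `L²` Fourier transform agrees with the Fourier integral on `L¹ ∩ L²`. -/
theorem fourier_toLp_ae_eq {f : V → H} (hf : Integrable f) (hf2 : MemLp f 2) :
    (𝓕 (hf2.toLp f) : Lp (α := V) H 2) =ᵐ[volume] 𝓕 f := by
  have hcont : Continuous (𝓕 f) :=
    VectorFourier.fourierIntegral_continuous Real.continuous_fourierChar
      (by exact continuous_inner) hf
  refine ae_eq_of_integral_contDiff_smul_eq ?_ hcont.locallyIntegrable ?_
  · exact (Lp.memLp _).locallyIntegrable (by norm_num)
  intro g hg hgs
  have hgc : ContDiff ℝ ∞ (fun x => (g x : ℂ)) := Complex.ofRealCLM.contDiff.comp hg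
  have hgcs : HasCompactSupport (fun x => (g x : ℂ)) := hgs.comp_left (g := Complex.ofReal) rfl
  let G : 𝓢(V, ℂ) := hgcs.toSchwartzMap hgc
  have hG : ∀ x, G x = (g x : ℂ) := fun x => rfl
  -- Testing against `g` turns the claim into the definition of the Fourier transform of a tempered
  -- distribution, followed by moving the Fourier integral from one factor to the other.
  have h1 := congrArg (fun T : 𝓢'(V, H) => T G) (Lp.fourier_toTemperedDistribution_eq (hf2.toLp f))
  simp only [TemperedDistribution.fourier_apply, Lp.toTemperedDistribution_apply] at h1
  have h2 : ∫ x, (𝓕 G) x • (hf2.toLp f) x = ∫ x, (𝓕 (G : V → ℂ)) x • f x := by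
    refine integral_congr_ae ?_
    filter_upwards [hf2.coeFn_toLp] with x hx
    rw [hx, SchwartzMap.fourier_coe]
  have h3 : ∫ x, (𝓕 (G : V → ℂ)) x • f x = ∫ x, G x • 𝓕 f x := by
    have := VectorFourier.integral_fourierIntegral_smul_eq_flip (μ := volume) (ν := volume)
      (L := innerₗ V) Real.continuous_fourierChar continuous_inner G.integrable hf
    rw [flip_innerₗ] at this
    exact this
  rw [h2, h3] at h1
  simp only [hG] at h1
  simpa using h1.symm

theorem eLpNorm_fourier {f : V → H} (hf : Integrable f) (hf2 : MemLp f 2) :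
    eLpNorm (𝓕 f) 2 = eLpNorm f 2 := by
  rw [← eLpNorm_congr_ae (fourier_toLp_ae_eq hf hf2), ← Lp.enorm_def, ← Lp.enorm_toLp (f := f) hf2]
  simp only [← ofReal_norm, Lp.norm_fourier_eq]

theorem lintegral_enorm_sq_fourier {f : V → H} (hf : Integrable f) (hf2 : MemLp f 2) :
    ∫⁻ w, ‖𝓕 f w‖ₑ ^ 2 = ∫⁻ v, ‖f v‖ₑ ^ 2 := by
  have h := eLpNorm_fourier hf hf2
  rw [eLpNorm_eq_lintegral_rpow_enorm_toReal (by norm_num) (by norm_num),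
    eLpNorm_eq_lintegral_rpow_enorm_toReal (by norm_num) (by norm_num)] at h
  simp only [ENNReal.toReal_ofNat, ENNReal.rpow_ofNat] at h
  exact (ENNReal.rpow_left_injective (by norm_num : (1 / 2 : ℝ) ≠ 0)) h

end Plancherel

/-! ### Decay of Fourier integrals -/

section Decay

variable {V : Type*} [NormedAddCommGroup V] [InnerProductSpace ℝ V] [FiniteDimensional ℝ V]
  [MeasurableSpace V] [BorelSpace V]

/-- Decay of the Fourier integral in terms of `L¹` norms of derivatives. -/
theorem norm_fourier_le_of_integral_le (N : ℕ) {h : V → ℂ} (hc : ContDiff ℝ ∞ h)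
    (hi : ∀ k ≤ N, Integrable (iteratedFDeriv ℝ k h)) {M : ℝ}
    (hM : ∀ k ≤ N, ∫ v, ‖iteratedFDeriv ℝ k h v‖ ≤ M) (w : V) :
    ‖𝓕 h w‖ ≤ (4 ^ N * (N + 2)) * M * (1 + ‖w‖) ^ (-(N : ℝ)) := by
  have hM0 : 0 ≤ M := (integral_nonneg fun _ => norm_nonneg _).trans (hM 0 (Nat.zero_le _))
  have key : ∀ n ≤ N, ‖w‖ ^ n * ‖𝓕 h w‖ ≤ 2 ^ n * ((n + 1) * M) := by
    intro n hn
    have := Real.pow_mul_norm_iteratedFDeriv_fourier_le (f := h) (K := 0) (N := N)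
      (hc.of_le (by exact_mod_cast le_top))
      (by
        intro k m hk hm
        have : k = 0 := by simpa using hk
        subst this
        simpa using (hi m (by exact_mod_cast hm)).norm) (k := 0) (n := n) le_rfl
      (by exact_mod_cast hn) w
    simp only [norm_iteratedFDeriv_zero, pow_zero, one_mul, Nat.cast_zero, mul_zero, zero_add,
      Finset.range_one, Finset.singleton_product, Finset.sum_map, Function.Embedding.coeFn_mk]
      at this
    refine this.trans ?_
    gcongr
    calc _ ≤ ∑ _x ∈ Finset.range (n + 1), M :=
          Finset.sum_le_sum fun i hi => hM i (by simp at hi; omega)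
      _ = (n + 1) * M := by simp
  rw [Real.rpow_neg (by positivity), Real.rpow_natCast, ← div_eq_mul_inv, le_div_iff₀ (by positivity)]
  -- This reduces the weight to the two extreme powers of `‖w‖`, so that only `key` at 0 and at `N`
  -- is needed.
  have h1 : (1 + ‖w‖) ^ N ≤ 2 ^ N * (1 + ‖w‖ ^ N) := by
    have h2 := add_pow_le (zero_le_one) (norm_nonneg w) N
    simp only [one_pow] at h2
    refine h2.trans ?_
    gcongr
    · norm_num
    · omega
  have k0 := key 0 (Nat.zero_le _)
  have kN := key N le_rfl
  simp only [pow_zero, one_mul, Nat.cast_zero, zero_add] at k0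
  calc ‖𝓕 h w‖ * (1 + ‖w‖) ^ N ≤ ‖𝓕 h w‖ * (2 ^ N * (1 + ‖w‖ ^ N)) := by gcongr
    _ = 2 ^ N * (‖𝓕 h w‖ + ‖w‖ ^ N * ‖𝓕 h w‖) := by ring
    _ ≤ 2 ^ N * (M + 2 ^ N * ((N + 1) * M)) := by gcongr
    _ ≤ 2 ^ N * (2 ^ N * M + 2 ^ N * ((N + 1) * M)) := by
        have : (1 : ℝ) ≤ 2 ^ N := one_le_pow₀ (by norm_num)
        gcongr
        nlinarith
    _ = (4 ^ N * (N + 2)) * M := by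
        rw [show (4 : ℝ) ^ N = 2 ^ N * 2 ^ N by rw [← mul_pow]; norm_num]; ring

end Decay

/-! ### Fourier inversion and decay on phase space -/

variable {d : ℕ}

/-- The phase `⟨z, w⟩` on phase space. -/
def pair (z w : Rn d × Rn d) : ℝ := ⟪z.1, w.1⟫_ℝ + ⟪z.2, w.2⟫_ℝ

/-- The Fourier transform on phase space. -/
def fourierProd (h : Rn d × Rn d → ℂ) (Q : Rn d × Rn d) : ℂ :=
  ∫ z, (𝐞 (-pair z Q) : ℂ) * h z

theorem continuous_pair : Continuous fun p : (Rn d × Rn d) × (Rn d × Rn d) => pair p.1 p.2 := by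
  unfold pair; fun_prop

theorem continuous_char : Continuous fun r : ℝ => (𝐞 r : ℂ) :=
  continuous_subtype_val.comp Real.continuous_fourierChar

/-- The product carries the sup norm, so Fourier theory is imported from the Hilbert sum `WithLp 2`,
which has the same volume. -/
theorem fourierProd_eq (h : Rn d × Rn d → ℂ) (Q : Rn d × Rn d) :
    fourierProd h Q = 𝓕 (fun v : WithLp 2 (Rn d × Rn d) => h (WithLp.ofLp v)) (WithLp.toLp 2 Q) := by
  rw [Real.fourier_eq, fourierProd,
    ← (WithLp.volume_preserving_ofLp (Rn d) (Rn d)).integral_comp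
      (WithLp.homeomorphProd 2 (Rn d) (Rn d)).measurableEmbedding]
  refine integral_congr_ae (Eventually.of_forall fun v => ?_)
  simp [pair, Circle.smul_def]

theorem norm_iteratedFDeriv_comp_clm_le {A B G : Type*} [NormedAddCommGroup A] [NormedSpace ℝ A]
    [NormedAddCommGroup B] [NormedSpace ℝ B] [NormedAddCommGroup G] [NormedSpace ℝ G]
    {f : B → G} (hf : ContDiff ℝ ∞ f) (L : A →L[ℝ] B) (hL : ‖L‖ ≤ 1) (n : ℕ) (x : A) :
    ‖iteratedFDeriv ℝ n (fun y => f (L y)) x‖ ≤ ‖iteratedFDeriv ℝ n f (L x)‖ := by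
  have := L.iteratedFDeriv_comp_right hf x (i := n) (by exact_mod_cast le_top)
  rw [show (fun y => f (L y)) = f ∘ L from rfl, this]
  refine (ContinuousMultilinearMap.norm_compContinuousLinearMap_le _ _).trans ?_
  refine mul_le_of_le_one_right (norm_nonneg _) ?_
  simpa using pow_le_one₀ (norm_nonneg _) hL

theorem norm_fst_toLp_le (z : Rn d × Rn d) : ‖z.1‖ ≤ ‖WithLp.toLp 2 z‖ := by
  rw [WithLp.prod_norm_eq_of_L2]
  exact Real.le_sqrt_of_sq_le (le_add_of_nonneg_right (sq_nonneg _))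

theorem norm_snd_toLp_le (z : Rn d × Rn d) : ‖z.2‖ ≤ ‖WithLp.toLp 2 z‖ := by
  rw [WithLp.prod_norm_eq_of_L2]
  exact Real.le_sqrt_of_sq_le (le_add_of_nonneg_left (sq_nonneg _))

instance : (volume : Measure (Rn d × Rn d)).IsAddHaarMeasure :=
  inferInstanceAs ((volume.prod volume : Measure (Rn d × Rn d)).IsAddHaarMeasure)

theorem norm_ofLp_clm_le : ‖(WithLp.prodContinuousLinearEquiv 2 ℝ (Rn d) (Rn d) :
    WithLp 2 (Rn d × Rn d) →L[ℝ] Rn d × Rn d)‖ ≤ 1 := by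
  refine ContinuousLinearMap.opNorm_le_bound _ zero_le_one fun v => ?_
  rw [one_mul]
  refine max_le ?_ ?_
  · exact norm_fst_toLp_le v.1
  · exact norm_snd_toLp_le v.1

theorem integral_comp_ofLp {G : Type*} [NormedAddCommGroup G] [NormedSpace ℝ G]
    (f : Rn d × Rn d → G) :
    ∫ v : WithLp 2 (Rn d × Rn d), f (WithLp.ofLp v) = ∫ z, f z :=
  (WithLp.volume_preserving_ofLp (Rn d) (Rn d)).integral_comp
      (WithLp.homeomorphProd 2 (Rn d) (Rn d)).measurableEmbedding f

theorem integrable_comp_ofLp {G : Type*} [NormedAddCommGroup G]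
    {f : Rn d × Rn d → G} :
    Integrable (fun v : WithLp 2 (Rn d × Rn d) => f (WithLp.ofLp v)) ↔ Integrable f :=
  (WithLp.volume_preserving_ofLp (Rn d) (Rn d)).integrable_comp_emb
      (WithLp.homeomorphProd 2 (Rn d) (Rn d)).measurableEmbedding

section CompEquiv

variable {V B : Type*} [NormedAddCommGroup V] [InnerProductSpace ℝ V] [FiniteDimensional ℝ V]
  [MeasurableSpace V] [BorelSpace V] [NormedAddCommGroup B] [NormedSpace ℝ B]
  [MeasureSpace B] [BorelSpace B] [IsFiniteMeasureOnCompacts (volume : Measure B)]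
  {h : B → ℂ} (hc : ContDiff ℝ ∞ h) (hs : HasCompactSupport h)
include hc hs

/-- A contractive, volume-preserving linear identification does not increase the L¹ norms of
derivatives. It serves to pass from the sup norm on phase space to the Hilbert norm. -/
theorem norm_fourier_comp_le_of_integral_le (e : V ≃L[ℝ] B) (he : ‖(e : V →L[ℝ] B)‖ ≤ 1)
    (hmp : MeasurePreserving (e : V → B)) (N : ℕ) {M : ℝ}
    (hM : ∀ k ≤ N, ∫ v, ‖iteratedFDeriv ℝ k h v‖ ≤ M) (w : V) :
    ‖𝓕 (fun v => h (e v)) w‖ ≤ (4 ^ N * (N + 2)) * M * (1 + ‖w‖) ^ (-(N : ℝ)) := by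
  have hint : ∀ k, Integrable (fun z => ‖iteratedFDeriv ℝ k h z‖) := fun k =>
    ((hc.continuous_iteratedFDeriv (by exact_mod_cast le_top)).integrable_of_hasCompactSupport
      (hs.iteratedFDeriv k)).norm
  have hemb := e.toHomeomorph.measurableEmbedding
  have hint' : ∀ k, Integrable (fun v => ‖iteratedFDeriv ℝ k h (e v)‖) := fun k =>
    (hmp.integrable_comp_emb hemb).2 (hint k)
  have hc' : ContDiff ℝ ∞ (fun v => h (e v)) := hc.comp e.contDiff
  have hle : ∀ k v, ‖iteratedFDeriv ℝ k (fun v => h (e v)) v‖ ≤ ‖iteratedFDeriv ℝ k h (e v)‖ :=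
    fun k v => norm_iteratedFDeriv_comp_clm_le hc (e : V →L[ℝ] B) he k v
  have hint'' : ∀ k, Integrable (iteratedFDeriv ℝ k (fun v => h (e v))) := fun k =>
    (hint' k).mono' (hc'.continuous_iteratedFDeriv (by exact_mod_cast le_top)).aestronglyMeasurable
      (Eventually.of_forall (hle k))
  refine norm_fourier_le_of_integral_le N hc' (fun k _ => hint'' k) (fun k hk => le_trans ?_ (hM k hk)) w
  rw [← hmp.integral_comp hemb (fun v => ‖iteratedFDeriv ℝ k h v‖)]
  exact integral_mono (hint'' k).norm (hint' k) (hle k)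

end CompEquiv

section PhaseFourier

variable {h : Rn d × Rn d → ℂ} (hc : ContDiff ℝ ∞ h) (hs : HasCompactSupport h)
include hc hs

theorem norm_fourierProd_le (N : ℕ) {M : ℝ}
    (hM : ∀ k ≤ N, ∫ v, ‖iteratedFDeriv ℝ k h v‖ ≤ M) (Q : Rn d × Rn d) :
    ‖fourierProd h Q‖ ≤ (4 ^ N * (N + 2)) * M * (1 + ‖Q‖) ^ (-(N : ℝ)) := by
  have hM0 : 0 ≤ M := (integral_nonneg fun _ => norm_nonneg _).trans (hM 0 (Nat.zero_le _))
  have h0 := norm_fourier_comp_le_of_integral_le hc hs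
    (WithLp.prodContinuousLinearEquiv 2 ℝ (Rn d) (Rn d)) norm_ofLp_clm_le
    (WithLp.volume_preserving_ofLp (Rn d) (Rn d)) N hM (WithLp.toLp 2 Q)
  rw [fourierProd_eq]
  refine h0.trans ?_
  have h1 : ‖Q‖ ≤ ‖WithLp.toLp 2 Q‖ := max_le (norm_fst_toLp_le Q) (norm_snd_toLp_le Q)
  refine mul_le_mul_of_nonneg_left ?_ (by positivity)
  exact Real.rpow_le_rpow_of_nonpos (by positivity) (by linarith) (by simp)

theorem continuous_fourierProd : Continuous (fourierProd h) := by
  have h1 : Continuous (𝓕 (fun v : WithLp 2 (Rn d × Rn d) => h (WithLp.ofLp v))) :=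
    VectorFourier.fourierIntegral_continuous Real.continuous_fourierChar
      (by exact continuous_inner)
      (integrable_comp_ofLp.2 (hc.continuous.integrable_of_hasCompactSupport hs))
  have h2 : fourierProd h = fun Q => 𝓕 (fun v : WithLp 2 (Rn d × Rn d) => h (WithLp.ofLp v))
      (WithLp.toLp 2 Q) := funext fun Q => fourierProd_eq h Q
  rw [h2]
  exact h1.comp (WithLp.prod_continuous_toLp 2 _ _)

theorem integrable_fourierProd : Integrable (fourierProd h) := by
  -- One more than the dimension of phase space, which makes the decay integrable.
  set N := 2 * d + 1
  obtain ⟨M, hM⟩ : ∃ M : ℝ, ∀ k ≤ N, ∫ v, ‖iteratedFDeriv ℝ k h v‖ ≤ M := by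
    refine ⟨∑ k ∈ Finset.range (N + 1), ∫ v, ‖iteratedFDeriv ℝ k h v‖, fun k hk => ?_⟩
    exact Finset.single_le_sum (f := fun k => ∫ v, ‖iteratedFDeriv ℝ k h v‖)
      (fun _ _ => integral_nonneg fun _ => norm_nonneg _) (Finset.mem_range.2 (by omega))
  refine Integrable.mono' ((integrable_one_add_norm (E := Rn d × Rn d) (μ := volume) (r := N) ?_).const_mul
    ((4 ^ N * (N + 2)) * M)) (continuous_fourierProd hc hs).aestronglyMeasurable
    (Eventually.of_forall fun Q => norm_fourierProd_le hc hs N hM Q)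
  simp only [Module.finrank_prod, finrank_euclideanSpace, Fintype.card_fin]
  exact_mod_cast (by omega : d + d < N)

theorem fourierProd_inversion (z : Rn d × Rn d) :
    h z = ∫ Q, (𝐞 (pair z Q) : ℂ) * fourierProd h Q := by
  have hi := integrable_fourierProd hc hs
  have e : (fun v : WithLp 2 (Rn d × Rn d) => fourierProd h (WithLp.ofLp v)) =
      𝓕 (fun v : WithLp 2 (Rn d × Rn d) => h (WithLp.ofLp v)) := by
    ext v; rw [fourierProd_eq]
  have h1 := Continuous.fourierInv_fourier_eq
    (f := fun v : WithLp 2 (Rn d × Rn d) => h (WithLp.ofLp v))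
    (hc.continuous.comp (WithLp.prod_continuous_ofLp 2 _ _))
    (integrable_comp_ofLp.2 (hc.continuous.integrable_of_hasCompactSupport hs))
    (by rw [← e]; exact integrable_comp_ofLp.2 hi)
  have h2 := congrFun h1 (WithLp.toLp 2 z)
  rw [← e, Real.fourierInv_eq] at h2
  rw [← show _ = h z from h2, ← integral_comp_ofLp (fun Q => (𝐞 (pair z Q) : ℂ) * fourierProd h Q)]
  refine integral_congr_ae (Eventually.of_forall fun v => ?_)
  simp [pair, Circle.smul_def, real_inner_comm]

end PhaseFourier

/-! ### Midpoint and difference coordinates -/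

section Midpoint

/-- `(m, t) ↦ (m + t/2, m - t/2)`. -/
def endpoints (z : Rn d × Rn d) : Rn d × Rn d :=
  (z.1 + (1 / 2 : ℝ) • z.2, z.1 - (1 / 2 : ℝ) • z.2)

/-- `endpoints` as a linear homeomorphism. -/
def endpointsEquiv : (Rn d × Rn d) ≃L[ℝ] (Rn d × Rn d) where
  toFun := endpoints
  map_add' x y := by ext <;> simp [endpoints] <;> ring
  map_smul' c x := by ext <;> simp [endpoints] <;> ring
  invFun z := ((1 / 2 : ℝ) • (z.1 + z.2), z.1 - z.2)
  left_inv x := by ext <;> simp [endpoints] <;> ring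
  right_inv x := by ext <;> simp [endpoints] <;> ring
  continuous_toFun := by unfold endpoints; fun_prop
  continuous_invFun := by fun_prop

/-- The map factors into coordinate swaps, a shear and a reflected shear, each of which preserves
volume. -/
theorem measurePreserving_endpoints :
    MeasurePreserving (endpoints : Rn d × Rn d → Rn d × Rn d) volume volume := by
  have h1 : MeasurePreserving (fun z : Rn d × Rn d => (z.1, (1 / 2 : ℝ) • z.1 + z.2))
      (volume.prod volume) (volume.prod volume) :=
    (MeasurePreserving.id _).skew_product (g := fun t m => (1 / 2 : ℝ) • t + m) (by fun_prop)
      (Eventually.of_forall fun t => (measurePreserving_add_left volume ((1 / 2 : ℝ) • t)).map_eq)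
  have h2 : MeasurePreserving (fun z : Rn d × Rn d => (z.1, z.1 - z.2))
      (volume.prod volume) (volume.prod volume) :=
    (MeasurePreserving.id _).skew_product (g := fun x t => x - t) (by fun_prop)
      (Eventually.of_forall fun x => (Measure.measurePreserving_sub_left volume x).map_eq)
  have h3 := h2.comp (Measure.measurePreserving_swap.comp (h1.comp
    (Measure.measurePreserving_swap (μ := (volume : Measure (Rn d))) (ν := (volume : Measure (Rn d))))))
  have e : (endpoints : Rn d × Rn d → Rn d × Rn d) =
      (fun z => (z.1, z.1 - z.2)) ∘ Prod.swap ∘ (fun z => (z.1, (1 / 2 : ℝ) • z.1 + z.2)) ∘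
        Prod.swap := by
    funext z
    simp only [endpoints, Function.comp, Prod.swap, Prod.mk.injEq]
    constructor <;> module
  rw [e]
  exact h3

theorem integral_comp_endpoints {G : Type*} [NormedAddCommGroup G] [NormedSpace ℝ G]
    (f : Rn d × Rn d → G) : ∫ z, f (endpoints z) = ∫ z, f z :=
  measurePreserving_endpoints.integral_comp
    (endpointsEquiv (d := d)).toHomeomorph.measurableEmbedding f

theorem integrable_comp_endpoints {G : Type*} [NormedAddCommGroup G]
    {f : Rn d × Rn d → G} : Integrable (fun z => f (endpoints z)) ↔ Integrable f :=
  measurePreserving_endpoints.integrable_comp_emb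
    (endpointsEquiv (d := d)).toHomeomorph.measurableEmbedding

end Midpoint


/-! ### Cross-Wigner functions -/

section Wigner

variable {d : ℕ}

theorem char_add (a b : ℝ) : (𝐞 (a + b) : ℂ) = 𝐞 a * 𝐞 b := by
  rw [AddChar.map_add_eq_mul]; simp

theorem conj_char (a : ℝ) : conj (𝐞 a : ℂ) = 𝐞 (-a) := by
  rw [AddChar.map_neg_eq_inv, Circle.coe_inv_eq_conj]

theorem norm_char (a : ℝ) : ‖(𝐞 a : ℂ)‖ = 1 := Circle.norm_coe _

/-- The cross-Wigner function of `φ` and `ψ`. -/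
def wig (φ ψ : Rn d → ℂ) (z : Rn d × Rn d) : ℂ :=
  ∫ t, (𝐞 ⟪z.2, t⟫_ℝ : ℂ) * (φ (z.1 - (1 / 2 : ℝ) • t) * conj (ψ (z.1 + (1 / 2 : ℝ) • t)))

theorem wig_conj (φ ψ : Rn d → ℂ) (z : Rn d × Rn d) : wig ψ φ z = conj (wig φ ψ z) := by
  rw [wig, wig, ← integral_conj, ← integral_neg_eq_self]
  refine integral_congr_ae (Eventually.of_forall fun t => ?_)
  simp only [map_mul, conj_char, smul_neg, sub_neg_eq_add, inner_neg_right, Complex.conj_conj,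
    ← sub_eq_add_neg]
  ring

/-- The character `x ↦ 𝐞 ⟨q, x⟩`. -/
def modul (q x : Rn d) : ℂ := (𝐞 ⟪q, x⟫_ℝ : ℂ)

/-- The two uses are the extreme cases: `r = q` is a pure translation in ξ, and `r = -q` is
multiplication by a character in x with no translation. -/
theorem wig_modul (q r : Rn d) (φ ψ : Rn d → ℂ) (z : Rn d × Rn d) :
    wig (fun x => modul q x * φ x) (fun x => modul r x * ψ x) z =
      modul (q - r) z.1 * wig φ ψ (z.1, z.2 - (1 / 2 : ℝ) • (q + r)) := by
  rw [wig, wig, ← integral_const_mul]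
  refine integral_congr_ae (Eventually.of_forall fun t => ?_)
  simp only [modul, map_mul, conj_char]
  have : (𝐞 ⟪z.2, t⟫_ℝ : ℂ) * 𝐞 ⟪q, z.1 - (1 / 2 : ℝ) • t⟫_ℝ * 𝐞 (-⟪r, z.1 + (1 / 2 : ℝ) • t⟫_ℝ) =
      𝐞 ⟪q - r, z.1⟫_ℝ * 𝐞 ⟪z.2 - (1 / 2 : ℝ) • (q + r), t⟫_ℝ := by
    rw [← char_add, ← char_add, ← char_add]
    congr 2
    simp only [inner_sub_left, inner_sub_right, inner_add_left, inner_add_right, inner_smul_left,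
      inner_smul_right]
    simp
    ring
  linear_combination (φ (z.1 - (1 / 2 : ℝ) • t) * conj (ψ (z.1 + (1 / 2 : ℝ) • t))) * this

theorem wig_translate (b : Rn d) (φ ψ : Rn d → ℂ) (z : Rn d × Rn d) :
    wig (fun x => φ (x - b)) (fun x => ψ (x - b)) z = wig φ ψ (z.1 - b, z.2) := by
  rw [wig, wig]
  refine integral_congr_ae (Eventually.of_forall fun t => ?_)
  simp only [sub_right_comm, add_sub_right_comm]

/-- The complex conjugate of a Schwartz function. -/
def conjSM (ψ : 𝓢(Rn d, ℂ)) : 𝓢(Rn d, ℂ) :=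
  SchwartzMap.postcompCLM (𝕜 := ℝ) (Complex.conjCLE : ℂ →L[ℝ] ℂ) ψ

/-- The Schwartz function `(x, y) ↦ f x * g y`. -/
def tensorSM (f g : 𝓢(Rn d, ℂ)) : 𝓢(Rn d × Rn d, ℂ) where
  toFun z := f z.1 * g z.2
  smooth' := (f.smooth'.comp contDiff_fst).mul (g.smooth'.comp contDiff_snd)
  decay' k n := by
    let p : 𝓢(Rn d, ℂ) → ℕ → ℕ → ℝ := fun f k n => SchwartzMap.seminorm ℝ k n f
    refine ⟨∑ i ∈ Finset.range (n + 1), (n.choose i : ℝ) *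
      (p f k i * p g 0 (n - i) + p f 0 i * p g k (n - i)), fun z => ?_⟩
    have h1 := norm_iteratedFDeriv_mul_le (𝕜 := ℝ) (N := ∞) (f.smooth'.comp contDiff_fst)
      (g.smooth'.comp contDiff_snd) z (n := n) (by exact_mod_cast le_top)
    refine (mul_le_mul_of_nonneg_left h1 (by positivity)).trans ?_
    rw [Finset.mul_sum]
    refine Finset.sum_le_sum fun i _ => ?_
    have hf : ‖iteratedFDeriv ℝ i (fun y : Rn d × Rn d => f.toFun y.1) z‖ ≤
        ‖iteratedFDeriv ℝ i f z.1‖ :=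
      norm_iteratedFDeriv_comp_clm_le f.smooth' (ContinuousLinearMap.fst ℝ (Rn d) (Rn d))
        (ContinuousLinearMap.norm_fst_le ..) i z
    have hg : ‖iteratedFDeriv ℝ (n - i) (fun y : Rn d × Rn d => g.toFun y.2) z‖ ≤
        ‖iteratedFDeriv ℝ (n - i) g z.2‖ :=
      norm_iteratedFDeriv_comp_clm_le g.smooth' (ContinuousLinearMap.snd ℝ (Rn d) (Rn d))
        (ContinuousLinearMap.norm_snd_le ..) (n - i) z
    have hz : ‖z‖ ^ k ≤ ‖z.1‖ ^ k + ‖z.2‖ ^ k := by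
      rcases le_total ‖z.1‖ ‖z.2‖ with h | h
      · rw [Prod.norm_def, max_eq_right h]; exact le_add_of_nonneg_left (by positivity)
      · rw [Prod.norm_def, max_eq_left h]; exact le_add_of_nonneg_right (by positivity)
    have a1 : ‖z.1‖ ^ k * ‖iteratedFDeriv ℝ i f z.1‖ ≤ p f k i := SchwartzMap.le_seminorm ℝ k i f z.1
    have a2 : ‖z.2‖ ^ k * ‖iteratedFDeriv ℝ (n - i) g z.2‖ ≤ p g k (n - i) :=
      SchwartzMap.le_seminorm ℝ k (n - i) g z.2
    have a3 : ‖iteratedFDeriv ℝ i f z.1‖ ≤ p f 0 i :=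
      SchwartzMap.norm_iteratedFDeriv_le_seminorm ℝ f i z.1
    have a4 : ‖iteratedFDeriv ℝ (n - i) g z.2‖ ≤ p g 0 (n - i) :=
      SchwartzMap.norm_iteratedFDeriv_le_seminorm ℝ g (n - i) z.2
    calc ‖z‖ ^ k * ((n.choose i : ℝ) * ‖iteratedFDeriv ℝ i (fun y : Rn d × Rn d => f.toFun y.1) z‖ *
            ‖iteratedFDeriv ℝ (n - i) (fun y : Rn d × Rn d => g.toFun y.2) z‖)
        ≤ (‖z.1‖ ^ k + ‖z.2‖ ^ k) * ((n.choose i : ℝ) * ‖iteratedFDeriv ℝ i f z.1‖ *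
            ‖iteratedFDeriv ℝ (n - i) g z.2‖) := by gcongr
      _ = (n.choose i : ℝ) * ((‖z.1‖ ^ k * ‖iteratedFDeriv ℝ i f z.1‖) *
            ‖iteratedFDeriv ℝ (n - i) g z.2‖ + ‖iteratedFDeriv ℝ i f z.1‖ *
            (‖z.2‖ ^ k * ‖iteratedFDeriv ℝ (n - i) g z.2‖)) := by ring
      _ ≤ _ := by gcongr

/-- The Schwartz function `(m, t) ↦ φ (m - t/2) * conj (ψ (m + t/2))`. -/
def midSM (φ ψ : 𝓢(Rn d, ℂ)) : 𝓢(Rn d × Rn d, ℂ) :=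
  SchwartzMap.compCLMOfContinuousLinearEquiv ℝ endpointsEquiv (tensorSM (conjSM ψ) φ)

theorem midSM_apply (φ ψ : 𝓢(Rn d, ℂ)) (m t : Rn d) :
    midSM φ ψ (m, t) = φ (m - (1 / 2 : ℝ) • t) * conj (ψ (m + (1 / 2 : ℝ) • t)) :=
  mul_comm _ _

theorem wig_eq_integral_midSM (φ ψ : 𝓢(Rn d, ℂ)) (z : Rn d × Rn d) :
    wig φ ψ z = ∫ t, (𝐞 ⟪z.2, t⟫_ℝ : ℂ) * midSM φ ψ (z.1, t) := by
  simp only [wig, midSM_apply]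

theorem wig_eq_fourier (φ ψ : 𝓢(Rn d, ℂ)) (z : Rn d × Rn d) :
    wig φ ψ z = 𝓕 (fun t => midSM φ ψ (z.1, t)) (-z.2) := by
  rw [wig_eq_integral_midSM, Real.fourier_eq]
  refine integral_congr_ae (Eventually.of_forall fun t => ?_)
  simp [Circle.smul_def, real_inner_comm]

/-- Restricting a Schwartz function on phase space to a fibre. -/
theorem norm_iteratedFDeriv_fibre_le (Φ : 𝓢(Rn d × Rn d, ℂ)) (k N : ℕ) :
    ∃ C, 0 ≤ C ∧ ∀ m t, ‖iteratedFDeriv ℝ k (fun t => Φ (m, t)) t‖ ≤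
      C * (1 + ‖m‖) ^ (-(N : ℝ)) * (1 + ‖t‖) ^ (-(N : ℝ)) := by
  refine ⟨2 ^ (2 * N) * ((Finset.Iic (2 * N, k)).sup fun m => SchwartzMap.seminorm ℝ m.1 m.2) Φ,
    by positivity, fun m t => ?_⟩
  have h1 : ‖iteratedFDeriv ℝ k (fun t => Φ (m, t)) t‖ ≤ ‖iteratedFDeriv ℝ k Φ (m, t)‖ := by
    have h2 := norm_iteratedFDeriv_comp_clm_le
      (f := fun z => Φ (z + ((m, 0) : Rn d × Rn d)))
      (Φ.smooth'.comp (contDiff_id.add contDiff_const)) (ContinuousLinearMap.inr ℝ (Rn d) (Rn d))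
      (ContinuousLinearMap.norm_inr_le_one ..) k t
    rw [iteratedFDeriv_comp_add_right] at h2
    simpa using h2
  have h3 := SchwartzMap.one_add_le_sup_seminorm_apply (𝕜 := ℝ) (m := (2 * N, k)) le_rfl le_rfl Φ
    (m, t)
  rw [Real.rpow_neg (by positivity), Real.rpow_neg (by positivity), Real.rpow_natCast,
    Real.rpow_natCast, mul_assoc, ← mul_inv, ← div_eq_mul_inv, le_div_iff₀ (by positivity)]
  refine le_trans ?_ h3
  rw [mul_comm]
  refine mul_le_mul ?_ h1 (norm_nonneg _) (by positivity)
  rw [two_mul N, pow_add]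
  gcongr
  · exact le_max_left _ _
  · exact le_max_right _ _

theorem integrable_decay : Integrable (fun x : Rn d => (1 + ‖x‖) ^ (-((d + 1 : ℕ) : ℝ))) :=
  integrable_one_add_norm (by simp)

/-- On each fibre the Wigner function is the Fourier transform of a Schwartz function, which gives
the decay in ξ; the fibre bounds themselves decay in x. The exponent d + 1 in each variable is
enough for integrability. -/
theorem norm_wig_le (φ ψ : 𝓢(Rn d, ℂ)) : ∃ C, ∀ z, ‖wig φ ψ z‖ ≤
    C * ((1 + ‖z.1‖) ^ (-((d + 1 : ℕ) : ℝ)) * (1 + ‖z.2‖) ^ (-((d + 1 : ℕ) : ℝ))) := by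
  set N := d + 1
  have h := fun k => norm_iteratedFDeriv_fibre_le (midSM φ ψ) k N
  choose C hC0 hC using h
  set I := ∫ x : Rn d, (1 + ‖x‖) ^ (-(N : ℝ))
  have hI : 0 ≤ I := integral_nonneg fun x => by positivity
  refine ⟨4 ^ N * (N + 2) * ((∑ k ∈ Finset.range (N + 1), C k) * I), fun z => ?_⟩
  have hsm : ContDiff ℝ ∞ (fun t => midSM φ ψ (z.1, t)) :=
    (midSM φ ψ).smooth'.comp (contDiff_const.prodMk contDiff_id)
  have hi : ∀ k, Integrable (iteratedFDeriv ℝ k (fun t => midSM φ ψ (z.1, t))) := fun k =>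
    (integrable_decay.const_mul (C k * (1 + ‖z.1‖) ^ (-(N : ℝ)))).mono'
      (hsm.continuous_iteratedFDeriv (by exact_mod_cast le_top)).aestronglyMeasurable
      (Eventually.of_forall fun t => hC k z.1 t)
  have := norm_fourier_le_of_integral_le N hsm (fun k _ => hi k)
    (M := (∑ k ∈ Finset.range (N + 1), C k) * (1 + ‖z.1‖) ^ (-(N : ℝ)) * I) ?_ (-z.2)
  · rw [wig_eq_fourier]
    refine this.trans (le_of_eq ?_)
    rw [norm_neg]
    ring
  · intro k hk
    calc _ ≤ ∫ t, C k * (1 + ‖z.1‖) ^ (-(N : ℝ)) * (1 + ‖t‖) ^ (-(N : ℝ)) :=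
          integral_mono (hi k).norm (integrable_decay.const_mul _) (hC k z.1)
      _ = C k * (1 + ‖z.1‖) ^ (-(N : ℝ)) * I := by rw [integral_const_mul]
      _ ≤ _ := by
        gcongr
        exact Finset.single_le_sum (fun i _ => hC0 i) (Finset.mem_range.2 (by omega))

theorem aestronglyMeasurable_wig {φ ψ : Rn d → ℂ} (hφ : Continuous φ) (hψ : Continuous ψ) :
    AEStronglyMeasurable (wig φ ψ) := by
  have hc : Continuous (fun p : (Rn d × Rn d) × Rn d => (𝐞 ⟪p.1.2, p.2⟫_ℝ : ℂ) *
      (φ (p.1.1 - (1 / 2 : ℝ) • p.2) * conj (ψ (p.1.1 + (1 / 2 : ℝ) • p.2)))) := by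
    have := continuous_char
    fun_prop
  exact hc.stronglyMeasurable.integral_prod_right.aestronglyMeasurable

theorem integrable_wig (φ ψ : 𝓢(Rn d, ℂ)) : Integrable (wig φ ψ) := by
  obtain ⟨C, hC⟩ := norm_wig_le φ ψ
  exact ((integrable_decay.mul_prod integrable_decay).const_mul C).mono'
    (aestronglyMeasurable_wig φ.continuous ψ.continuous) (Eventually.of_forall hC)

end Wigner


/-! ### Gaussian wave packets -/

section WavePackets

variable {d : ℕ}

/-- The Gaussian `exp (-r |x|²)`. -/
def gauss (r : ℝ) (x : Rn d) : ℝ := Real.exp (-r * ‖x‖ ^ 2)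

theorem gauss_pos (r : ℝ) (x : Rn d) : 0 < gauss r x := Real.exp_pos _

theorem gauss_le_one {r : ℝ} (hr : 0 ≤ r) (x : Rn d) : gauss r x ≤ 1 :=
  Real.exp_le_one_iff.2 (by have := mul_nonneg hr (sq_nonneg ‖x‖); linarith)

theorem continuous_gauss (r : ℝ) : Continuous (gauss r : Rn d → ℝ) := by
  unfold gauss; fun_prop

theorem integrable_gauss {r : ℝ} (hr : 0 < r) : Integrable (gauss r : Rn d → ℝ) := by
  have h := GaussianFourier.integrable_cexp_neg_mul_sq_norm_add (V := Rn d) (b := r)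
    (by simpa using hr) 0 0
  refine h.re.congr (Eventually.of_forall fun x => ?_)
  simp only [zero_mul, add_zero, gauss]
  rw [show (-(r : ℂ) * (‖x‖ : ℂ) ^ 2) = ((-r * ‖x‖ ^ 2 : ℝ) : ℂ) by push_cast; ring]
  exact Complex.exp_ofReal_re _

/-- The normalisation of the Fourier transform of `gauss (2π)`. -/
def gaussConst (d : ℕ) : ℂ := (Real.pi / (2 * Real.pi : ℝ)) ^ (d / 2 : ℂ)

theorem integral_char_gauss (s κ : Rn d) :
    ∫ ξ, (𝐞 ⟪ξ, s⟫_ℝ : ℂ) * (gauss (2 * Real.pi) (ξ - κ) : ℂ) =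
      gaussConst d * 𝐞 ⟪κ, s⟫_ℝ * (gauss (Real.pi / 2) s : ℂ) := by
  have h := fourier_gaussian_innerProductSpace (V := Rn d) (b := (2 * Real.pi : ℝ))
    (by simpa using Real.pi_pos) (-s)
  rw [Real.fourier_eq] at h
  rw [← integral_add_right_eq_self _ κ]
  have h1 : ∀ ξ : Rn d, (𝐞 ⟪ξ + κ, s⟫_ℝ : ℂ) * (gauss (2 * Real.pi) (ξ + κ - κ) : ℂ) =
      𝐞 ⟪κ, s⟫_ℝ * (𝐞 (-⟪ξ, -s⟫_ℝ) • Complex.exp (-((2 * Real.pi : ℝ) : ℂ) * ‖ξ‖ ^ 2)) := by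
    intro ξ
    rw [inner_add_left, char_add, add_sub_cancel_right, inner_neg_right, neg_neg, Circle.smul_def,
      gauss]
    push_cast
    rw [smul_eq_mul]
    ring
  simp_rw [h1]
  rw [integral_const_mul, h, gaussConst, gauss, finrank_euclideanSpace, Fintype.card_fin, norm_neg]
  push_cast
  rw [show -(Real.pi : ℂ) ^ 2 * ‖s‖ ^ 2 / (2 * Real.pi) = -(Real.pi / 2) * ‖s‖ ^ 2 by
    have : (Real.pi : ℂ) ≠ 0 := by exact_mod_cast Real.pi_ne_zero
    field_simp]
  ring

/-- The wave packet transform with Gaussian window. -/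
def packet (φ : Rn d → ℂ) (P : Rn d × Rn d) : ℂ :=
  𝓕 (fun y => (gauss Real.pi (y - P.1) : ℂ) * φ y) P.2

theorem integrable_gauss_mul {r : ℝ} (hr : 0 ≤ r) (p : Rn d) {φ : Rn d → ℂ} (hφ : Integrable φ) :
    Integrable (fun y => (gauss r (y - p) : ℂ) * φ y) := by
  refine hφ.bdd_mul (c := 1) ?_ (Eventually.of_forall fun y => ?_)
  · exact (Complex.continuous_ofReal.comp
      ((continuous_gauss r).comp (continuous_sub_right p))).aestronglyMeasurable
  · rw [Complex.norm_real, Real.norm_of_nonneg (gauss_pos _ _).le]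
    exact gauss_le_one hr _

/-- The Gaussian window on phase space. -/
def window (z : Rn d × Rn d) : ℝ := gauss (2 * Real.pi) z.1 * gauss (2 * Real.pi) z.2

/-- The Gaussian wave packet symbols. -/
def elemSymbol (P Q z : Rn d × Rn d) : ℂ := 𝐞 (pair z Q) * (window (z - P) : ℂ)

theorem window_nonneg (z : Rn d × Rn d) : 0 ≤ window z :=
  mul_nonneg (gauss_pos _ _).le (gauss_pos _ _).le

theorem window_le_one (z : Rn d × Rn d) : window z ≤ 1 :=
  mul_le_one₀ (gauss_le_one (by positivity) _) (gauss_pos _ _).le (gauss_le_one (by positivity) _)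

theorem continuous_window : Continuous (window : Rn d × Rn d → ℝ) :=
  ((continuous_gauss _).comp continuous_fst).mul ((continuous_gauss _).comp continuous_snd)

theorem integrable_window : Integrable (window : Rn d × Rn d → ℝ) :=
  (integrable_gauss (by positivity)).mul_prod (integrable_gauss (by positivity))

theorem norm_elemSymbol (P Q z : Rn d × Rn d) : ‖elemSymbol P Q z‖ = window (z - P) := by
  rw [elemSymbol, norm_mul, norm_char, one_mul, Complex.norm_real,
    Real.norm_of_nonneg (window_nonneg _)]

theorem continuous_elemSymbol : Continuous fun p : ((Rn d × Rn d) × (Rn d × Rn d)) × (Rn d × Rn d) =>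
    elemSymbol p.1.1 p.1.2 p.2 := by
  unfold elemSymbol
  refine (continuous_char.comp (continuous_pair.comp (by fun_prop : Continuous
    fun p : ((Rn d × Rn d) × (Rn d × Rn d)) × (Rn d × Rn d) => (p.2, p.1.2)))).mul
    (Complex.continuous_ofReal.comp (continuous_window.comp (by fun_prop)))

/-- The parallelogram law separates midpoint and difference into the two endpoints. This is what
dictates the widths: `2π` for the window, whose Fourier transform has width parameter `π / 2`, and
`π` for the packets. -/
theorem gauss_parallelogram (x y p b : Rn d) :
    gauss (2 * Real.pi) ((1 / 2 : ℝ) • (x + y) - p) * gauss (Real.pi / 2) (x - y + b) =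
      gauss Real.pi (x - (p - (1 / 2 : ℝ) • b)) * gauss Real.pi (y - (p + (1 / 2 : ℝ) • b)) := by
  unfold gauss
  rw [← Real.exp_add, ← Real.exp_add]
  congr 1
  have h := parallelogram_law_with_norm ℝ (x - (p - (1 / 2 : ℝ) • b)) (y - (p + (1 / 2 : ℝ) • b))
  have h1 : x - (p - (1 / 2 : ℝ) • b) + (y - (p + (1 / 2 : ℝ) • b)) =
      (2 : ℝ) • ((1 / 2 : ℝ) • (x + y) - p) := by module
  have h2 : x - (p - (1 / 2 : ℝ) • b) - (y - (p + (1 / 2 : ℝ) • b)) = x - y + b := by module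
  rw [h1, h2, norm_smul, Real.norm_ofNat] at h
  linear_combination (-Real.pi / 2) * h

/-- A modulated Gaussian symbol quantizes to a multiple of a rank-one operator between Gaussian
packets. Integrating out ξ produces a Gaussian in the difference variable, and `gauss_parallelogram`
then decouples the two endpoints. -/
theorem integral_elemSymbol_wig (φ ψ : 𝓢(Rn d, ℂ)) (P Q : Rn d × Rn d) :
    ∫ z, elemSymbol P Q z * wig φ ψ z = gaussConst d * 𝐞 ⟪P.2, Q.2⟫_ℝ *
      (conj (packet ψ (P.1 - (1 / 2 : ℝ) • Q.2, P.2 + (1 / 2 : ℝ) • Q.1)) *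
        packet φ (P.1 + (1 / 2 : ℝ) • Q.2, P.2 - (1 / 2 : ℝ) • Q.1)) := by
  obtain ⟨p, κ⟩ := P
  obtain ⟨α, β⟩ := Q
  simp only
  -- the amplitude after performing the integral in `ξ`
  let f : Rn d × Rn d → ℂ := fun w => gaussConst d * 𝐞 ⟪κ, β⟫_ℝ *
    ((𝐞 ⟪w.1, κ + (1 / 2 : ℝ) • α⟫_ℝ * ((gauss Real.pi (w.1 - (p - (1 / 2 : ℝ) • β)) : ℂ) *
        conj (ψ w.1))) *
      (𝐞 (-⟪w.2, κ - (1 / 2 : ℝ) • α⟫_ℝ) * ((gauss Real.pi (w.2 - (p + (1 / 2 : ℝ) • β)) : ℂ) *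
        φ w.2)))
  have hchar : ∀ (g : Rn d → ℝ), Continuous g → ∀ {u : Rn d → ℂ}, Integrable u →
      Integrable fun x => (𝐞 (g x) : ℂ) * u x := fun g hg u hu =>
    hu.bdd_mul (c := 1) (continuous_char.comp hg).aestronglyMeasurable
      (Eventually.of_forall fun x => (norm_char _).le)
  have hψi : Integrable (fun x => conj (ψ x)) := (conjSM ψ).integrable
  have hf1 : Integrable (fun x => (𝐞 ⟪x, κ + (1 / 2 : ℝ) • α⟫_ℝ : ℂ) *
      ((gauss Real.pi (x - (p - (1 / 2 : ℝ) • β)) : ℂ) * conj (ψ x))) :=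
    hchar (fun x => ⟪x, κ + (1 / 2 : ℝ) • α⟫_ℝ) (by fun_prop)
      (integrable_gauss_mul Real.pi_pos.le _ hψi)
  have hf2 : Integrable (fun y => (𝐞 (-⟪y, κ - (1 / 2 : ℝ) • α⟫_ℝ) : ℂ) *
      ((gauss Real.pi (y - (p + (1 / 2 : ℝ) • β)) : ℂ) * φ y)) :=
    hchar (fun y => -⟪y, κ - (1 / 2 : ℝ) • α⟫_ℝ) (by fun_prop)
      (integrable_gauss_mul Real.pi_pos.le _ φ.integrable)
  have hf : Integrable f := (hf1.mul_prod hf2).const_mul _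
  -- In midpoint coordinates the decoupled integrand equals what the ξ-integration of the packet
  -- symbol leaves behind.
  have hfe : ∀ m t, f (endpoints (m, t)) = 𝐞 ⟪m, α⟫_ℝ * (gauss (2 * Real.pi) (m - p) : ℂ) *
      (midSM φ ψ (m, t) * (gaussConst d * 𝐞 ⟪κ, t + β⟫_ℝ * (gauss (Real.pi / 2) (t + β) : ℂ))) := by
    intro m t
    have hg := gauss_parallelogram (m + (1 / 2 : ℝ) • t) (m - (1 / 2 : ℝ) • t) p β
    rw [show (1 / 2 : ℝ) • (m + (1 / 2 : ℝ) • t + (m - (1 / 2 : ℝ) • t)) = m by module,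
      show m + (1 / 2 : ℝ) • t - (m - (1 / 2 : ℝ) • t) = t by module] at hg
    have hg' := congrArg (fun r : ℝ => (r : ℂ)) hg
    simp only [Complex.ofReal_mul] at hg'
    have hp : (𝐞 ⟪κ, β⟫_ℝ : ℂ) * 𝐞 ⟪m + (1 / 2 : ℝ) • t, κ + (1 / 2 : ℝ) • α⟫_ℝ *
        𝐞 (-⟪m - (1 / 2 : ℝ) • t, κ - (1 / 2 : ℝ) • α⟫_ℝ) = 𝐞 ⟪m, α⟫_ℝ * 𝐞 ⟪κ, t + β⟫_ℝ := by
      rw [← char_add, ← char_add, ← char_add]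
      congr 2
      simp only [inner_sub_left, inner_sub_right, inner_add_left, inner_add_right, inner_smul_left,
        inner_smul_right, real_inner_comm κ]
      simp
      ring
    simp only [f, endpoints, midSM_apply]
    linear_combination (gaussConst d * conj (ψ (m + (1 / 2 : ℝ) • t)) * φ (m - (1 / 2 : ℝ) • t)) *
      ((gauss Real.pi (m + (1 / 2 : ℝ) • t - (p - (1 / 2 : ℝ) • β)) : ℂ) *
        (gauss Real.pi (m - (1 / 2 : ℝ) • t - (p + (1 / 2 : ℝ) • β)) : ℂ) * hp -
        𝐞 ⟪m, α⟫_ℝ * 𝐞 ⟪κ, t + β⟫_ℝ * hg')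
  have hR : ∫ w, f w = gaussConst d * 𝐞 ⟪κ, β⟫_ℝ *
      (conj (packet ψ (p - (1 / 2 : ℝ) • β, κ + (1 / 2 : ℝ) • α)) *
        packet φ (p + (1 / 2 : ℝ) • β, κ - (1 / 2 : ℝ) • α)) := by
    simp only [f]
    rw [integral_const_mul, Measure.volume_eq_prod, integral_prod_mul
      (fun x => (𝐞 ⟪x, κ + (1 / 2 : ℝ) • α⟫_ℝ : ℂ) *
      ((gauss Real.pi (x - (p - (1 / 2 : ℝ) • β)) : ℂ) * conj (ψ x)))
      (fun y => (𝐞 (-⟪y, κ - (1 / 2 : ℝ) • α⟫_ℝ) : ℂ) *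
      ((gauss Real.pi (y - (p + (1 / 2 : ℝ) • β)) : ℂ) * φ y))]
    congr 2
    · rw [packet, Real.fourier_eq, ← integral_conj]
      refine integral_congr_ae (Eventually.of_forall fun x => ?_)
      simp [Circle.smul_def]
  rw [← hR, ← integral_comp_endpoints f]
  have hL : Integrable (fun z => elemSymbol (p, κ) (α, β) z * wig φ ψ z) := by
    refine (integrable_wig φ ψ).bdd_mul (c := 1) ?_ (Eventually.of_forall fun z => ?_)
    · exact (continuous_elemSymbol.comp (by fun_prop :
        Continuous fun z => ((((p, κ), (α, β)) : (Rn d × Rn d) × (Rn d × Rn d)), z))).aestronglyMeasurable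
    · rw [norm_elemSymbol]; exact window_le_one _
  rw [Measure.volume_eq_prod, integral_prod _ hL,
    integral_prod _ (integrable_comp_endpoints.2 hf)]
  refine integral_congr_ae (Eventually.of_forall fun m => ?_)
  simp only [hfe]
  rw [integral_const_mul]
  have e1 : ∀ ξ, elemSymbol (p, κ) (α, β) (m, ξ) * wig φ ψ (m, ξ) =
      𝐞 ⟪m, α⟫_ℝ * (gauss (2 * Real.pi) (m - p) : ℂ) *
        ∫ t, 𝐞 ⟪ξ, t + β⟫_ℝ * (gauss (2 * Real.pi) (ξ - κ) : ℂ) * midSM φ ψ (m, t) := by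
    intro ξ
    have : ∀ t, (𝐞 ⟪ξ, t + β⟫_ℝ : ℂ) * (gauss (2 * Real.pi) (ξ - κ) : ℂ) * midSM φ ψ (m, t) =
        (𝐞 ⟪ξ, β⟫_ℝ * (gauss (2 * Real.pi) (ξ - κ) : ℂ)) * (𝐞 ⟪ξ, t⟫_ℝ * midSM φ ψ (m, t)) := by
      intro t
      rw [inner_add_right, char_add]
      ring
    simp_rw [this]
    rw [integral_const_mul, wig_eq_integral_midSM, elemSymbol, window, pair, char_add]
    simp only [Prod.mk_sub_mk, Complex.ofReal_mul]
    ring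
  simp_rw [e1]
  rw [integral_const_mul]
  congr 1
  have hΦ : Integrable (fun t => midSM φ ψ (m, t)) := by
    obtain ⟨C, _, hC⟩ := norm_iteratedFDeriv_fibre_le (midSM φ ψ) 0 (d + 1)
    refine (integrable_decay.const_mul (C * (1 + ‖m‖) ^ (-((d + 1 : ℕ) : ℝ)))).mono'
      ((midSM φ ψ).continuous.comp (by fun_prop)).aestronglyMeasurable
      (Eventually.of_forall fun t => ?_)
    simpa using hC m t
  rw [integral_integral_swap]
  · refine integral_congr_ae (Eventually.of_forall fun t => ?_)
    simp only
    rw [integral_mul_const, integral_char_gauss, mul_comm]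
  · have h2 : Integrable (fun x : Rn d × Rn d =>
        (gauss (2 * Real.pi) (x.1 - κ) : ℂ) * midSM φ ψ (m, x.2)) (volume.prod volume) :=
      Integrable.mul_prod (f := fun ξ => (gauss (2 * Real.pi) (ξ - κ) : ℂ))
        (((integrable_gauss (by positivity)).comp_sub_right κ).ofReal) hΦ
    have h3 := h2.bdd_mul (c := 1) (f := fun x : Rn d × Rn d => (𝐞 ⟪x.1, x.2 + β⟫_ℝ : ℂ))
      (continuous_char.comp (by fun_prop)).aestronglyMeasurable
      (Eventually.of_forall fun x => (norm_char _).le)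
    refine h3.congr (Eventually.of_forall fun x => ?_)
    simp only [Function.uncurry]
    ring

theorem stronglyMeasurable_packet {φ : Rn d → ℂ} (hφ : Continuous φ) :
    StronglyMeasurable (packet φ) := by
  have hc : Continuous (fun p : (Rn d × Rn d) × Rn d => (𝐞 (-⟪p.2, p.1.2⟫_ℝ) : ℂ) *
      ((gauss Real.pi (p.2 - p.1.1) : ℂ) * φ p.2)) := by
    have := continuous_char
    have := continuous_gauss (d := d) Real.pi
    fun_prop
  have h : packet φ = fun P => ∫ y, (𝐞 (-⟪y, P.2⟫_ℝ) : ℂ) *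
      ((gauss Real.pi (y - P.1) : ℂ) * φ y) := by
    funext P
    simp only [packet, Real.fourier_eq, Circle.smul_def, smul_eq_mul]
  rw [h]
  exact hc.stronglyMeasurable.integral_prod_right

/-- Plancherel in the frequency variable for each fixed centre, then Tonelli: integrating over the
centre leaves the mass of the squared Gaussian. -/
theorem lintegral_packet_sq (φ : 𝓢(Rn d, ℂ)) :
    ∫⁻ P, ‖packet φ P‖ₑ ^ 2 = (∫⁻ x : Rn d, ‖gauss Real.pi x‖ₑ ^ 2) * ∫⁻ x, ‖φ x‖ₑ ^ 2 := by
  have hm := (stronglyMeasurable_packet φ.continuous).measurable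
  rw [Measure.volume_eq_prod, lintegral_prod _ (by fun_prop)]
  have h1 : ∀ p : Rn d, ∫⁻ κ, ‖packet φ (p, κ)‖ₑ ^ 2 =
      ∫⁻ y, ‖gauss Real.pi (y - p)‖ₑ ^ 2 * ‖φ y‖ₑ ^ 2 := by
    intro p
    have hi := integrable_gauss_mul Real.pi_pos.le p φ.integrable
    simp only [packet]
    rw [lintegral_enorm_sq_fourier hi]
    · refine lintegral_congr fun y => ?_
      rw [enorm_mul, mul_pow]
      congr 2
      rw [← ofReal_norm, Complex.norm_real, ofReal_norm]
    · refine (φ.memLp 2).mono hi.aestronglyMeasurable (Eventually.of_forall fun y => ?_)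
      rw [norm_mul, Complex.norm_real, Real.norm_of_nonneg (gauss_pos _ _).le]
      exact mul_le_of_le_one_left (norm_nonneg _) (gauss_le_one Real.pi_pos.le _)
  have hg := (continuous_gauss (d := d) Real.pi).measurable
  have hφ := φ.continuous
  simp_rw [h1]
  rw [lintegral_lintegral_swap (by fun_prop), ← lintegral_const_mul _ (by fun_prop)]
  refine lintegral_congr fun y => ?_
  rw [lintegral_mul_const _ (by fun_prop),
    lintegral_sub_left_eq_self (fun x => ‖gauss Real.pi x‖ₑ ^ 2) y]

theorem eLpNorm_two_eq {α F : Type*} [MeasurableSpace α] {μ : Measure α} [NormedAddCommGroup F]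
    (f : α → F) : eLpNorm f 2 μ = (∫⁻ x, ‖f x‖ₑ ^ 2 ∂μ) ^ (1 / 2 : ℝ) := by
  rw [eLpNorm_eq_lintegral_rpow_enorm_toReal (by norm_num) (by norm_num)]
  simp

theorem lintegral_packet_mul_le (φ ψ : 𝓢(Rn d, ℂ)) (A B : Rn d × Rn d) :
    ∫⁻ P, ‖packet ψ (P + A)‖ₑ * ‖packet φ (P + B)‖ₑ ≤
      (∫⁻ x : Rn d, ‖gauss Real.pi x‖ₑ ^ 2) * (eLpNorm ψ 2 * eLpNorm φ 2) := by
  have hm1 := (stronglyMeasurable_packet φ.continuous).measurable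
  have hm2 := (stronglyMeasurable_packet ψ.continuous).measurable
  have h := ENNReal.lintegral_mul_le_Lp_mul_Lq (volume : Measure (Rn d × Rn d))
    (Real.HolderConjugate.two_two) (f := fun P => ‖packet ψ (P + A)‖ₑ)
    (g := fun P => ‖packet φ (P + B)‖ₑ) (by fun_prop) (by fun_prop)
  refine h.trans (le_of_eq ?_)
  simp only [ENNReal.rpow_ofNat]
  rw [lintegral_add_right_eq_self (fun P => ‖packet ψ P‖ₑ ^ 2) A,
    lintegral_add_right_eq_self (fun P => ‖packet φ P‖ₑ ^ 2) B,
    lintegral_packet_sq, lintegral_packet_sq, eLpNorm_two_eq, eLpNorm_two_eq,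
    ENNReal.mul_rpow_of_nonneg _ _ (by norm_num), ENNReal.mul_rpow_of_nonneg _ _ (by norm_num)]
  have : ∀ t : ℝ≥0∞, t ^ (1 / 2 : ℝ) * t ^ (1 / 2 : ℝ) = t := fun t => by
    rw [← ENNReal.rpow_add_of_nonneg _ _ (by norm_num) (by norm_num)]; norm_num
  rw [mul_mul_mul_comm, this]

/-- The bound is independent of `Q`, since `Q` only translates the arguments of the two packet
transforms and translations disappear after Cauchy–Schwarz in `P`. -/
theorem lintegral_elemSymbol_wig_le (φ ψ : 𝓢(Rn d, ℂ)) (Q : Rn d × Rn d) :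
    ∫⁻ P, ‖∫ z, elemSymbol P Q z * wig φ ψ z‖ₑ ≤
      ‖gaussConst d‖ₑ * ((∫⁻ x : Rn d, ‖gauss Real.pi x‖ₑ ^ 2) * (eLpNorm ψ 2 * eLpNorm φ 2)) := by
  have h := lintegral_packet_mul_le φ ψ (-((1 / 2 : ℝ) • Q.2), (1 / 2 : ℝ) • Q.1)
    ((1 / 2 : ℝ) • Q.2, -((1 / 2 : ℝ) • Q.1))
  refine le_trans (le_of_eq ?_) (mul_le_mul_right h _)
  have hm1 := (stronglyMeasurable_packet φ.continuous).measurable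
  have hm2 := (stronglyMeasurable_packet ψ.continuous).measurable
  rw [← lintegral_const_mul _ (by fun_prop)]
  refine lintegral_congr fun P => ?_
  have h1 : ∀ r : ℝ, ‖(𝐞 r : ℂ)‖ₑ = 1 := fun r => by
    rw [← ofReal_norm, norm_char, ENNReal.ofReal_one]
  have h2 : ∀ z : ℂ, ‖conj z‖ₑ = ‖z‖ₑ := fun z => by
    rw [← ofReal_norm, ← ofReal_norm, RCLike.norm_conj]
  rw [integral_elemSymbol_wig, enorm_mul, enorm_mul, enorm_mul, h1, mul_one, h2]
  simp only [Prod.add_def, sub_eq_add_neg]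

theorem lintegral_gauss_sq_lt_top : ∫⁻ x : Rn d, ‖gauss Real.pi x‖ₑ ^ 2 < ⊤ := by
  refine lt_of_le_of_lt (lintegral_mono fun x => ?_) (integrable_gauss (d := d) Real.pi_pos).2
  rw [sq]
  refine mul_le_of_le_one_left (by simp) ?_
  rw [← ofReal_norm, Real.norm_of_nonneg (gauss_pos _ _).le]
  exact ENNReal.ofReal_le_one.2 (gauss_le_one Real.pi_pos.le _)

end WavePackets


/-! ### The Calderón–Vaillancourt bound -/

section CalderonVaillancourt

variable {d : ℕ}

/-- A smooth compactly supported cut-off on phase space. -/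
def phaseBump (d : ℕ) : ContDiffBump (0 : Rn d × Rn d) := ⟨1, 2, zero_lt_one, one_lt_two⟩

/-- The piece of the symbol `a` near the point `P` of phase space. -/
def localSymbol (a : Rn d × Rn d → ℂ) (P z : Rn d × Rn d) : ℂ := a z * (phaseBump d (z - P) : ℂ)

theorem contDiff_phaseBump : ContDiff ℝ ∞ (fun z : Rn d × Rn d => (phaseBump d z : ℂ)) :=
  Complex.ofRealCLM.contDiff.comp (phaseBump d).contDiff

theorem hasCompactSupport_phaseBump :
    HasCompactSupport (fun z : Rn d × Rn d => (phaseBump d z : ℂ)) :=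
  (phaseBump d).hasCompactSupport.comp_left (g := Complex.ofReal) rfl

theorem contDiff_localSymbol {a : Rn d × Rn d → ℂ} (ha : ContDiff ℝ ∞ a) (P : Rn d × Rn d) :
    ContDiff ℝ ∞ (localSymbol a P) :=
  ha.mul (contDiff_phaseBump.comp (contDiff_id.sub contDiff_const))

theorem hasCompactSupport_localSymbol (a : Rn d × Rn d → ℂ) (P : Rn d × Rn d) :
    HasCompactSupport (localSymbol a P) :=
  (hasCompactSupport_phaseBump.comp_homeomorph (Homeomorph.subRight P)).mul_left

/-- By Leibniz all integrals fall on derivatives of the bump, and translation invariance makes them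
independent of `P`; so sup bounds on the symbol become L¹ bounds on its pieces. -/
theorem exists_integral_localSymbol_le (d N : ℕ) : ∃ C : ℝ, 0 ≤ C ∧
    ∀ a : Rn d × Rn d → ℂ, ContDiff ℝ ∞ a → ∀ M : ℝ,
      (∀ n ≤ N, ∀ z, ‖iteratedFDeriv ℝ n a z‖ ≤ M) → ∀ P, ∀ k ≤ N,
        ∫ z, ‖iteratedFDeriv ℝ k (localSymbol a P) z‖ ≤ C * M := by
  set I : ℕ → ℝ := fun j => ∫ z, ‖iteratedFDeriv ℝ j (fun z : Rn d × Rn d => (phaseBump d z : ℂ)) z‖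
  have hint : ∀ j, Integrable
      (fun z => ‖iteratedFDeriv ℝ j (fun z : Rn d × Rn d => (phaseBump d z : ℂ)) z‖) := fun j =>
    ((contDiff_phaseBump.continuous_iteratedFDeriv
      (by exact_mod_cast le_top)).integrable_of_hasCompactSupport
      (hasCompactSupport_phaseBump.iteratedFDeriv j)).norm
  have hI : ∀ j, 0 ≤ I j := fun j => integral_nonneg fun _ => norm_nonneg _
  refine ⟨∑ k ∈ Finset.range (N + 1), ∑ i ∈ Finset.range (k + 1), (k.choose i : ℝ) * I (k - i),
    Finset.sum_nonneg fun k _ => Finset.sum_nonneg fun i _ => mul_nonneg (by positivity) (hI _), ?_⟩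
  intro a ha M hM P k hk
  have hM0 : 0 ≤ M := (norm_nonneg _).trans (hM 0 (Nat.zero_le _) 0)
  have hle : ∀ z, ‖iteratedFDeriv ℝ k (localSymbol a P) z‖ ≤
      ∑ i ∈ Finset.range (k + 1), (k.choose i : ℝ) * M *
        ‖iteratedFDeriv ℝ (k - i) (fun z : Rn d × Rn d => (phaseBump d z : ℂ)) (z - P)‖ := by
    intro z
    refine (norm_iteratedFDeriv_mul_le (𝕜 := ℝ) (N := ∞) ha
      (contDiff_phaseBump.comp (contDiff_id.sub contDiff_const)) z (n := k)
      (by exact_mod_cast le_top)).trans (Finset.sum_le_sum fun i hi => ?_)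
    have : iteratedFDeriv ℝ (k - i) ((fun z => (phaseBump d z : ℂ)) ∘ fun z => id z - P) z =
        iteratedFDeriv ℝ (k - i) (fun z : Rn d × Rn d => (phaseBump d z : ℂ)) (z - P) :=
      iteratedFDeriv_comp_sub (f := fun z : Rn d × Rn d => (phaseBump d z : ℂ)) (k - i) P z
    rw [this]
    gcongr
    exact hM i (by simp at hi; omega) z
  have hint2 : ∀ i, Integrable (fun z =>
      ‖iteratedFDeriv ℝ (k - i) (fun z : Rn d × Rn d => (phaseBump d z : ℂ)) (z - P)‖) := fun i =>
    (hint (k - i)).comp_sub_right P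
  calc ∫ z, ‖iteratedFDeriv ℝ k (localSymbol a P) z‖
      ≤ ∫ z, ∑ i ∈ Finset.range (k + 1), (k.choose i : ℝ) * M *
        ‖iteratedFDeriv ℝ (k - i) (fun z : Rn d × Rn d => (phaseBump d z : ℂ)) (z - P)‖ :=
        integral_mono_of_nonneg (Eventually.of_forall fun _ => norm_nonneg _)
          (integrable_finsetSum _ fun i _ => (hint2 i).const_mul _) (Eventually.of_forall hle)
    _ = (∑ i ∈ Finset.range (k + 1), (k.choose i : ℝ) * I (k - i)) * M := by
        rw [integral_finsetSum _ fun i _ => (hint2 i).const_mul _, Finset.sum_mul]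
        refine Finset.sum_congr rfl fun i _ => ?_
        rw [integral_const_mul]
        simp only [I]
        rw [integral_sub_right_eq_self (fun z =>
          ‖iteratedFDeriv ℝ (k - i) (fun z : Rn d × Rn d => (phaseBump d z : ℂ)) z‖) P]
        ring
    _ ≤ _ := by
        gcongr
        exact Finset.single_le_sum (f := fun k => ∑ i ∈ Finset.range (k + 1),
          (k.choose i : ℝ) * I (k - i))
          (fun k _ => Finset.sum_nonneg fun i _ => mul_nonneg (by positivity) (hI _))
          (Finset.mem_range.2 (by omega))

/-- The wave packet coefficients of a symbol. -/
def coeff (a : Rn d × Rn d → ℂ) (P Q : Rn d × Rn d) : ℂ := fourierProd (localSymbol a P) Q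

theorem stronglyMeasurable_coeff {a : Rn d × Rn d → ℂ} (ha : Continuous a) :
    StronglyMeasurable fun p : (Rn d × Rn d) × (Rn d × Rn d) => coeff a p.1 p.2 := by
  have hc : Continuous (fun p : ((Rn d × Rn d) × (Rn d × Rn d)) × (Rn d × Rn d) =>
      (𝐞 (-pair p.2 p.1.2) : ℂ) * (a p.2 * (phaseBump d (p.2 - p.1.1) : ℂ))) := by
    have h1 := continuous_char
    have h2 := (contDiff_phaseBump (d := d)).continuous
    have h3 := continuous_pair (d := d)
    refine (h1.comp (h3.comp (by fun_prop : Continuous fun p :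
      ((Rn d × Rn d) × (Rn d × Rn d)) × (Rn d × Rn d) => (p.2, p.1.2))).neg).mul
      ((ha.comp continuous_snd).mul (h2.comp (by fun_prop)))
  exact hc.stronglyMeasurable.integral_prod_right

theorem exists_norm_coeff_le (d N : ℕ) : ∃ C : ℝ, 0 ≤ C ∧
    ∀ a : Rn d × Rn d → ℂ, ContDiff ℝ ∞ a → ∀ M : ℝ,
      (∀ n ≤ N, ∀ z, ‖iteratedFDeriv ℝ n a z‖ ≤ M) → ∀ P Q,
        ‖coeff a P Q‖ ≤ C * M * (1 + ‖Q‖) ^ (-(N : ℝ)) := by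
  obtain ⟨C, hC0, hC⟩ := exists_integral_localSymbol_le d N
  refine ⟨4 ^ N * (N + 2) * C, by positivity, fun a ha M hM P Q => ?_⟩
  have := norm_fourierProd_le (contDiff_localSymbol ha P) (hasCompactSupport_localSymbol a P) N
    (hC a ha M hM P) Q
  refine this.trans (le_of_eq ?_)
  ring

/-- The normalisation of the wave packet decomposition. -/
def windowMass (d : ℕ) : ℝ := ∫ z : Rn d × Rn d, phaseBump d z * window z

theorem windowMass_pos (d : ℕ) : 0 < windowMass d := by
  refine Continuous.integral_pos_of_hasCompactSupport_nonneg_nonzero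
    ((phaseBump d).continuous.mul continuous_window)
    (phaseBump d).hasCompactSupport.mul_right
    (fun z => mul_nonneg (phaseBump d).nonneg (window_nonneg z)) (x := 0) ?_
  refine mul_ne_zero ?_ ?_
  · rw [(phaseBump d).one_of_mem_closedBall (by simp [phaseBump])]
    exact one_ne_zero
  · exact (mul_pos (gauss_pos _ _) (gauss_pos _ _)).ne'

instance : (volume : Measure (Rn d × Rn d)).IsNegInvariant :=
  Measure.IsAddHaarMeasure.isNegInvariant_of_regular _

theorem integral_bump_window (z : Rn d × Rn d) :
    ∫ P, ((phaseBump d (z - P) * window (z - P) : ℝ) : ℂ) = windowMass d := by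
  rw [integral_complex_ofReal,
    integral_sub_left_eq_self (fun P => phaseBump d P * window P) volume z, windowMass]

/-- Fourier inversion in `Q` recovers the symbol times bump times window at `z - P`, and integrating
over `P` leaves the total mass of bump times window. -/
theorem symbol_eq_integral {a : Rn d × Rn d → ℂ} (ha : ContDiff ℝ ∞ a) (z : Rn d × Rn d) :
    (windowMass d : ℂ) * a z = ∫ P, ∫ Q, coeff a P Q * elemSymbol P Q z := by
  have h1 : ∀ P, ∫ Q, coeff a P Q * elemSymbol P Q z =
      a z * ((phaseBump d (z - P) * window (z - P) : ℝ) : ℂ) := by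
    intro P
    have h := fourierProd_inversion (contDiff_localSymbol ha P) (hasCompactSupport_localSymbol a P) z
    have h2 : ∀ Q, coeff a P Q * elemSymbol P Q z =
        𝐞 (pair z Q) * fourierProd (localSymbol a P) Q * (window (z - P) : ℂ) := by
      intro Q
      rw [coeff, elemSymbol]
      ring
    simp_rw [h2]
    rw [integral_mul_const, ← h, localSymbol]
    push_cast
    ring
  simp_rw [h1]
  rw [integral_const_mul, integral_bump_window, mul_comm]

theorem window_sub_comm (z P : Rn d × Rn d) : window (z - P) = window (P - z) := by
  simp only [window, gauss, Prod.fst_sub, Prod.snd_sub, norm_sub_rev z.1, norm_sub_rev z.2]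

theorem integrable_decay_phase :
    Integrable (fun Q : Rn d × Rn d => (1 + ‖Q‖) ^ (-((2 * d + 1 : ℕ) : ℝ))) := by
  refine integrable_one_add_norm ?_
  simp only [Module.finrank_prod, finrank_euclideanSpace, Fintype.card_fin]
  exact_mod_cast (by omega : d + d < 2 * d + 1)

/-- The integrand of the wave packet decomposition. -/
def packetIntegrand (a : Rn d × Rn d → ℂ) (φ ψ : Rn d → ℂ)
    (p : ((Rn d × Rn d) × (Rn d × Rn d)) × (Rn d × Rn d)) : ℂ :=
  coeff a p.1.1 p.2 * elemSymbol p.1.1 p.2 p.1.2 * wig φ ψ p.1.2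

/-- Justifies Fubini: the coefficients decay in `Q` faster than the dimension 2d, the window is
integrable in `P - z`, and the Wigner function in `z`. -/
theorem integrable_packetIntegrand {a : Rn d × Rn d → ℂ} (ha : ContDiff ℝ ∞ a) {M : ℝ}
    (hM : ∀ n ≤ 2 * d + 1, ∀ z, ‖iteratedFDeriv ℝ n a z‖ ≤ M) (φ ψ : 𝓢(Rn d, ℂ)) :
    Integrable (packetIntegrand a φ ψ)
      ((volume.prod volume : Measure ((Rn d × Rn d) × (Rn d × Rn d))).prod volume) := by
  obtain ⟨C, hC0, hC⟩ := exists_norm_coeff_le d (2 * d + 1)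
  have hM0 : 0 ≤ M := (norm_nonneg _).trans (hM 0 (Nat.zero_le _) 0)
  have hconv : Integrable (fun p : (Rn d × Rn d) × (Rn d × Rn d) =>
      ‖wig φ ψ p.2‖ * window (p.1 - p.2)) (volume.prod volume) :=
    Integrable.convolution_integrand (ContinuousLinearMap.mul ℝ ℝ) (integrable_wig φ ψ).norm
      integrable_window
  refine ((hconv.mul_prod integrable_decay_phase).const_mul (C * M)).mono' ?_
    (Eventually.of_forall fun p => ?_)
  · refine AEStronglyMeasurable.mul (AEStronglyMeasurable.mul ?_ ?_) ?_
    · exact ((stronglyMeasurable_coeff ha.continuous).comp_measurable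
        (by fun_prop : Measurable fun p : ((Rn d × Rn d) × (Rn d × Rn d)) × (Rn d × Rn d) =>
          (p.1.1, p.2))).aestronglyMeasurable
    · exact (continuous_elemSymbol.comp (by fun_prop :
        Continuous fun p : ((Rn d × Rn d) × (Rn d × Rn d)) × (Rn d × Rn d) =>
          ((p.1.1, p.2), p.1.2))).aestronglyMeasurable
    · exact ((integrable_wig φ ψ).aestronglyMeasurable.comp_snd (μ := volume)).comp_fst
        (ν := volume)
  · simp only [packetIntegrand, norm_mul, norm_elemSymbol, window_sub_comm p.1.2]
    have := hC a ha M hM p.1.1 p.2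
    have h1 := window_nonneg (p.1.1 - p.1.2)
    calc _ ≤ C * M * (1 + ‖p.2‖) ^ (-((2 * d + 1 : ℕ) : ℝ)) * window (p.1.1 - p.1.2) *
          ‖wig φ ψ p.1.2‖ := by gcongr
      _ = _ := by ring

theorem integral_mul_wig_eq {a : Rn d × Rn d → ℂ} (ha : ContDiff ℝ ∞ a) {M : ℝ}
    (hM : ∀ n ≤ 2 * d + 1, ∀ z, ‖iteratedFDeriv ℝ n a z‖ ≤ M) (φ ψ : 𝓢(Rn d, ℂ)) :
    (windowMass d : ℂ) * ∫ z, a z * wig φ ψ z =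
      ∫ Q, ∫ P, coeff a P Q * ∫ z, elemSymbol P Q z * wig φ ψ z := by
  have hT := integrable_packetIntegrand ha hM φ ψ
  have hT' : Integrable (fun p => ∫ Q, packetIntegrand a φ ψ (p, Q)) (volume.prod volume) :=
    hT.integral_prod_left
  calc (windowMass d : ℂ) * ∫ z, a z * wig φ ψ z
      = ∫ z, ∫ P, ∫ Q, packetIntegrand a φ ψ ((P, z), Q) := by
        rw [← integral_const_mul]
        refine integral_congr_ae (Eventually.of_forall fun z => ?_)
        simp only [packetIntegrand]
        rw [← mul_assoc, symbol_eq_integral ha, ← integral_mul_const]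
        refine integral_congr_ae (Eventually.of_forall fun P => ?_)
        simp only
        rw [← integral_mul_const]
    _ = ∫ p, ∫ Q, packetIntegrand a φ ψ (p, Q) ∂volume ∂(volume.prod volume) :=
        (integral_prod_symm _ hT').symm
    _ = ∫ Q, ∫ p, packetIntegrand a φ ψ (p, Q) ∂(volume.prod volume) ∂volume :=
        integral_integral_swap hT
    _ = _ := by
        refine integral_congr_ae ?_
        filter_upwards [hT.prod_left_ae] with Q hQ
        rw [integral_prod _ hQ]
        refine integral_congr_ae (Eventually.of_forall fun P => ?_)
        simp only [packetIntegrand, mul_assoc]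
        rw [integral_const_mul]

/-- For fixed `Q` the integral over `P` costs a constant independent of `Q`, so a bound on the
coefficients that is uniform in `P` and integrable in `Q` suffices. -/
theorem enorm_integral_coeff_le {a : Rn d × Rn d → ℂ} {K : ℝ} {w : Rn d × Rn d → ℝ}
    (hK : 0 ≤ K) (hw0 : ∀ Q, 0 ≤ w Q) (hwi : Integrable w)
    (hc : ∀ P Q, ‖coeff a P Q‖ ≤ K * w Q) (φ ψ : 𝓢(Rn d, ℂ)) :
    ‖∫ Q, ∫ P, coeff a P Q * ∫ z, elemSymbol P Q z * wig φ ψ z‖ₑ ≤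
      ENNReal.ofReal (K * ∫ Q, w Q) * (‖gaussConst d‖ₑ *
        ((∫⁻ x : Rn d, ‖gauss Real.pi x‖ₑ ^ 2) * (eLpNorm ψ 2 * eLpNorm φ 2))) := by
  set B := ‖gaussConst d‖ₑ *
        ((∫⁻ x : Rn d, ‖gauss Real.pi x‖ₑ ^ 2) * (eLpNorm ψ 2 * eLpNorm φ 2)) with hB
  calc _ ≤ ∫⁻ Q, ‖∫ P, coeff a P Q * ∫ z, elemSymbol P Q z * wig φ ψ z‖ₑ :=
        enorm_integral_le_lintegral_enorm _
    _ ≤ ∫⁻ Q, ENNReal.ofReal (K * w Q) * B := by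
        refine lintegral_mono fun Q => ?_
        calc _ ≤ ∫⁻ P, ‖coeff a P Q * ∫ z, elemSymbol P Q z * wig φ ψ z‖ₑ :=
              enorm_integral_le_lintegral_enorm _
          _ ≤ ∫⁻ P, ENNReal.ofReal (K * w Q) * ‖∫ z, elemSymbol P Q z * wig φ ψ z‖ₑ := by
              refine lintegral_mono fun P => ?_
              rw [enorm_mul]
              refine mul_le_mul_left ?_ _
              rw [← ofReal_norm]
              exact ENNReal.ofReal_le_ofReal (hc P Q)
          _ = ENNReal.ofReal (K * w Q) * ∫⁻ P, ‖∫ z, elemSymbol P Q z * wig φ ψ z‖ₑ :=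
              lintegral_const_mul' _ _ ENNReal.ofReal_ne_top
          _ ≤ _ := mul_le_mul_right (lintegral_elemSymbol_wig_le φ ψ Q) _
    _ = _ := by
        rw [lintegral_mul_const'' _ (hwi.const_mul K).aestronglyMeasurable.aemeasurable.ennreal_ofReal,
          ← ofReal_integral_eq_lintegral_ofReal
          (hwi.const_mul _) (Eventually.of_forall fun Q => mul_nonneg hK (hw0 Q)),
          integral_const_mul]

theorem eLpNorm_schwartz_ne_top (φ : 𝓢(Rn d, ℂ)) : eLpNorm φ 2 volume ≠ ⊤ :=
  (SchwartzMap.memLp φ 2 volume).2.ne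

theorem norm_le_of_enorm_mul_le {m : ℝ} {I g : ℂ} {x : ℝ} {G A B : ℝ≥0∞} (hm : 0 < m) (hx : 0 ≤ x)
    (hG : G ≠ ⊤) (hA : A ≠ ⊤) (hB : B ≠ ⊤)
    (h : ‖(m : ℂ) * I‖ₑ ≤ ENNReal.ofReal x * (‖g‖ₑ * (G * (A * B)))) :
    ‖I‖ ≤ m⁻¹ * (x * (‖g‖ * (G.toReal * (A.toReal * B.toReal)))) := by
  have hfin := ENNReal.mul_ne_top (a := ENNReal.ofReal x) ENNReal.ofReal_ne_top
    (ENNReal.mul_ne_top (enorm_ne_top (x := g)) (ENNReal.mul_ne_top hG (ENNReal.mul_ne_top hA hB)))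
  have e3 := ENNReal.toReal_mono hfin h
  rw [toReal_enorm, norm_mul, Complex.norm_real, Real.norm_of_nonneg hm.le,
    ENNReal.toReal_mul, ENNReal.toReal_mul, ENNReal.toReal_mul, ENNReal.toReal_mul,
    toReal_enorm, ENNReal.toReal_ofReal hx] at e3
  rwa [← div_eq_inv_mul, le_div_iff₀' hm]

/-- **Calderón–Vaillancourt theorem** for the Weyl quantization, in weak form. -/
theorem exists_norm_integral_mul_wig_le (d : ℕ) : ∃ C : ℝ, 0 ≤ C ∧
    ∀ a : Rn d × Rn d → ℂ, ContDiff ℝ ∞ a → ∀ M : ℝ,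
      (∀ n ≤ 2 * d + 1, ∀ z, ‖iteratedFDeriv ℝ n a z‖ ≤ M) → ∀ φ ψ : 𝓢(Rn d, ℂ),
        ‖∫ z, a z * wig φ ψ z‖ ≤ C * M * (‖ψ.toLp 2 volume‖ * ‖φ.toLp 2 volume‖) := by
  obtain ⟨C, hC0, hC⟩ := exists_norm_coeff_le d (2 * d + 1)
  set w : Rn d × Rn d → ℝ := fun Q => (1 + ‖Q‖) ^ (-((2 * d + 1 : ℕ) : ℝ)) with hw
  have hw0 : ∀ Q, 0 ≤ w Q := fun Q => by positivity
  have hwi : Integrable w := integrable_decay_phase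
  have hwI : 0 ≤ ∫ Q, w Q := integral_nonneg hw0
  set G : ℝ≥0∞ := ∫⁻ x : Rn d, ‖gauss Real.pi x‖ₑ ^ 2 with hG
  have hGt : G ≠ ⊤ := lintegral_gauss_sq_lt_top.ne
  have h0 := windowMass_pos d
  refine ⟨(windowMass d)⁻¹ * (C * (∫ Q, w Q) * (‖gaussConst d‖ * G.toReal)), by positivity, ?_⟩
  intro a ha M hM φ ψ
  have hM0 : 0 ≤ M := (norm_nonneg _).trans (hM 0 (Nat.zero_le _) 0)
  have e2 := enorm_integral_coeff_le (mul_nonneg hC0 hM0) hw0 hwi (hC a ha M hM) φ ψ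
  rw [← integral_mul_wig_eq ha hM] at e2
  have e3 := norm_le_of_enorm_mul_le h0 (mul_nonneg (mul_nonneg hC0 hM0) hwI) hGt
    (eLpNorm_schwartz_ne_top ψ) (eLpNorm_schwartz_ne_top φ) e2
  rw [SchwartzMap.norm_toLp, SchwartzMap.norm_toLp]
  refine e3.trans (le_of_eq ?_)
  ring

end CalderonVaillancourt


/-! ### Operators defined weakly by a symbol -/

section Operators

variable {d : ℕ}

theorem denseRange_toLp : DenseRange (fun φ : 𝓢(Rn d, ℂ) => φ.toLp 2 volume) :=
  SchwartzMap.denseRange_toLpCLM (F := ℂ) (p := 2) (by norm_num)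

theorem norm_inner_le_of_schwartz {K : L2 d →L[ℂ] L2 d} {c : ℝ}
    (h : ∀ φ ψ : 𝓢(Rn d, ℂ), ‖⟪ψ.toLp 2 volume, K (φ.toLp 2 volume)⟫_ℂ‖ ≤
      c * (‖ψ.toLp 2 volume‖ * ‖φ.toLp 2 volume‖)) (u v : L2 d) :
    ‖⟪v, K u⟫_ℂ‖ ≤ c * (‖v‖ * ‖u‖) := by
  refine denseRange_toLp.induction_on (p := fun v => ‖⟪v, K u⟫_ℂ‖ ≤ c * (‖v‖ * ‖u‖)) v
    (isClosed_le (by fun_prop) (by fun_prop)) fun ψ => ?_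
  exact denseRange_toLp.induction_on (p := fun u => ‖⟪ψ.toLp 2 volume, K u⟫_ℂ‖ ≤
    c * (‖ψ.toLp 2 volume‖ * ‖u‖)) u (isClosed_le (by fun_prop) (by fun_prop)) fun φ => h φ ψ

theorem norm_apply_le_of_schwartz {K : L2 d →L[ℂ] L2 d} {c : ℝ} (hc : 0 ≤ c)
    (h : ∀ φ ψ : 𝓢(Rn d, ℂ), ‖⟪ψ.toLp 2 volume, K (φ.toLp 2 volume)⟫_ℂ‖ ≤
      c * (‖ψ.toLp 2 volume‖ * ‖φ.toLp 2 volume‖)) (u : L2 d) : ‖K u‖ ≤ c * ‖u‖ := by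
  have h1 := norm_inner_le_of_schwartz h u (K u)
  rw [inner_self_eq_norm_sq_to_K, norm_pow, RCLike.norm_ofReal, abs_norm] at h1
  rcases (norm_nonneg (K u)).eq_or_lt with h0 | h0
  · rw [← h0]; positivity
  · refine le_of_mul_le_mul_left ?_ h0
    linarith

theorem opNorm_le_of_schwartz {K : L2 d →L[ℂ] L2 d} {c : ℝ} (hc : 0 ≤ c)
    (h : ∀ φ ψ : 𝓢(Rn d, ℂ), ‖⟪ψ.toLp 2 volume, K (φ.toLp 2 volume)⟫_ℂ‖ ≤
      c * (‖ψ.toLp 2 volume‖ * ‖φ.toLp 2 volume‖)) : ‖K‖ ≤ c :=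
  K.opNorm_le_bound hc (norm_apply_le_of_schwartz hc h)

theorem clm_ext_of_schwartz {K L : L2 d →L[ℂ] L2 d}
    (h : ∀ φ ψ : 𝓢(Rn d, ℂ), ⟪ψ.toLp 2 volume, K (φ.toLp 2 volume)⟫_ℂ =
      ⟪ψ.toLp 2 volume, L (φ.toLp 2 volume)⟫_ℂ) : K = L := by
  have : ‖K - L‖ ≤ 0 := by
    refine opNorm_le_of_schwartz le_rfl fun φ ψ => ?_
    rw [_root_.sub_apply, inner_sub_right, h, sub_self, norm_zero, zero_mul]
  exact sub_eq_zero.1 (norm_le_zero_iff.1 this)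

/-- A bounded sesquilinear form on the Schwartz functions is represented by a bounded operator. -/
theorem exists_clm_of_form (B : 𝓢(Rn d, ℂ) → 𝓢(Rn d, ℂ) → ℂ) {c : ℝ} (hc : 0 ≤ c)
    (hadd : ∀ φ φ' ψ, B (φ + φ') ψ = B φ ψ + B φ' ψ) (hsmul : ∀ (r : ℂ) φ ψ, B (r • φ) ψ = r * B φ ψ)
    (hadd' : ∀ φ ψ ψ', B φ (ψ + ψ') = B φ ψ + B φ ψ')
    (hsmul' : ∀ (r : ℂ) φ ψ, B φ (r • ψ) = conj r * B φ ψ)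
    (hB : ∀ φ ψ, ‖B φ ψ‖ ≤ c * (‖ψ.toLp 2 volume‖ * ‖φ.toLp 2 volume‖)) :
    ∃ K : L2 d →L[ℂ] L2 d, ∀ φ ψ : 𝓢(Rn d, ℂ),
      ⟪ψ.toLp 2 volume, K (φ.toLp 2 volume)⟫_ℂ = B φ ψ := by
  let e : 𝓢(Rn d, ℂ) →ₗ[ℂ] L2 d :=
    (SchwartzMap.toLpCLM ℂ ℂ 2 (volume : Measure (Rn d))).toLinearMap
  have he : DenseRange e := denseRange_toLp
  -- The form is conjugate-linear in its second argument; its conjugate is a linear functional to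
  -- which Riesz representation applies.
  let f : 𝓢(Rn d, ℂ) → 𝓢(Rn d, ℂ) →ₗ[ℂ] ℂ := fun φ =>
    { toFun := fun ψ => conj (B φ ψ)
      map_add' := fun ψ ψ' => by rw [hadd', map_add]
      map_smul' := fun r ψ => by rw [hsmul', map_mul, Complex.conj_conj]; rfl }
  have hf : ∀ φ ψ, ‖f φ ψ‖ ≤ (c * ‖φ.toLp 2 volume‖) * ‖e ψ‖ := fun φ ψ => by
    have h1 : ‖f φ ψ‖ = ‖B φ ψ‖ := RCLike.norm_conj _
    rw [h1]
    refine (hB φ ψ).trans (le_of_eq ?_)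
    simp only [e, ContinuousLinearMap.coe_coe, SchwartzMap.toLpCLM_apply]
    ring
  let k : 𝓢(Rn d, ℂ) → L2 d := fun φ =>
    (InnerProductSpace.toDual ℂ (L2 d)).symm ((f φ).extendOfNorm e)
  have hk : ∀ φ ψ : 𝓢(Rn d, ℂ), ⟪ψ.toLp 2 volume, k φ⟫_ℂ = B φ ψ := fun φ ψ => by
    have h1 : ⟪k φ, ψ.toLp 2 volume⟫_ℂ = conj (B φ ψ) := by
      rw [InnerProductSpace.toDual_symm_apply]
      exact LinearMap.extendOfNorm_eq he ⟨_, hf φ⟩ ψ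
    rw [← inner_conj_symm, h1, Complex.conj_conj]
  have hkn : ∀ φ, ‖k φ‖ ≤ c * ‖e φ‖ := fun φ => by
    rw [LinearIsometryEquiv.norm_map]
    exact ContinuousLinearMap.opNorm_le_bound _ (by positivity)
      (LinearMap.norm_extendOfNorm_apply_le he _ (hf φ))
  have hext : ∀ u v : L2 d, (∀ ψ : 𝓢(Rn d, ℂ), ⟪ψ.toLp 2 volume, u⟫_ℂ = ⟪ψ.toLp 2 volume, v⟫_ℂ) →
      u = v := fun u v h => by
    refine ext_inner_left ℂ fun w => ?_
    exact denseRange_toLp.induction_on (p := fun w => ⟪w, u⟫_ℂ = ⟪w, v⟫_ℂ) w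
      (isClosed_eq (by fun_prop) (by fun_prop)) h
  -- Linearity is checked by pairing with Schwartz functions, which determine a vector by density.
  let kl : 𝓢(Rn d, ℂ) →ₗ[ℂ] L2 d :=
    { toFun := k
      map_add' := fun φ φ' => hext _ _ fun ψ => by rw [inner_add_right, hk, hk, hk, hadd]
      map_smul' := fun r φ => hext _ _ fun ψ => by
        rw [RingHom.id_apply, inner_smul_right, hk, hk, hsmul] }
  refine ⟨kl.extendOfNorm e, fun φ ψ => ?_⟩
  rw [← hk φ ψ]
  congr 1
  exact LinearMap.extendOfNorm_eq (f := kl) he ⟨c, hkn⟩ φ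

theorem integrable_wig_integrand (φ ψ : 𝓢(Rn d, ℂ)) (z : Rn d × Rn d) :
    Integrable fun t => (𝐞 ⟪z.2, t⟫_ℝ : ℂ) *
      (φ (z.1 - (1 / 2 : ℝ) • t) * conj (ψ (z.1 + (1 / 2 : ℝ) • t))) := by
  have hΦ : Integrable (fun t => midSM φ ψ (z.1, t)) := by
    obtain ⟨C, _, hC⟩ := norm_iteratedFDeriv_fibre_le (midSM φ ψ) 0 (d + 1)
    refine (integrable_decay.const_mul (C * (1 + ‖z.1‖) ^ (-((d + 1 : ℕ) : ℝ)))).mono'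
      ((midSM φ ψ).continuous.comp (by fun_prop)).aestronglyMeasurable
      (Eventually.of_forall fun t => ?_)
    simpa using hC z.1 t
  have := hΦ.bdd_mul (c := 1) (f := fun t : Rn d => (𝐞 ⟪z.2, t⟫_ℝ : ℂ))
      (continuous_char.comp (by fun_prop)).aestronglyMeasurable
      (Eventually.of_forall fun x => (norm_char _).le)
  simpa only [midSM_apply] using this

theorem wig_add_left (φ φ' ψ : 𝓢(Rn d, ℂ)) (z : Rn d × Rn d) :
    wig (φ + φ' : 𝓢(Rn d, ℂ)) ψ z = wig φ ψ z + wig φ' ψ z := by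
  rw [wig, wig, wig, ← integral_add (integrable_wig_integrand φ ψ z)
    (integrable_wig_integrand φ' ψ z)]
  refine integral_congr_ae (Eventually.of_forall fun t => ?_)
  simp only [_root_.add_apply]
  ring

theorem wig_smul_left (r : ℂ) (φ ψ : 𝓢(Rn d, ℂ)) (z : Rn d × Rn d) :
    wig (r • φ : 𝓢(Rn d, ℂ)) ψ z = r * wig φ ψ z := by
  rw [wig, wig, ← integral_const_mul]
  refine integral_congr_ae (Eventually.of_forall fun t => ?_)
  simp only [_root_.smul_apply, smul_eq_mul]
  ring

theorem wig_add_right (φ ψ ψ' : 𝓢(Rn d, ℂ)) (z : Rn d × Rn d) :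
    wig φ (ψ + ψ' : 𝓢(Rn d, ℂ)) z = wig φ ψ z + wig φ ψ' z := by
  rw [wig_conj (ψ + ψ' : 𝓢(Rn d, ℂ)), wig_add_left, map_add, ← wig_conj, ← wig_conj]

theorem wig_smul_right (r : ℂ) (φ ψ : 𝓢(Rn d, ℂ)) (z : Rn d × Rn d) :
    wig φ (r • ψ : 𝓢(Rn d, ℂ)) z = conj r * wig φ ψ z := by
  rw [wig_conj (r • ψ : 𝓢(Rn d, ℂ)), wig_smul_left, map_mul, ← wig_conj]

theorem integrable_mul_wig {a : Rn d × Rn d → ℂ} (ha : Continuous a) {M : ℝ}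
    (hM : ∀ z, ‖a z‖ ≤ M) (φ ψ : 𝓢(Rn d, ℂ)) : Integrable fun z => a z * wig φ ψ z :=
  (integrable_wig φ ψ).bdd_mul ha.aestronglyMeasurable (Eventually.of_forall hM)

/-- `K` is the Weyl quantization of the symbol `(x, η) ↦ a (x, η / 2π)`, in weak form. -/
def IsOp (a : Rn d × Rn d → ℂ) (K : L2 d →L[ℂ] L2 d) : Prop :=
  ∀ φ ψ : 𝓢(Rn d, ℂ), ⟪ψ.toLp 2 volume, K (φ.toLp 2 volume)⟫_ℂ = ∫ z, a z * wig φ ψ z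

/-- `a` is smooth and its derivatives up to order `2d + 1` are bounded by `M`. -/
structure SymbolBound (a : Rn d × Rn d → ℂ) (M : ℝ) : Prop where
  smooth : ContDiff ℝ ∞ a
  bound : ∀ n ≤ 2 * d + 1, ∀ z, ‖iteratedFDeriv ℝ n a z‖ ≤ M

theorem SymbolBound.nonneg {a : Rn d × Rn d → ℂ} {M : ℝ} (h : SymbolBound a M) : 0 ≤ M :=
  (norm_nonneg _).trans (h.bound 0 (Nat.zero_le _) 0)

theorem SymbolBound.norm_le {a : Rn d × Rn d → ℂ} {M : ℝ} (h : SymbolBound a M) (z) : ‖a z‖ ≤ M := by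
  simpa using h.bound 0 (Nat.zero_le _) z

theorem SymbolBound.integrable {a : Rn d × Rn d → ℂ} {M : ℝ} (h : SymbolBound a M)
    (φ ψ : 𝓢(Rn d, ℂ)) : Integrable fun z => a z * wig φ ψ z :=
  integrable_mul_wig h.smooth.continuous h.norm_le φ ψ

/-- The constant in the Calderón–Vaillancourt theorem. -/
def cvConst (d : ℕ) : ℝ := (exists_norm_integral_mul_wig_le d).choose

theorem cvConst_nonneg (d : ℕ) : 0 ≤ cvConst d := (exists_norm_integral_mul_wig_le d).choose_spec.1

theorem SymbolBound.norm_integral_le {a : Rn d × Rn d → ℂ} {M : ℝ} (h : SymbolBound a M)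
    (φ ψ : 𝓢(Rn d, ℂ)) :
    ‖∫ z, a z * wig φ ψ z‖ ≤ cvConst d * M * (‖ψ.toLp 2 volume‖ * ‖φ.toLp 2 volume‖) :=
  (exists_norm_integral_mul_wig_le d).choose_spec.2 a h.smooth M h.bound φ ψ

theorem SymbolBound.exists_isOp {a : Rn d × Rn d → ℂ} {M : ℝ} (h : SymbolBound a M) :
    ∃ K, IsOp a K := by
  refine exists_clm_of_form (fun φ ψ => ∫ z, a z * wig φ ψ z)
    (mul_nonneg (cvConst_nonneg d) h.nonneg) ?_ ?_ ?_ ?_ h.norm_integral_le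
  · intro φ φ' ψ
    simp only [wig_add_left, mul_add]
    exact integral_add (h.integrable φ ψ) (h.integrable φ' ψ)
  · intro r φ ψ
    simp only [wig_smul_left, mul_left_comm _ r]
    exact integral_const_mul _ _
  · intro φ ψ ψ'
    simp only [wig_add_right, mul_add]
    exact integral_add (h.integrable φ ψ) (h.integrable φ ψ')
  · intro r φ ψ
    simp only [wig_smul_right, mul_left_comm _ (conj r)]
    exact integral_const_mul _ _

theorem IsOp.unique {a : Rn d × Rn d → ℂ} {K L : L2 d →L[ℂ] L2 d} (hK : IsOp a K) (hL : IsOp a L) :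
    K = L :=
  clm_ext_of_schwartz fun φ ψ => (hK φ ψ).trans (hL φ ψ).symm

theorem IsOp.norm_le {a : Rn d × Rn d → ℂ} {K : L2 d →L[ℂ] L2 d} (hK : IsOp a K) {M : ℝ}
    (h : SymbolBound a M) : ‖K‖ ≤ cvConst d * M :=
  opNorm_le_of_schwartz (mul_nonneg (cvConst_nonneg d) h.nonneg) fun φ ψ => by
    rw [hK]; exact h.norm_integral_le φ ψ

theorem IsOp.sub {a b : Rn d × Rn d → ℂ} {K L : L2 d →L[ℂ] L2 d} {M N : ℝ} (hK : IsOp a K)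
    (hL : IsOp b L) (ha : SymbolBound a M) (hb : SymbolBound b N) : IsOp (a - b) (K - L) := by
  intro φ ψ
  rw [_root_.sub_apply, inner_sub_right, hK, hL,
    ← integral_sub (ha.integrable φ ψ) (hb.integrable φ ψ)]
  simp only [Pi.sub_apply, sub_mul]

/-- Exchanging the two arguments of the Wigner function conjugates it, so the adjoint has the
conjugate symbol; uniqueness then identifies it with `K`. -/
theorem IsOp.isSelfAdjoint {a : Rn d × Rn d → ℂ} {K : L2 d →L[ℂ] L2 d} (hK : IsOp a K)
    (ha : ∀ z, conj (a z) = a z) : IsSelfAdjoint K := by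
  rw [ContinuousLinearMap.isSelfAdjoint_iff']
  refine IsOp.unique (a := a) (fun φ ψ => ?_) hK
  rw [ContinuousLinearMap.adjoint_inner_right, ← inner_conj_symm, hK, ← integral_conj]
  refine integral_congr_ae (Eventually.of_forall fun z => ?_)
  simp only [map_mul, ha]
  rw [← wig_conj]

end Operators

/-! ### Multiplication operators on L² -/

section Multiplication

variable {d : ℕ}

/-- Multiplication by a bounded continuous function. -/
def mulOp (f : BoundedContinuousFunction (Rn d) ℂ) : L2 d →L[ℂ] L2 d :=
  (ContinuousLinearMap.mul ℂ ℂ).holderL volume ⊤ 2 2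
    ((memLp_top_of_bound f.continuous.aestronglyMeasurable ‖f‖
      (Eventually.of_forall f.norm_coe_le_norm)).toLp f)

theorem mulOp_coeFn (f : BoundedContinuousFunction (Rn d) ℂ) (u : L2 d) :
    mulOp f u =ᵐ[volume] fun x => f x * u x := by
  have h := (ContinuousLinearMap.mul ℂ ℂ).coeFn_holder (r := 2) (μ := volume)
    ((memLp_top_of_bound (f := f) (μ := volume) f.continuous.aestronglyMeasurable ‖f‖
      (Eventually.of_forall f.norm_coe_le_norm)).toLp f) u
  refine h.trans ?_
  filter_upwards [(memLp_top_of_bound (f := f) (μ := volume) f.continuous.aestronglyMeasurable ‖f‖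
      (Eventually.of_forall f.norm_coe_le_norm)).coeFn_toLp] with x hx
  rw [hx]
  rfl

theorem mulOp_mulOp (f g : BoundedContinuousFunction (Rn d) ℂ) (u : L2 d) :
    mulOp f (mulOp g u) = mulOp (f * g) u := by
  refine Lp.ext ?_
  filter_upwards [mulOp_coeFn f (mulOp g u), mulOp_coeFn g u, mulOp_coeFn (f * g) u] with x h1 h2 h3
  rw [h1, h2, h3, BoundedContinuousFunction.mul_apply, mul_assoc]

theorem inner_mulOp_right (f : BoundedContinuousFunction (Rn d) ℂ) (u v : L2 d) :
    ⟪v, mulOp f u⟫_ℂ = ∫ x, f x * (u x * conj (v x)) := by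
  rw [L2.inner_def]
  refine integral_congr_ae ?_
  filter_upwards [mulOp_coeFn f u] with x hx
  rw [hx, RCLike.inner_apply]
  ring

theorem enorm_sq_eq_lintegral (u : L2 d) : ‖u‖ₑ ^ 2 = ∫⁻ x, ‖u x‖ₑ ^ 2 := by
  rw [Lp.enorm_def, eLpNorm_two_eq, ← ENNReal.rpow_natCast, ← ENNReal.rpow_mul]
  norm_num

end Multiplication


/-! ### From the weak form to the oscillatory integral -/

section Bridge

variable {d : ℕ}

/-- The inner integral in the definition of the Weyl quantization. -/
def innerIntegral (A : Rn d × Rn d → ℂ) (φ : Rn d → ℂ) (x ξ : Rn d) : ℂ :=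
  ∫ y, (𝐞 ⟪ξ, x - y⟫_ℝ : ℂ) * A ((1 / 2 : ℝ) • (x + y), ξ) * φ y

/-- The substitution η = 2πξ: its Jacobian absorbs the prefactor (2π)^(-d) and the phase becomes the
standard Fourier character. -/
theorem weylIntegral_eq (a : Rn d × Rn d → ℝ) (φ : 𝓢(Rn d, ℂ)) (x : Rn d) :
    weylIntegral a φ x =
      ∫ ξ, innerIntegral (fun z => (a (z.1, (2 * Real.pi) • z.2) : ℂ)) φ x ξ := by
  have h1 : ∀ ξ, innerIntegral (fun z => (a (z.1, (2 * Real.pi) • z.2) : ℂ)) φ x ξ =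
      (fun η : Rn d => ∫ y : Rn d, Complex.exp (Complex.I * (inner ℝ η (x - y) : ℝ)) *
        (a ((1 / 2 : ℝ) • (x + y), η) : ℂ) * φ y) ((2 * Real.pi) • ξ) := by
    intro ξ
    refine integral_congr_ae (Eventually.of_forall fun y => ?_)
    simp only
    rw [Real.fourierChar_apply, inner_smul_left]
    congr 3
    simp
    ring
  rw [integral_congr_ae (Eventually.of_forall h1), Measure.integral_comp_smul volume
    (fun η : Rn d => ∫ y : Rn d, Complex.exp (Complex.I * (inner ℝ η (x - y) : ℝ)) *
        (a ((1 / 2 : ℝ) • (x + y), η) : ℂ) * φ y) (2 * Real.pi), finrank_euclideanSpace, Fintype.card_fin, weylIntegral,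
    abs_of_nonneg (by positivity), Complex.real_smul]

theorem contDiff_slice {A : Rn d × Rn d → ℂ} (hA : ContDiff ℝ ∞ A) (x ξ : Rn d) :
    ContDiff ℝ ∞ (fun y => A ((1 / 2 : ℝ) • (x + y), ξ)) :=
  hA.comp (((contDiff_const.add contDiff_id).const_smul _).prodMk contDiff_const)

theorem norm_iteratedFDeriv_slice_le {A : Rn d × Rn d → ℂ} {M : ℝ} (hA : SymbolBound A M)
    (x ξ y : Rn d) {k : ℕ} (hk : k ≤ 2 * d + 1) :
    ‖iteratedFDeriv ℝ k (fun y => A ((1 / 2 : ℝ) • (x + y), ξ)) y‖ ≤ M := by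
  let L : Rn d →L[ℝ] Rn d × Rn d :=
    (ContinuousLinearMap.inl ℝ (Rn d) (Rn d)).comp ((1 / 2 : ℝ) • ContinuousLinearMap.id ℝ (Rn d))
  have hLe : ∀ y, L y = ((1 / 2 : ℝ) • y, 0) := fun y => rfl
  have hL : ‖L‖ ≤ 1 := by
    refine ContinuousLinearMap.opNorm_le_bound _ zero_le_one fun y => ?_
    rw [hLe, Prod.norm_def, norm_zero, max_eq_left (norm_nonneg _), norm_smul]
    have : ‖(1 / 2 : ℝ)‖ ≤ 1 := by norm_num
    exact mul_le_mul_of_nonneg_right this (norm_nonneg _)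
  have h2 := norm_iteratedFDeriv_comp_clm_le
      (f := fun z => A (z + (((1 / 2 : ℝ) • x, ξ) : Rn d × Rn d)))
      (hA.smooth.comp (contDiff_id.add contDiff_const)) L hL k y
  rw [iteratedFDeriv_comp_add_right] at h2
  refine le_trans (le_of_eq ?_) (h2.trans (hA.bound k hk _))
  congr 2
  funext y
  rw [hLe]
  simp [smul_add, add_comm]

/-- Up to a unimodular factor the inner integral is the Fourier transform of the slice of `A` times
`φ`, whose derivatives have L¹ norms bounded uniformly in x and ξ. -/
theorem exists_norm_innerIntegral_le {A : Rn d × Rn d → ℂ} {M : ℝ} (hA : SymbolBound A M)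
    (φ : 𝓢(Rn d, ℂ)) : ∃ C, ∀ x ξ, ‖innerIntegral A φ x ξ‖ ≤
      C * (1 + ‖ξ‖) ^ (-((d + 1 : ℕ) : ℝ)) := by
  set N := d + 1
  have hM0 := hA.nonneg
  have hφi : ∀ j, Integrable (fun y => ‖iteratedFDeriv ℝ j φ y‖) := fun j => by
    simpa using φ.integrable_pow_mul_iteratedFDeriv volume 0 j
  set I : ℕ → ℝ := fun j => ∫ y, ‖iteratedFDeriv ℝ j φ y‖
  have hI : ∀ j, 0 ≤ I j := fun j => integral_nonneg fun _ => norm_nonneg _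
  have hφc : ContDiff ℝ ∞ φ := φ.smooth'
  set R : ℕ → ℝ := fun k => ∑ i ∈ Finset.range (k + 1), (k.choose i : ℝ) * M * I (k - i)
  have hR : ∀ k, 0 ≤ R k := fun k => Finset.sum_nonneg fun i _ => by have := hI (k - i); positivity
  refine ⟨4 ^ N * (N + 2) * ∑ k ∈ Finset.range (N + 1), R k, fun x ξ => ?_⟩
  set h : Rn d → ℂ := fun y => A ((1 / 2 : ℝ) • (x + y), ξ) * φ y
  have hs := contDiff_slice hA.smooth x ξ
  have hc : ContDiff ℝ ∞ h := hs.mul hφc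
  have hle : ∀ k ≤ N, ∀ y, ‖iteratedFDeriv ℝ k h y‖ ≤
      ∑ i ∈ Finset.range (k + 1), (k.choose i : ℝ) * M * ‖iteratedFDeriv ℝ (k - i) φ y‖ := by
    intro k hk y
    refine (norm_iteratedFDeriv_mul_le (𝕜 := ℝ) (N := ∞) hs hφc y (n := k)
      (by exact_mod_cast le_top)).trans (Finset.sum_le_sum fun i hi => ?_)
    gcongr
    exact norm_iteratedFDeriv_slice_le hA x ξ y (by simp at hi; omega)
  have hsum : ∀ k, Integrable fun y => ∑ i ∈ Finset.range (k + 1),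
      (k.choose i : ℝ) * M * ‖iteratedFDeriv ℝ (k - i) φ y‖ := fun k =>
    integrable_finsetSum _ fun i _ => (hφi (k - i)).const_mul _
  have hhi : ∀ k ≤ N, Integrable (iteratedFDeriv ℝ k h) := fun k hk =>
    (hsum k).mono' (hc.continuous_iteratedFDeriv (by exact_mod_cast le_top)).aestronglyMeasurable
      (Eventually.of_forall (hle k hk))
  have hM' : ∀ k ≤ N, ∫ y, ‖iteratedFDeriv ℝ k h y‖ ≤ ∑ k ∈ Finset.range (N + 1), R k := by
    intro k hk
    calc ∫ y, ‖iteratedFDeriv ℝ k h y‖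
        ≤ ∫ y, ∑ i ∈ Finset.range (k + 1),
            (k.choose i : ℝ) * M * ‖iteratedFDeriv ℝ (k - i) φ y‖ :=
          integral_mono (hhi k hk).norm (hsum k) (hle k hk)
      _ = R k := by
          rw [integral_finsetSum _ fun i _ => (hφi (k - i)).const_mul _]
          exact Finset.sum_congr rfl fun i _ => integral_const_mul _ _
      _ ≤ _ := Finset.single_le_sum (fun i _ => hR i) (Finset.mem_range.2 (by omega))
  have key := norm_fourier_le_of_integral_le N hc hhi hM' ξ
  refine le_trans (le_of_eq ?_) key
  rw [Real.fourier_eq]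
  have : innerIntegral A φ x ξ = 𝐞 ⟪ξ, x⟫_ℝ * ∫ y, 𝐞 (-⟪y, ξ⟫_ℝ) • h y := by
    rw [innerIntegral, ← integral_const_mul]
    refine integral_congr_ae (Eventually.of_forall fun y => ?_)
    simp only [h]
    rw [Circle.smul_def, inner_sub_right, sub_eq_add_neg, char_add, real_inner_comm y ξ, smul_eq_mul]
    ring
  rw [this, norm_mul, norm_char, one_mul]

theorem stronglyMeasurable_innerIntegral {A : Rn d × Rn d → ℂ} (hA : Continuous A)
    {φ : Rn d → ℂ} (hφ : Continuous φ) :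
    StronglyMeasurable fun p : Rn d × Rn d => innerIntegral A φ p.1 p.2 := by
  have hc : Continuous (fun p : (Rn d × Rn d) × Rn d => (𝐞 ⟪p.1.2, p.1.1 - p.2⟫_ℝ : ℂ) *
      A ((1 / 2 : ℝ) • (p.1.1 + p.2), p.1.2) * φ p.2) := by
    have := continuous_char
    fun_prop
  exact hc.stronglyMeasurable.integral_prod_right

/-- At fixed ξ the volume-preserving passage from endpoints to midpoint and difference turns the
kernel pairing into the Wigner pairing. Keeping ξ outside keeps the double integral absolutely
convergent. -/
theorem integral_conj_mul_innerIntegral {A : Rn d × Rn d → ℂ} {M : ℝ} (hA : SymbolBound A M)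
    (φ ψ : 𝓢(Rn d, ℂ)) (ξ : Rn d) :
    ∫ x, conj (ψ x) * innerIntegral A φ x ξ = ∫ m, A (m, ξ) * wig φ ψ (m, ξ) := by
  let f : Rn d × Rn d → ℂ := fun w =>
    (𝐞 ⟪ξ, w.1 - w.2⟫_ℝ * A ((1 / 2 : ℝ) • (w.1 + w.2), ξ)) * (conj (ψ w.1) * φ w.2)
  have hAc := hA.smooth.continuous
  have hf : Integrable f := by
    have h1 : Integrable (fun w : Rn d × Rn d => conj (ψ w.1) * φ w.2) :=
      (conjSM ψ).integrable.mul_prod φ.integrable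
    refine h1.bdd_mul (c := M) ?_ (Eventually.of_forall fun w => ?_)
    · have := continuous_char
      exact (by fun_prop : Continuous fun w : Rn d × Rn d =>
        (𝐞 ⟪ξ, w.1 - w.2⟫_ℝ : ℂ) * A ((1 / 2 : ℝ) • (w.1 + w.2), ξ)).aestronglyMeasurable
    · rw [norm_mul, norm_char, one_mul]
      exact hA.norm_le _
  have e1 : ∫ x, conj (ψ x) * innerIntegral A φ x ξ = ∫ w, f w := by
    rw [Measure.volume_eq_prod, integral_prod _ hf]
    refine integral_congr_ae (Eventually.of_forall fun x => ?_)
    simp only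
    rw [innerIntegral, ← integral_const_mul]
    refine integral_congr_ae (Eventually.of_forall fun y => ?_)
    simp only [f]
    ring
  rw [e1, ← integral_comp_endpoints f, Measure.volume_eq_prod,
    integral_prod _ (integrable_comp_endpoints.2 hf)]
  refine integral_congr_ae (Eventually.of_forall fun m => ?_)
  simp only
  rw [wig, ← integral_const_mul]
  refine integral_congr_ae (Eventually.of_forall fun t => ?_)
  simp only [f, endpoints]
  rw [show m + (1 / 2 : ℝ) • t - (m - (1 / 2 : ℝ) • t) = t by module,
    show (1 / 2 : ℝ) • (m + (1 / 2 : ℝ) • t + (m - (1 / 2 : ℝ) • t)) = m by module]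
  ring

theorem integral_conj_mul_integral_innerIntegral {A : Rn d × Rn d → ℂ} {M : ℝ}
    (hA : SymbolBound A M) (φ ψ : 𝓢(Rn d, ℂ)) :
    ∫ x, conj (ψ x) * ∫ ξ, innerIntegral A φ x ξ = ∫ z, A z * wig φ ψ z := by
  obtain ⟨C, hC⟩ := exists_norm_innerIntegral_le hA φ
  have hi : Integrable (Function.uncurry fun x ξ => conj (ψ x) * innerIntegral A φ x ξ)
      (volume.prod volume) := by
    have h1 : Integrable (fun w : Rn d × Rn d => ‖ψ w.1‖ * (1 + ‖w.2‖) ^ (-((d + 1 : ℕ) : ℝ)))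
      (volume.prod volume) := ψ.integrable.norm.mul_prod integrable_decay
    refine (h1.const_mul C).mono' ?_ (Eventually.of_forall fun w => ?_)
    · refine AEStronglyMeasurable.mul ?_
        (stronglyMeasurable_innerIntegral hA.smooth.continuous φ.continuous).aestronglyMeasurable
      exact ((conjSM ψ).continuous.comp continuous_fst).aestronglyMeasurable
    · simp only [Function.uncurry, norm_mul, RCLike.norm_conj]
      calc _ ≤ ‖ψ w.1‖ * (C * (1 + ‖w.2‖) ^ (-((d + 1 : ℕ) : ℝ))) := by
            gcongr
            exact hC _ _
        _ = _ := by ring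
  simp_rw [← integral_const_mul]
  rw [integral_integral_swap hi, Measure.volume_eq_prod, integral_prod_symm _ (hA.integrable φ ψ)]
  exact integral_congr_ae
    (Eventually.of_forall fun ξ => integral_conj_mul_innerIntegral hA φ ψ ξ)

theorem IsOp.isWeylQuantization {a : Rn d × Rn d → ℝ} {K : L2 d →L[ℂ] L2 d} {M : ℝ}
    (hA : SymbolBound (fun z => (a (z.1, (2 * Real.pi) • z.2) : ℂ)) M)
    (hK : IsOp (fun z => (a (z.1, (2 * Real.pi) • z.2) : ℂ)) K) : IsWeylQuantization a K := by
  intro φ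
  set A : Rn d × Rn d → ℂ := fun z => (a (z.1, (2 * Real.pi) • z.2) : ℂ)
  obtain ⟨C, hC⟩ := exists_norm_innerIntegral_le hA φ
  have hw : weylIntegral a φ = fun x => ∫ ξ, innerIntegral A φ x ξ :=
    funext fun x => weylIntegral_eq a φ x
  rw [hw]
  have hloc : LocallyIntegrable (fun x => ∫ ξ, innerIntegral A φ x ξ) := by
    refine LocallyIntegrable.mono (f := fun _ => C * ∫ ξ : Rn d, (1 + ‖ξ‖) ^ (-((d + 1 : ℕ) : ℝ)))
      continuous_const.locallyIntegrable ?_ (Eventually.of_forall fun x => ?_)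
    · exact (stronglyMeasurable_innerIntegral hA.smooth.continuous
        φ.continuous).integral_prod_right'.aestronglyMeasurable
    · refine (norm_integral_le_of_norm_le (integrable_decay.const_mul C)
        (Eventually.of_forall (hC x))).trans ?_
      rw [integral_const_mul]
      exact le_abs_self _
  -- Two locally integrable functions agree almost everywhere once they agree against real test
  -- functions; these are Schwartz, so the weak identity applies.
  refine ae_eq_of_integral_contDiff_smul_eq ?_ hloc ?_
  · exact (Lp.memLp _).locallyIntegrable (by norm_num)
  intro g hg hgs
  have hgc : ContDiff ℝ ∞ (fun x => (g x : ℂ)) := Complex.ofRealCLM.contDiff.comp hg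
  have hgcs : HasCompactSupport (fun x => (g x : ℂ)) := hgs.comp_left (g := Complex.ofReal) rfl
  let ψ : 𝓢(Rn d, ℂ) := hgcs.toSchwartzMap hgc
  have hψ : ∀ x, conj (ψ x) = (g x : ℂ) := fun x => Complex.conj_ofReal _
  have h1 := hK φ ψ
  rw [← integral_conj_mul_integral_innerIntegral hA, L2.inner_def] at h1
  simp only [hψ] at h1
  rw [show ∫ x, g x • ∫ ξ, innerIntegral A φ x ξ = ∫ x, (g x : ℂ) * ∫ ξ, innerIntegral A φ x ξ by
    simp only [Complex.real_smul], ← h1]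
  refine integral_congr_ae ?_
  filter_upwards [ψ.coeFn_toLp 2 volume] with x hx
  rw [hx, RCLike.inner_apply, hψ, Complex.real_smul, mul_comm]

end Bridge


/-! ### Modulations and commutator bounds -/

section Modulation

variable {d : ℕ}

theorem continuous_modul (q : Rn d) : Continuous (modul q) := by
  unfold modul; exact continuous_char.comp (by fun_prop)

theorem norm_modul (q x : Rn d) : ‖modul q x‖ = 1 := norm_char _

theorem conj_modul (q x : Rn d) : conj (modul q x) = modul (-q) x := by
  rw [modul, modul, conj_char, inner_neg_left]

theorem modul_add (q r x : Rn d) : modul (q + r) x = modul q x * modul r x := by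
  rw [modul, modul, modul, inner_add_left, char_add]

/-- The character `modul q` as a bounded continuous function. -/
def modulBCF (q : Rn d) : BoundedContinuousFunction (Rn d) ℂ :=
  BoundedContinuousFunction.ofNormedAddCommGroup (modul q) (continuous_modul q) 1
    fun x => (norm_modul q x).le

theorem modulBCF_apply (q x : Rn d) : modulBCF q x = modul q x := rfl

/-- The modulation operator `u ↦ 𝐞 ⟨q, ·⟩ u`. -/
def modulOp (q : Rn d) : L2 d →L[ℂ] L2 d := mulOp (modulBCF q)

theorem modulOp_coeFn (q : Rn d) (u : L2 d) : modulOp q u =ᵐ[volume] fun x => modul q x * u x :=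
  mulOp_coeFn _ u

theorem norm_modulOp (q : Rn d) (u : L2 d) : ‖modulOp q u‖ = ‖u‖ := by
  rw [Lp.norm_def, Lp.norm_def]
  congr 1
  refine eLpNorm_congr_norm_ae ?_
  filter_upwards [modulOp_coeFn q u] with x hx
  rw [hx, norm_mul, norm_modul, one_mul]

theorem modulOp_modulOp (q r : Rn d) (u : L2 d) : modulOp q (modulOp r u) = modulOp (q + r) u := by
  rw [modulOp, modulOp, mulOp_mulOp, modulOp]
  congr 2
  ext x
  exact (modul_add q r x).symm

theorem modulOp_zero (u : L2 d) : modulOp 0 u = u := by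
  refine Lp.ext ?_
  filter_upwards [modulOp_coeFn 0 u] with x hx
  rw [hx, modul]
  simp

theorem inner_modulOp_right (q : Rn d) (u v : L2 d) :
    ⟪v, modulOp q u⟫_ℂ = ⟪modulOp (-q) v, u⟫_ℂ := by
  rw [L2.inner_def, L2.inner_def]
  refine integral_congr_ae ?_
  filter_upwards [modulOp_coeFn q u, modulOp_coeFn (-q) v] with x h1 h2
  rw [h1, h2, RCLike.inner_apply, RCLike.inner_apply, map_mul, conj_modul, neg_neg]
  ring

theorem integrable_mul_conj (u v : L2 d) : Integrable fun x => u x * conj (v x) := by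
  have := L2.integrable_inner (𝕜 := ℂ) v u
  simpa only [RCLike.inner_apply] using this

theorem inner_modulOp_eq_fourier (q : Rn d) (u v : L2 d) :
    ⟪v, modulOp q u⟫_ℂ = 𝓕 (fun x => u x * conj (v x)) (-q) := by
  rw [modulOp, inner_mulOp_right, Real.fourier_eq]
  refine integral_congr_ae (Eventually.of_forall fun x => ?_)
  simp only
  rw [modulBCF_apply, modul, Circle.smul_def, inner_neg_right, neg_neg, real_inner_comm, smul_eq_mul]

/-- Each matrix coefficient is the Fourier transform of an L¹ function. -/
theorem continuous_inner_modulOp (u v : L2 d) : Continuous fun q => ⟪v, modulOp q u⟫_ℂ := by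
  have h1 : Continuous (𝓕 (fun x => u x * conj (v x))) :=
    VectorFourier.fourierIntegral_continuous Real.continuous_fourierChar
      (by exact continuous_inner) (integrable_mul_conj u v)
  simp_rw [inner_modulOp_eq_fourier]
  exact h1.comp continuous_neg

/-- Modulations preserve the norm, so expanding the square of the difference upgrades weak
continuity to strong continuity. -/
theorem continuous_modulOp_apply (u : L2 d) : Continuous fun q => modulOp q u := by
  rw [continuous_iff_continuousAt]
  intro q₀
  rw [ContinuousAt, tendsto_iff_norm_sub_tendsto_zero]
  have h1 : ∀ q, ‖modulOp q u - modulOp q₀ u‖ ^ 2 =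
      2 * ‖u‖ ^ 2 - 2 * RCLike.re ⟪modulOp q₀ u, modulOp q u⟫_ℂ := by
    intro q
    rw [@norm_sub_sq ℂ, norm_modulOp, norm_modulOp, ← inner_conj_symm, RCLike.conj_re]
    ring
  have h2 : Tendsto (fun q => ‖modulOp q u - modulOp q₀ u‖ ^ 2) (𝓝 q₀) (𝓝 0) := by
    have h3 : Continuous fun q => 2 * ‖u‖ ^ 2 - 2 * RCLike.re ⟪modulOp q₀ u, modulOp q u⟫_ℂ :=
      continuous_const.sub (continuous_const.mul
        (RCLike.continuous_re.comp (continuous_inner_modulOp u (modulOp q₀ u))))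
    have h4 := h3.tendsto q₀
    simp_rw [h1]
    refine h4.trans (le_of_eq ?_)
    rw [inner_self_eq_norm_sq, norm_modulOp, sub_self]
  have h5 := h2.sqrt
  simpa [Real.sqrt_sq (norm_nonneg _)] using h5

/-- Modulation of Schwartz functions. -/
def modulSM (q : Rn d) (φ : 𝓢(Rn d, ℂ)) : 𝓢(Rn d, ℂ) :=
  𝓕⁻ (SchwartzMap.compSubConstCLM ℂ q (𝓕 φ))

theorem modulSM_apply (q : Rn d) (φ : 𝓢(Rn d, ℂ)) (x : Rn d) :
    modulSM q φ x = modul q x * φ x := by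
  have h1 : φ x = 𝓕⁻ ((𝓕 φ : 𝓢(Rn d, ℂ)) : Rn d → ℂ) x := by
    rw [← SchwartzMap.fourierInv_coe, FourierTransform.fourierInv_fourier_eq]
  rw [modulSM, SchwartzMap.fourierInv_coe, h1, Real.fourierInv_eq, Real.fourierInv_eq,
    ← integral_const_mul, ← integral_add_right_eq_self _ q]
  refine integral_congr_ae (Eventually.of_forall fun ξ => ?_)
  simp only [SchwartzMap.compSubConstCLM_apply, add_sub_cancel_right, Circle.smul_def, smul_eq_mul,
    modul, inner_add_left, char_add]
  ring

theorem toLp_modulSM (q : Rn d) (φ : 𝓢(Rn d, ℂ)) :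
    (modulSM q φ).toLp 2 volume = modulOp q (φ.toLp 2 volume) := by
  refine Lp.ext ?_
  filter_upwards [(modulSM q φ).coeFn_toLp 2 volume, φ.coeFn_toLp 2 volume,
    modulOp_coeFn q (φ.toLp 2 volume)] with x h1 h2 h3
  rw [h1, h3, h2, modulSM_apply]

theorem wig_modulSM (q r : Rn d) (φ ψ : 𝓢(Rn d, ℂ)) (z : Rn d × Rn d) :
    wig (modulSM q φ) (modulSM r ψ) z =
      modul (q - r) z.1 * wig φ ψ (z.1, z.2 - (1 / 2 : ℝ) • (q + r)) := by
  rw [← wig_modul]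
  congr 1
  · funext x; exact modulSM_apply q φ x
  · funext x; exact modulSM_apply r ψ x

theorem IsOp.modulOp_conj {a : Rn d × Rn d → ℂ} {K : L2 d →L[ℂ] L2 d} (hK : IsOp a K) (q : Rn d) :
    IsOp (fun z => a (z + (0, q))) (modulOp (-q) ∘L K ∘L modulOp q) := by
  intro φ ψ
  rw [ContinuousLinearMap.comp_apply, ContinuousLinearMap.comp_apply, inner_modulOp_right, neg_neg,
    ← toLp_modulSM, ← toLp_modulSM, hK, ← integral_add_right_eq_self _ ((0, q) : Rn d × Rn d)]
  refine integral_congr_ae (Eventually.of_forall fun z => ?_)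
  simp only
  rw [wig_modulSM]
  have h1 : modul (q - q) (z + (0, q)).1 = 1 := by simp [modul]
  have h2 : ((z + (0, q)).1, (z + (0, q)).2 - (1 / 2 : ℝ) • (q + q)) = z := by
    ext1
    · simp
    · simp only [Prod.snd_add]; module
  rw [h1, h2, one_mul]

/-- Splitting the character evenly on both sides of `K` makes the ξ-translations cancel, so the Weyl
symbol is multiplied exactly, with no remainder. -/
theorem IsOp.inner_modulOp_modulOp {a : Rn d × Rn d → ℂ} {K : L2 d →L[ℂ] L2 d} (hK : IsOp a K)
    (q : Rn d) (φ ψ : 𝓢(Rn d, ℂ)) :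
    ⟪ψ.toLp 2 volume, modulOp ((1 / 2 : ℝ) • q) (K (modulOp ((1 / 2 : ℝ) • q) (φ.toLp 2 volume)))⟫_ℂ =
      ∫ z, modul q z.1 * (a z * wig φ ψ z) := by
  rw [inner_modulOp_right, ← toLp_modulSM, ← toLp_modulSM, hK]
  refine integral_congr_ae (Eventually.of_forall fun z => ?_)
  simp only
  rw [wig_modulSM]
  have h1 : (1 / 2 : ℝ) • q - -((1 / 2 : ℝ) • q) = q := by module
  have h2 : (z.1, z.2 - (1 / 2 : ℝ) • ((1 / 2 : ℝ) • q + -((1 / 2 : ℝ) • q))) = z := by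
    ext1
    · rfl
    · simp
  rw [h1, h2]
  ring

/-- The mean value inequality applied to each derivative; this is where the extra order 2d + 2 is
spent. -/
theorem SymbolBound.sub_translate {a : Rn d × Rn d → ℂ} {M : ℝ} (ha : ContDiff ℝ ∞ a)
    (hM : ∀ n ≤ 2 * d + 2, ∀ z, ‖iteratedFDeriv ℝ n a z‖ ≤ M) (h : Rn d × Rn d) :
    SymbolBound (fun z => a (z + h) - a z) (M * ‖h‖) := by
  refine ⟨(ha.comp (contDiff_id.add contDiff_const)).sub ha, fun n hn z => ?_⟩
  have e : iteratedFDeriv ℝ n (fun z => a (z + h) - a z) z =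
      iteratedFDeriv ℝ n a (z + h) - iteratedFDeriv ℝ n a z := by
    rw [show (fun z => a (z + h) - a z) = (fun z => a (z + h)) - a from rfl,
      iteratedFDeriv_sub_apply, iteratedFDeriv_comp_add_right]
    · exact ((ha.comp (contDiff_id.add contDiff_const)).of_le (by exact_mod_cast le_top)).contDiffAt
    · exact (ha.of_le (by exact_mod_cast le_top)).contDiffAt
  rw [e]
  have hd : Differentiable ℝ (iteratedFDeriv ℝ n a) :=
    ha.differentiable_iteratedFDeriv (by exact_mod_cast ENat.natCast_lt_top n)
  have := Convex.norm_image_sub_le_of_norm_fderiv_le (𝕜 := ℝ) (f := iteratedFDeriv ℝ n a)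
    (s := Set.univ) (C := M) (x := z) (y := z + h) (fun x _ => hd x)
    (fun x _ => by rw [norm_fderiv_iteratedFDeriv]; exact hM (n + 1) (by omega) x) convex_univ
    (Set.mem_univ _) (Set.mem_univ _)
  simpa using this

/-- `K` has commutators with the modulations `modulOp q` of size `κ |q|`. -/
def CommBound (K : L2 d →L[ℂ] L2 d) (κ : ℝ) : Prop :=
  ∀ q u, ‖K (modulOp q u) - modulOp q (K u)‖ ≤ κ * ‖q‖ * ‖u‖

theorem IsOp.commBound {a : Rn d × Rn d → ℂ} {K : L2 d →L[ℂ] L2 d} (hK : IsOp a K) {M : ℝ}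
    (ha : ContDiff ℝ ∞ a) (hM : ∀ n ≤ 2 * d + 2, ∀ z, ‖iteratedFDeriv ℝ n a z‖ ≤ M) :
    CommBound K (cvConst d * M) := by
  intro q u
  have hb : SymbolBound a M := ⟨ha, fun n hn => hM n (by omega)⟩
  have hb' : SymbolBound (fun z => a (z + (0, q))) M := by
    refine ⟨ha.comp (contDiff_id.add contDiff_const), fun n hn z => ?_⟩
    rw [iteratedFDeriv_comp_add_right]
    exact hM n (by omega) _
  have h1 := ((hK.modulOp_conj q).sub hK hb' hb).norm_le
    (SymbolBound.sub_translate ha hM ((0, q) : Rn d × Rn d))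
  have h2 : K (modulOp q u) - modulOp q (K u) =
      -- The commutator is a modulation of the difference between `K` and its conjugate, whose
      -- symbol is the increment of `a` under a translation by `q` in ξ.
      modulOp q ((modulOp (-q) ∘L K ∘L modulOp q - K) u) := by
    rw [_root_.sub_apply, map_sub, ContinuousLinearMap.comp_apply, ContinuousLinearMap.comp_apply,
      modulOp_modulOp, add_neg_cancel, modulOp_zero]
  rw [h2, norm_modulOp]
  refine (ContinuousLinearMap.le_opNorm _ u).trans ?_
  have h3 : ‖((0, q) : Rn d × Rn d)‖ = ‖q‖ := by simp [Prod.norm_def]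
  rw [h3] at h1
  calc _ ≤ cvConst d * (M * ‖q‖) * ‖u‖ := by gcongr
    _ = _ := by ring

end Modulation


/-! ### Localization by slowly varying cut-offs -/

section Localization

variable {d : ℕ}

/-- The localized cut-off `x ↦ χ (ε x - s)`. -/
def cutoff (χ : 𝓢(Rn d, ℂ)) (ε : ℝ) (s : Rn d) : BoundedContinuousFunction (Rn d) ℂ :=
  χ.toBoundedContinuousFunction.compContinuous ⟨fun x => ε • x - s, by fun_prop⟩

theorem cutoff_apply (χ : 𝓢(Rn d, ℂ)) (ε : ℝ) (s x : Rn d) : cutoff χ ε s x = χ (ε • x - s) := rfl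

theorem cutoff_eq_integral (χ : 𝓢(Rn d, ℂ)) (ε : ℝ) (s x : Rn d) :
    χ (ε • x - s) = ∫ p, 𝓕 χ p * modul (-p) s * modul (ε • p) x := by
  have h1 : χ (ε • x - s) = 𝓕⁻ ((𝓕 χ : 𝓢(Rn d, ℂ)) : Rn d → ℂ) (ε • x - s) := by
    rw [← SchwartzMap.fourierInv_coe, FourierTransform.fourierInv_fourier_eq]
  rw [h1, Real.fourierInv_eq]
  refine integral_congr_ae (Eventually.of_forall fun p => ?_)
  simp only [Circle.smul_def, smul_eq_mul, modul, inner_sub_right, inner_smul_right,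
    real_inner_smul_left, inner_neg_left]
  rw [sub_eq_add_neg, char_add]
  ring

theorem integrable_fourier_mul_modul (χ : 𝓢(Rn d, ℂ)) (s : Rn d) :
    Integrable fun p => 𝓕 χ p * modul (-p) s :=
  (𝓕 χ).integrable.mul_bdd (c := 1)
    (continuous_char.comp (by fun_prop)).aestronglyMeasurable
    (Eventually.of_forall fun p => (norm_modul _ _).le)

theorem integrable_smul_modulOp (χ : 𝓢(Rn d, ℂ)) (ε : ℝ) (s : Rn d) (u : L2 d) :
    Integrable fun p => (𝓕 χ p * modul (-p) s) • modulOp (ε • p) u := by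
  refine (integrable_fourier_mul_modul χ s).smul_bdd (C := ‖u‖) ?_
    (Eventually.of_forall fun p => (norm_modulOp _ _).le)
  exact ((continuous_modulOp_apply u).comp (by fun_prop)).aestronglyMeasurable

/-- Fourier inversion writes the cut-off as a superposition of modulations of frequency `ε • p`; the
small factor ε in every commutator comes from here. -/
theorem mulOp_cutoff_eq_integral (χ : 𝓢(Rn d, ℂ)) (ε : ℝ) (s : Rn d) (u : L2 d) :
    mulOp (cutoff χ ε s) u = ∫ p, (𝓕 χ p * modul (-p) s) • modulOp (ε • p) u := by
  refine ext_inner_left ℂ fun v => ?_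
  rw [← integral_inner (integrable_smul_modulOp χ ε s u), inner_mulOp_right]
  have h1 : ∀ p, ⟪v, (𝓕 χ p * modul (-p) s) • modulOp (ε • p) u⟫_ℂ =
      ∫ x, 𝓕 χ p * modul (-p) s * (modul (ε • p) x * (u x * conj (v x))) := by
    intro p
    rw [inner_smul_right, modulOp, inner_mulOp_right, integral_const_mul]
    rfl
  simp_rw [h1]
  have hi : Integrable (Function.uncurry fun p x =>
      𝓕 χ p * modul (-p) s * (modul (ε • p) x * (u x * conj (v x)))) (volume.prod volume) := by
    have h2 := (integrable_fourier_mul_modul χ s).mul_prod (integrable_mul_conj u v)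
    have h3 := h2.bdd_mul (c := 1) (f := fun w : Rn d × Rn d => modul (ε • w.1) w.2)
      (continuous_char.comp (by fun_prop)).aestronglyMeasurable
      (Eventually.of_forall fun p => (norm_modul _ _).le)
    refine h3.congr (Eventually.of_forall fun w => ?_)
    simp only [Function.uncurry]
    ring
  rw [integral_integral_swap hi]
  refine integral_congr_ae (Eventually.of_forall fun x => ?_)
  simp only
  rw [cutoff_apply, cutoff_eq_integral, ← integral_mul_const]
  refine integral_congr_ae (Eventually.of_forall fun p => ?_)
  simp only
  ring

/-- Averaged commutator bound: the commutator with `mulOp (cutoff χ ε s)` is `O(ε)` in mean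
square with respect to `s`. -/
theorem CommBound.lintegral_commutator_le {K : L2 d →L[ℂ] L2 d} {κ : ℝ} (hK : CommBound K κ)
    (χ : 𝓢(Rn d, ℂ)) {ε : ℝ} (hκ : 0 ≤ κ) (hε : 0 ≤ ε) (u : L2 d) :
    ∫⁻ s, ‖K (mulOp (cutoff χ ε s) u) - mulOp (cutoff χ ε s) (K u)‖ₑ ^ 2 ≤
      (ENNReal.ofReal (κ * ε) * ‖u‖ₑ) ^ 2 * ∫⁻ p : Rn d, (‖p‖ₑ * ‖𝓕 χ p‖ₑ) ^ 2 := by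
  set G : Rn d → L2 d := fun p => 𝓕 χ p • (K (modulOp (ε • p) u) - modulOp (ε • p) (K u))
  have hc : Continuous fun p => K (modulOp (ε • p) u) - modulOp (ε • p) (K u) :=
    (K.continuous.comp ((continuous_modulOp_apply u).comp (by fun_prop))).sub
      ((continuous_modulOp_apply (K u)).comp (by fun_prop))
  have hb : ∀ p, ‖K (modulOp (ε • p) u) - modulOp (ε • p) (K u)‖ ≤ 2 * (‖K‖ * ‖u‖) := fun p => by
    refine (norm_sub_le _ _).trans ?_
    have h1 := K.le_opNorm (modulOp (ε • p) u)
    have h2 := K.le_opNorm u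
    rw [norm_modulOp] at h1 ⊢
    linarith
  have hG1 : Integrable G := (𝓕 χ).integrable.smul_bdd (C := 2 * (‖K‖ * ‖u‖))
    hc.aestronglyMeasurable (Eventually.of_forall hb)
  have hG2 : MemLp G 2 := by
    refine MemLp.of_le_mul (c := 2 * (‖K‖ * ‖u‖)) ((𝓕 χ).memLp 2) hG1.aestronglyMeasurable
      (Eventually.of_forall fun p => ?_)
    simp only [G, norm_smul]
    rw [mul_comm]
    exact mul_le_mul_of_nonneg_right (hb p) (norm_nonneg _)
  -- The centre `s` enters only through a character, so the commutator is the Fourier transform of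
  -- the vector-valued `G`, and Plancherel trades the integral over `s` for one over `p`.
  have hF : ∀ s, K (mulOp (cutoff χ ε s) u) - mulOp (cutoff χ ε s) (K u) = 𝓕 G s := by
    intro s
    rw [mulOp_cutoff_eq_integral, mulOp_cutoff_eq_integral,
      ← K.integral_comp_comm (integrable_smul_modulOp χ ε s u),
      ← integral_sub (K.integrable_comp (integrable_smul_modulOp χ ε s u))
        (integrable_smul_modulOp χ ε s (K u)), Real.fourier_eq]
    refine integral_congr_ae (Eventually.of_forall fun p => ?_)
    simp only [G]
    rw [map_smul, ← smul_sub, Circle.smul_def, smul_smul, modul, inner_neg_left, mul_comm]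
  simp_rw [hF]
  rw [lintegral_enorm_sq_fourier hG1 hG2,
    ← lintegral_const_mul' _ _ (by finiteness)]
  refine lintegral_mono fun p => ?_
  rw [← mul_pow]
  gcongr
  have h1 : ‖G p‖ₑ = ‖𝓕 χ p‖ₑ * ‖K (modulOp (ε • p) u) - modulOp (ε • p) (K u)‖ₑ := enorm_smul _ _
  have h2 : ‖K (modulOp (ε • p) u) - modulOp (ε • p) (K u)‖ₑ ≤
      ENNReal.ofReal (κ * ε) * ‖p‖ₑ * ‖u‖ₑ := by
    rw [← ofReal_norm, ← ofReal_norm, ← ofReal_norm, ← ENNReal.ofReal_mul (by positivity),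
      ← ENNReal.ofReal_mul (by positivity)]
    refine ENNReal.ofReal_le_ofReal ((hK _ _).trans (le_of_eq ?_))
    rw [norm_smul, Real.norm_of_nonneg hε]
    ring
  rw [h1]
  calc _ ≤ ‖𝓕 χ p‖ₑ * (ENNReal.ofReal (κ * ε) * ‖p‖ₑ * ‖u‖ₑ) := by gcongr
    _ = _ := by ring

theorem integrable_norm_mul_fourier (χ : 𝓢(Rn d, ℂ)) :
    Integrable fun p : Rn d => ‖p‖ * ‖𝓕 χ p‖ := by
  have h := SchwartzMap.integrable_pow_mul volume (𝓕 χ) 1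
  simp only [pow_one] at h
  exact h

theorem lintegral_enorm_fourier_moment_lt_top (χ : 𝓢(Rn d, ℂ)) :
    ∫⁻ p : Rn d, (‖p‖ₑ * ‖𝓕 χ p‖ₑ) ^ 2 < ⊤ := by
  have h1 : ∀ p : Rn d, ‖p‖ * ‖𝓕 χ p‖ ≤ SchwartzMap.seminorm ℝ 1 0 (𝓕 χ) := fun p => by
    simpa using SchwartzMap.norm_pow_mul_le_seminorm ℝ (𝓕 χ) 1 p
  have h2 : Integrable fun p : Rn d => ‖p‖ * ‖𝓕 χ p‖ :=
    integrable_norm_mul_fourier χ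
  have h3 : Integrable fun p : Rn d => (‖p‖ * ‖𝓕 χ p‖) ^ 2 := by
    refine (h2.const_mul (SchwartzMap.seminorm ℝ 1 0 (𝓕 χ))).mono'
      (h2.aestronglyMeasurable.pow 2) (Eventually.of_forall fun p => ?_)
    rw [norm_pow, Real.norm_of_nonneg (by positivity), sq]
    exact mul_le_mul_of_nonneg_right (h1 p) (by positivity)
  have h4 := h3.hasFiniteIntegral
  rw [HasFiniteIntegral] at h4
  refine lt_of_le_of_lt (le_of_eq (lintegral_congr fun p => ?_)) h4
  simp [enorm_pow, enorm_mul]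

theorem enorm_sq_mulOp_cutoff (χ : 𝓢(Rn d, ℂ)) (ε : ℝ) (s : Rn d) (u : L2 d) :
    ‖mulOp (cutoff χ ε s) u‖ₑ ^ 2 = ∫⁻ x, ‖χ (ε • x - s)‖ₑ ^ 2 * ‖u x‖ₑ ^ 2 := by
  rw [enorm_sq_eq_lintegral]
  refine lintegral_congr_ae ?_
  filter_upwards [mulOp_coeFn (cutoff χ ε s) u] with x hx
  rw [hx, enorm_mul, mul_pow, cutoff_apply]

/-- Mean square of the localizations. -/
theorem lintegral_enorm_sq_mulOp_cutoff (χ : 𝓢(Rn d, ℂ)) (ε : ℝ) (u : L2 d) :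
    ∫⁻ s, ‖mulOp (cutoff χ ε s) u‖ₑ ^ 2 = (∫⁻ x, ‖χ x‖ₑ ^ 2) * ‖u‖ₑ ^ 2 := by
  simp_rw [enorm_sq_mulOp_cutoff]
  have m1 : Measurable fun w : Rn d × Rn d => ‖χ (ε • w.2 - w.1)‖ₑ ^ 2 :=
    Continuous.measurable (by have := χ.continuous; fun_prop)
  rw [lintegral_lintegral_swap]
  · rw [enorm_sq_eq_lintegral, ← lintegral_const_mul'' _
      ((Lp.aestronglyMeasurable u).enorm.pow_const 2)]
    refine lintegral_congr fun x => ?_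
    rw [lintegral_mul_const'' _ (by
      exact (Continuous.measurable (by have := χ.continuous; fun_prop)).aemeasurable)]
    congr 1
    exact lintegral_sub_left_eq_self (fun x => ‖χ x‖ₑ ^ 2) (ε • x)
  · exact AEMeasurable.mul m1.aemeasurable
      (((Lp.aestronglyMeasurable u).enorm.pow_const 2).comp_snd)

/-- Replacing the Weyl quantization of `θ (ε x - s) b` by the product `Op b ∘ θ (ε x - s)`
costs `O(ε)`. -/
theorem IsOp.norm_apply_cutoff_sub_le {b : Rn d × Rn d → ℂ} {K K' : L2 d →L[ℂ] L2 d} {κ M : ℝ}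
    (hK : IsOp b K) (hb : Continuous b) (hM : ∀ z, ‖b z‖ ≤ M) (hκ : 0 ≤ κ) (hC : CommBound K κ)
    (θ : 𝓢(Rn d, ℂ)) {ε : ℝ} (hε : 0 ≤ ε) (s : Rn d)
    (hK' : IsOp (fun z => θ (ε • z.1 - s) * b z) K') (u : L2 d) :
    ‖K (mulOp (cutoff θ ε s) u) - K' u‖ ≤ κ * ε * (∫ p : Rn d, ‖p‖ * ‖𝓕 θ p‖) * ‖u‖ := by
  have hI : 0 ≤ ∫ p : Rn d, ‖p‖ * ‖𝓕 θ p‖ := integral_nonneg fun _ => by positivity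
  have := norm_apply_le_of_schwartz (K := K ∘L mulOp (cutoff θ ε s) - K')
    (c := κ * ε * (∫ p : Rn d, ‖p‖ * ‖𝓕 θ p‖)) (by positivity) (fun φ ψ => ?_) u
  · exact this
  set h : Rn d → ℂ := fun p => 𝓕 θ p * modul (-p) s
  have hh : Integrable h := integrable_fourier_mul_modul θ s
  set E : Rn d → L2 d →L[ℂ] L2 d := fun p => modulOp ((1 / 2 : ℝ) • ε • p)
  set f := φ.toLp 2 volume
  set g := ψ.toLp 2 volume
  have hEE : ∀ p, E p (E p f) = modulOp (ε • p) f := fun p => by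
    simp only [E]
    rw [modulOp_modulOp]
    rw [← add_smul, add_halves, one_smul]
  have hEc : Continuous fun p => E p f := (continuous_modulOp_apply f).comp (by fun_prop)
  -- In `e1` both half modulations stand to the right of `K`; in `e2` there is one on each side. The
  -- difference is a commutator with a single half modulation, to which `hC` applies.
  have e1 : ⟪g, K (mulOp (cutoff θ ε s) f)⟫_ℂ = ∫ p, h p * ⟪g, K (E p (E p f))⟫_ℂ := by
    rw [mulOp_cutoff_eq_integral, ← K.integral_comp_comm (integrable_smul_modulOp θ ε s f),
      ← integral_inner (K.integrable_comp (integrable_smul_modulOp θ ε s f))]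
    refine integral_congr_ae (Eventually.of_forall fun p => ?_)
    simp only [hEE]
    rw [map_smul, inner_smul_right]
  have e2 : ⟪g, K' f⟫_ℂ = ∫ p, h p * ⟪g, E p (K (E p f))⟫_ℂ := by
    have h1 : ∀ p, h p * ⟪g, E p (K (E p f))⟫_ℂ =
        ∫ z, h p * (modul (ε • p) z.1 * (b z * wig φ ψ z)) := fun p => by
      rw [integral_const_mul, ← hK.inner_modulOp_modulOp]
    simp_rw [h1]
    have hi : Integrable (Function.uncurry fun p z =>
        h p * (modul (ε • p) z.1 * (b z * wig φ ψ z))) (volume.prod volume) := by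
      have h2 := hh.mul_prod (integrable_mul_wig hb hM φ ψ)
      have h3 := h2.bdd_mul (c := 1) (f := fun w : Rn d × (Rn d × Rn d) => modul (ε • w.1) w.2.1)
        (continuous_char.comp (by fun_prop)).aestronglyMeasurable
        (Eventually.of_forall fun p => (norm_modul _ _).le)
      refine h3.congr (Eventually.of_forall fun w => ?_)
      simp only [Function.uncurry]
      ring
    rw [integral_integral_swap hi, hK']
    refine integral_congr_ae (Eventually.of_forall fun z => ?_)
    simp only
    rw [cutoff_eq_integral, mul_assoc, ← integral_mul_const]
    refine integral_congr_ae (Eventually.of_forall fun p => ?_)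
    simp only [h]
    ring
  have i1 : Integrable fun p => h p * ⟪g, K (E p (E p f))⟫_ℂ := by
    refine hh.mul_bdd (c := ‖g‖ * (‖K‖ * ‖f‖)) ?_ (Eventually.of_forall fun p => ?_)
    · simp_rw [hEE]
      have := (continuous_modulOp_apply f).comp (by fun_prop : Continuous fun p : Rn d => ε • p)
      exact (continuous_const.inner (K.continuous.comp this)).aestronglyMeasurable
    · refine (norm_inner_le_norm _ _).trans ?_
      gcongr
      refine (K.le_opNorm _).trans ?_
      simp only [E, norm_modulOp, le_refl]
  have i2 : Integrable fun p => h p * ⟪g, E p (K (E p f))⟫_ℂ := by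
    refine hh.mul_bdd (c := ‖g‖ * (‖K‖ * ‖f‖)) ?_ (Eventually.of_forall fun p => ?_)
    · have : Continuous fun p => modulOp (-((1 / 2 : ℝ) • ε • p)) g :=
        (continuous_modulOp_apply g).comp (by fun_prop)
      simp only [E, inner_modulOp_right _ _ g]
      exact (this.inner (K.continuous.comp hEc)).aestronglyMeasurable
    · refine (norm_inner_le_norm _ _).trans ?_
      gcongr
      simp only [E, norm_modulOp]
      refine (K.le_opNorm _).trans ?_
      simp only [norm_modulOp, le_refl]
  rw [_root_.sub_apply, inner_sub_right, ContinuousLinearMap.comp_apply, e1, e2,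
    ← integral_sub i1 i2]
  have hi : Integrable fun p : Rn d => ‖p‖ * ‖𝓕 θ p‖ :=
    integrable_norm_mul_fourier θ
  refine (norm_integral_le_of_norm_le (hi.const_mul (κ * ε * (‖g‖ * ‖f‖)))
    (Eventually.of_forall fun p => ?_)).trans (le_of_eq ?_)
  · rw [← mul_sub, ← inner_sub_right, norm_mul]
    have n1 : ‖h p‖ = ‖𝓕 θ p‖ := by simp only [h, norm_mul, norm_modul, mul_one]
    have n2 : ‖K (E p (E p f)) - E p (K (E p f))‖ ≤ κ * (ε * ‖p‖) * ‖f‖ := by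
      refine (hC _ _).trans ?_
      simp only [E, norm_modulOp]
      gcongr
      rw [norm_smul, norm_smul, Real.norm_of_nonneg hε]
      -- The factor 1/2 gained from the half modulation is discarded.
      have : ‖(1 / 2 : ℝ)‖ ≤ 1 := by norm_num
      exact mul_le_of_le_one_left (by positivity) this
    calc _ ≤ ‖𝓕 θ p‖ * (‖g‖ * (κ * (ε * ‖p‖) * ‖f‖)) := by
          rw [n1]
          gcongr
          exact (norm_inner_le_norm _ _).trans (by gcongr)
      _ = _ := by ring
  · rw [integral_const_mul]
    ring

end Localization


/-! ### Spectrum and approximate eigenvectors of self-adjoint operators -/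

section Spectral

variable {H : Type*} [NormedAddCommGroup H] [InnerProductSpace ℂ H] [CompleteSpace H]

theorem isSelfAdjoint_sub_algebraMap {K : H →L[ℂ] H} (hK : IsSelfAdjoint K) (r : ℝ) :
    IsSelfAdjoint (K - algebraMap ℂ (H →L[ℂ] H) r) := by
  refine hK.sub ?_
  rw [IsSelfAdjoint, ← algebraMap_star_comm]
  simp

/-- Spectral values of a self-adjoint operator are approximate eigenvalues. -/
theorem exists_approx_eigenvector {K : H →L[ℂ] H} (hK : IsSelfAdjoint K) {t : ℂ}
    (ht : t ∈ spectrum ℂ K) {η : ℝ} (hη : 0 < η) : ∃ u : H, u ≠ 0 ∧ ‖K u - t • u‖ ≤ η * ‖u‖ := by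
  by_contra! hcon
  have hr := hK.mem_spectrum_eq_re ht
  set A := K - algebraMap ℂ (H →L[ℂ] H) t with hA
  have hAu : ∀ u, A u = K u - t • u := fun u => by
    simp [hA, Algebra.algebraMap_eq_smul_one]
  have hAs : IsSelfAdjoint A := by
    rw [hA, hr]; exact isSelfAdjoint_sub_algebraMap hK _
  have hbd : ∀ u, η * ‖u‖ ≤ ‖A u‖ := fun u => by
    rcases eq_or_ne u 0 with rfl | hu
    · simp
    · rw [hAu]; exact (hcon u hu).le
  -- If there were no approximate eigenvector, `A` would be bounded below. Self-adjointness makes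
  -- the orthogonal complement of its range equal to its kernel, hence trivial, so `A` would be
  -- invertible and `t` in the resolvent set.
  refine ht ?_
  rw [spectrum.mem_resolventSet_iff, ← IsUnit.neg_iff, neg_sub, ContinuousLinearMap.isUnit_iff_bijective,
    ContinuousLinearMap.bijective_iff_dense_range_and_antilipschitz]
  refine ⟨?_, (Real.toNNReal η)⁻¹, ?_⟩
  · rw [Submodule.topologicalClosure_eq_top_iff, ContinuousLinearMap.orthogonal_range,
      (ContinuousLinearMap.isSelfAdjoint_iff'.1 hAs : ContinuousLinearMap.adjoint A = A),
      Submodule.eq_bot_iff]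
    intro u hu
    have h1 : A u = 0 := hu
    have h2 := hbd u
    rw [h1, norm_zero] at h2
    exact norm_le_zero_iff.1 (by nlinarith [norm_nonneg u])
  · refine ContinuousLinearMap.antilipschitz_of_bound _ fun u => ?_
    rw [NNReal.coe_inv, Real.coe_toNNReal _ hη.le, ← div_eq_inv_mul, le_div_iff₀ hη, mul_comm]
    exact hbd u

/-- Approximate eigenvalues of a self-adjoint operator are close to the spectrum. -/
theorem exists_mem_spectrum_of_approx_eigenvector {K : H →L[ℂ] H} (hK : IsSelfAdjoint K) {r : ℝ}
    {u : H} (hu : u ≠ 0) {η : ℝ} (h : ‖K u - (r : ℂ) • u‖ ≤ η * ‖u‖) :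
    ∃ t ∈ spectrum ℂ K, ‖t - r‖ ≤ η := by
  have : Nontrivial H := ⟨⟨u, 0, hu⟩⟩
  have hu0 : 0 < ‖u‖ := norm_pos_iff.2 hu
  have hη : 0 ≤ η := nonneg_of_mul_nonneg_left ((norm_nonneg _).trans h) hu0
  by_cases hr : (r : ℂ) ∈ spectrum ℂ K
  · exact ⟨r, hr, by simpa using hη⟩
  rw [spectrum.notMem_iff, ← IsUnit.neg_iff, neg_sub] at hr
  obtain ⟨A, hA⟩ := hr
  have hAs : IsSelfAdjoint (A : H →L[ℂ] H) := by
    rw [hA]; exact isSelfAdjoint_sub_algebraMap hK r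
  have hAu : (A : H →L[ℂ] H) u = K u - (r : ℂ) • u := by
    simp [hA, Algebra.algebraMap_eq_smul_one]
  have hinv : IsSelfAdjoint ((A⁻¹ : (H →L[ℂ] H)ˣ) : H →L[ℂ] H) := by
    have h1 : IsSelfAdjoint A := Units.ext hAs
    have h2 : IsSelfAdjoint A⁻¹ := h1.inv
    rw [IsSelfAdjoint, ← Units.coe_star, h2.star_eq]
  -- The inverse is self-adjoint, so its norm is attained as the modulus of a spectral value `z`.
  -- The approximate eigenvector forces `1 ≤ ‖z‖ * η`, and `z⁻¹` is then a spectral value of `K - r`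
  -- of modulus at most `η`.
  obtain ⟨z, hz, hzn⟩ := spectrum.exists_nnnorm_eq_spectralRadius
    ((A⁻¹ : (H →L[ℂ] H)ˣ) : H →L[ℂ] H)
  rw [hinv.spectralRadius_eq_nnnorm] at hzn
  have hzn' : ‖z‖ = ‖((A⁻¹ : (H →L[ℂ] H)ˣ) : H →L[ℂ] H)‖ :=
    congrArg NNReal.toReal (ENNReal.coe_injective hzn)
  have h1 : ‖u‖ ≤ ‖z‖ * (η * ‖u‖) := by
    have h2 : ((A⁻¹ : (H →L[ℂ] H)ˣ) : H →L[ℂ] H) ((A : H →L[ℂ] H) u) = u := by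
      rw [← mul_apply_eq_comp, Units.inv_mul]; rfl
    calc ‖u‖ = ‖((A⁻¹ : (H →L[ℂ] H)ˣ) : H →L[ℂ] H) ((A : H →L[ℂ] H) u)‖ := by rw [h2]
      _ ≤ ‖z‖ * ‖(A : H →L[ℂ] H) u‖ := by rw [hzn']; exact ContinuousLinearMap.le_opNorm _ _
      _ ≤ _ := by rw [hAu]; gcongr
  have hz1 : 1 ≤ ‖z‖ * η := by
    by_contra! hlt
    nlinarith
  have hz0 : z ≠ 0 := by
    rintro rfl
    simp at hz1
    linarith
  have h3 : z⁻¹ ∈ spectrum ℂ (A : H →L[ℂ] H) := by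
    have := (spectrum.inv_mem_iff (r := (Units.mk0 z hz0)⁻¹) (a := A))
    rw [inv_inv] at this
    simpa using this.2 hz
  rw [hA, ← spectrum.sub_singleton_eq] at h3
  obtain ⟨t, ht, s, hs, hts⟩ := h3
  rw [Set.mem_singleton_iff] at hs
  refine ⟨t, ht, ?_⟩
  simp only at hts
  rw [← hs, hts, norm_inv, inv_le_iff_one_le_mul₀ (norm_pos_iff.2 hz0)]
  linarith

end Spectral


/-! ### Calculus of uniform derivative bounds -/

section UniformBounds

variable {ι : Type*} {E G G' G'' : Type*} [NormedAddCommGroup E] [NormedSpace ℝ E]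
  [NormedAddCommGroup G] [NormedSpace ℝ G] [NormedAddCommGroup G'] [NormedSpace ℝ G']
  [NormedAddCommGroup G''] [NormedSpace ℝ G'']

/-- A family of smooth functions all of whose derivatives are bounded by multiples of the
weight `w`, uniformly in the family. -/
structure UnifLe (f : ι → E → G) (w : ι → E → ℝ) : Prop where
  smooth : ∀ i, ContDiff ℝ ∞ (f i)
  nonneg : ∀ i z, 0 ≤ w i z
  bound : ∀ n, ∃ C, 0 ≤ C ∧ ∀ i z, ‖iteratedFDeriv ℝ n (f i) z‖ ≤ C * w i z

theorem UnifLe.bound_le {f : ι → E → G} {w : ι → E → ℝ} (h : UnifLe f w) (N : ℕ) :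
    ∃ C, 0 ≤ C ∧ ∀ n ≤ N, ∀ i z, ‖iteratedFDeriv ℝ n (f i) z‖ ≤ C * w i z := by
  choose C hC0 hC using h.bound
  refine ⟨∑ n ∈ Finset.range (N + 1), C n, Finset.sum_nonneg fun n _ => hC0 n, fun n hn i z => ?_⟩
  refine (hC n i z).trans (mul_le_mul_of_nonneg_right ?_ (h.nonneg i z))
  exact Finset.single_le_sum (fun n _ => hC0 n) (Finset.mem_range.2 (by omega))

theorem UnifLe.mono {f : ι → E → G} {w w' : ι → E → ℝ} (h : UnifLe f w) {c : ℝ} (hc : 0 ≤ c)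
    (h0 : ∀ i z, 0 ≤ w' i z) (hw : ∀ i z, w i z ≤ c * w' i z) : UnifLe f w' := by
  refine ⟨h.smooth, h0, fun n => ?_⟩
  obtain ⟨C, hC0, hC⟩ := h.bound n
  refine ⟨C * c, by positivity, fun i z => (hC i z).trans ?_⟩
  rw [mul_assoc]
  exact mul_le_mul_of_nonneg_left (hw i z) hC0

theorem UnifLe.bilin (B : G →L[ℝ] G' →L[ℝ] G'') {f : ι → E → G} {g : ι → E → G'}
    {w w' : ι → E → ℝ} (hf : UnifLe f w) (hg : UnifLe g w') :
    UnifLe (fun i z => B (f i z) (g i z)) (fun i z => w i z * w' i z) := by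
  refine ⟨fun i => B.isBoundedBilinearMap.contDiff.comp₂ (hf.smooth i) (hg.smooth i),
    fun i z => mul_nonneg (hf.nonneg i z) (hg.nonneg i z), fun n => ?_⟩
  choose C hC0 hC using hf.bound
  choose D hD0 hD using hg.bound
  refine ⟨‖B‖ * ∑ k ∈ Finset.range (n + 1), (n.choose k : ℝ) * C k * D (n - k),
    mul_nonneg (norm_nonneg B) (Finset.sum_nonneg fun k _ => ?_), fun i z => ?_⟩
  · have := hC0 k
    have := hD0 (n - k)
    positivity
  · refine (B.norm_iteratedFDeriv_le_of_bilinear (hf.smooth i) (hg.smooth i) z (n := n)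
      (by exact_mod_cast le_top)).trans ?_
    rw [mul_assoc, Finset.sum_mul]
    refine mul_le_mul_of_nonneg_left (Finset.sum_le_sum fun k _ => ?_) (norm_nonneg B)
    have h1 := hC k i z
    have h2 := hD (n - k) i z
    calc _ ≤ (n.choose k : ℝ) * (C k * w i z) * (D (n - k) * w' i z) := by
          gcongr
          exact mul_nonneg (Nat.cast_nonneg _) ((norm_nonneg _).trans h1)
      _ = _ := by ring

theorem UnifLe.const {c : ι → G} {v : ι → ℝ} (hc : ∀ i, ‖c i‖ ≤ v i) :
    UnifLe (fun i (_ : E) => c i) (fun i _ => v i) := by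
  refine ⟨fun i => contDiff_const, fun i _ => (norm_nonneg _).trans (hc i), fun n =>
    ⟨1, zero_le_one, fun i z => ?_⟩⟩
  rw [one_mul]
  refine le_trans ?_ (hc i)
  rcases n.eq_zero_or_pos with rfl | hn
  · simp
  · rw [iteratedFDeriv_const_of_ne hn.ne']
    simp

theorem UnifLe.add {f g : ι → E → G} {w : ι → E → ℝ} (hf : UnifLe f w) (hg : UnifLe g w) :
    UnifLe (fun i z => f i z + g i z) w := by
  refine ⟨fun i => (hf.smooth i).add (hg.smooth i), hf.nonneg, fun n => ?_⟩
  obtain ⟨C, hC0, hC⟩ := hf.bound n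
  obtain ⟨D, hD0, hD⟩ := hg.bound n
  refine ⟨C + D, by positivity, fun i z => ?_⟩
  have : iteratedFDeriv ℝ n (fun z => f i z + g i z) z =
      iteratedFDeriv ℝ n (f i) z + iteratedFDeriv ℝ n (g i) z :=
    iteratedFDeriv_add_apply ((hf.smooth i).of_le (by exact_mod_cast le_top)).contDiffAt
      ((hg.smooth i).of_le (by exact_mod_cast le_top)).contDiffAt
  rw [this, add_mul]
  exact (norm_add_le _ _).trans (add_le_add (hC i z) (hD i z))

theorem UnifLe.fderiv {f : ι → E → G} {w : ι → E → ℝ} (hf : UnifLe f w) :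
    UnifLe (fun i => fderiv ℝ (f i)) w := by
  refine ⟨fun i => (hf.smooth i).fderiv_right (by exact_mod_cast le_top), hf.nonneg, fun n => ?_⟩
  obtain ⟨C, hC0, hC⟩ := hf.bound (n + 1)
  refine ⟨C, hC0, fun i z => ?_⟩
  rw [norm_iteratedFDeriv_fderiv]
  exact hC i z

/-- Only derivatives of the inner map enter the chain rule, so the inner map itself may be
unbounded, as it must be when F is. -/
theorem UnifLe.comp {f : ι → G → G'} {g : ι → E → G} (hf : UnifLe f fun _ _ => 1)
    (hg : ∀ i, ContDiff ℝ ∞ (g i)) (hg' : UnifLe (fun i => _root_.fderiv ℝ (g i)) fun _ _ => 1) :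
    UnifLe (fun i z => f i (g i z)) fun _ _ => 1 := by
  refine ⟨fun i => (hf.smooth i).comp (hg i), fun _ _ => zero_le_one, fun n => ?_⟩
  obtain ⟨C, hC0, hC⟩ := hf.bound_le n
  obtain ⟨D, hD0, hD⟩ := hg'.bound_le n
  -- The composition estimate wants the k-th derivative of the inner map below a k-th power; `1 + D`
  -- works because it is at least 1 and at least `D`.
  refine ⟨n.factorial * C * (1 + D) ^ n, by positivity, fun i z => ?_⟩
  rw [mul_one]
  refine norm_iteratedFDeriv_comp_le (N := ∞) (hf.smooth i) (hg i) (by exact_mod_cast le_top) z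
    (fun k hk => by simpa using hC k hk i (g i z)) fun k hk hkn => ?_
  obtain ⟨k, rfl⟩ := Nat.exists_eq_add_of_le' hk
  have h1 := hD k (by omega) i z
  rw [norm_iteratedFDeriv_fderiv, mul_one] at h1
  calc _ ≤ (1 + D) ^ 1 := by linarith
    _ ≤ _ := pow_le_pow_right₀ (by linarith) (by omega)

end UniformBounds

/-! ### The perturbed symbol compared with a translated symbol -/

section Perturbation

variable {d : ℕ} {ι : Type*}

/-- The change of variables `(x, ξ) ↦ (x + δ F(x), ξ)`. -/
def shiftMap (F : Rn d → Rn d) (δ : ℝ) (z : Rn d × Rn d) : Rn d × Rn d := (z.1 + δ • F z.1, z.2)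

/-- The derivative of `(x, ξ) ↦ (F x, 0)`. -/
def liftDeriv (F : Rn d → Rn d) (z : Rn d × Rn d) : Rn d × Rn d →L[ℝ] Rn d × Rn d :=
  (ContinuousLinearMap.inl ℝ (Rn d) (Rn d)).comp
    ((fderiv ℝ F z.1).comp (ContinuousLinearMap.fst ℝ (Rn d) (Rn d)))

theorem contDiff_shiftMap {F : Rn d → Rn d} (hF : ContDiff ℝ ∞ F) (δ : ℝ) :
    ContDiff ℝ ∞ (shiftMap F δ) :=
  (contDiff_fst.add ((hF.comp contDiff_fst).const_smul δ)).prodMk contDiff_snd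

theorem hasFDerivAt_shiftMap {F : Rn d → Rn d} (hF : ContDiff ℝ ∞ F) (δ : ℝ) (z : Rn d × Rn d) :
    HasFDerivAt (shiftMap F δ) (ContinuousLinearMap.id ℝ _ + δ • liftDeriv F z) z := by
  have h1 : HasFDerivAt F (fderiv ℝ F z.1) z.1 := (hF.differentiable (by simp) _).hasFDerivAt
  have h2 : HasFDerivAt (fun z : Rn d × Rn d => F z.1)
      ((fderiv ℝ F z.1).comp (ContinuousLinearMap.fst ℝ (Rn d) (Rn d))) z :=
    h1.comp z hasFDerivAt_fst
  have h3 := (hasFDerivAt_id (𝕜 := ℝ) z).add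
    (((ContinuousLinearMap.inl ℝ (Rn d) (Rn d)).hasFDerivAt.comp z h2).const_smul δ)
  refine h3.congr_of_eventuallyEq (Eventually.of_forall fun w => ?_)
  ext1 <;> simp [shiftMap]

theorem unifLe_liftDeriv {F : Rn d → Rn d} (hF : IsCInftyOne F) :
    UnifLe (fun _ : ι => liftDeriv F) fun _ _ => 1 := by
  have h1 : UnifLe (fun (_ : ι) (z : Rn d × Rn d) => fderiv ℝ F z.1) fun _ _ => 1 := by
    have hs : ContDiff ℝ ∞ (fderiv ℝ F) := hF.smooth.fderiv_right (by exact_mod_cast le_top)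
    refine ⟨fun _ => hs.comp contDiff_fst, fun _ _ => zero_le_one, fun n => ?_⟩
    obtain ⟨C, hC⟩ := hF.bounded (n + 1) (by omega)
    refine ⟨C, (norm_nonneg _).trans (hC 0), fun _ z => ?_⟩
    rw [mul_one]
    refine (norm_iteratedFDeriv_comp_clm_le hs (ContinuousLinearMap.fst ℝ (Rn d) (Rn d))
      (ContinuousLinearMap.norm_fst_le ..) n z).trans ?_
    rw [norm_iteratedFDeriv_fderiv]
    exact hC _
  have h2 := UnifLe.bilin (ContinuousLinearMap.compL ℝ (Rn d × Rn d) (Rn d) (Rn d)) h1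
    (UnifLe.const (c := fun _ => ContinuousLinearMap.fst ℝ (Rn d) (Rn d)) fun _ => le_rfl)
  have h3 := UnifLe.bilin (ContinuousLinearMap.compL ℝ (Rn d × Rn d) (Rn d) (Rn d × Rn d))
    (UnifLe.const (c := fun _ => ContinuousLinearMap.inl ℝ (Rn d) (Rn d)) fun _ => le_rfl) h2
  refine h3.mono (c := ‖ContinuousLinearMap.inl ℝ (Rn d) (Rn d)‖ *
    ‖ContinuousLinearMap.fst ℝ (Rn d) (Rn d)‖) (by positivity) (fun _ _ => zero_le_one)
    fun _ _ => le_of_eq (by ring)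

theorem unifLe_comp_shiftMap {G : Type*} [NormedAddCommGroup G] [NormedSpace ℝ G]
    {F : Rn d → Rn d} (hF : IsCInftyOne F) {δ : ι → ℝ} (hδ : ∀ i, |δ i| ≤ 1)
    {A : Rn d × Rn d → G} (hA : UnifLe (fun _ : ι => A) fun _ _ => 1) :
    UnifLe (fun i z => A (shiftMap F (δ i) z)) fun _ _ => 1 := by
  refine hA.comp (fun i => contDiff_shiftMap hF.smooth (δ i)) ?_
  have h1 := UnifLe.bilin (ContinuousLinearMap.lsmul ℝ ℝ)
    (UnifLe.const (c := δ) (v := fun _ => 1) hδ) (unifLe_liftDeriv (ι := ι) hF)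
  have h2 : UnifLe (fun (_ : ι) (_ : Rn d × Rn d) => ContinuousLinearMap.id ℝ (Rn d × Rn d))
      (fun i z => 1 * 1) :=
    UnifLe.const fun _ => (ContinuousLinearMap.norm_id_le).trans (by simp)
  have h3 := (h2.add h1).mono (w' := fun _ _ => 1) zero_le_one (fun _ _ => zero_le_one) (by simp)
  convert h3 using 2 with i
  funext z
  exact (hasFDerivAt_shiftMap hF.smooth (δ i) z).fderiv

/-- Induction on the order, over all target spaces at once: differentiating gives the same kind of
difference for the derivative of `A`, plus a term carrying an explicit factor δ and bounded
otherwise. The base case is the mean value inequality, and the 1 in the weight absorbs the extra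
terms. -/
theorem norm_iteratedFDeriv_shiftMap_sub_le {F : Rn d → Rn d} (hF : IsCInftyOne F) {δ : ι → ℝ}
    (hδ : ∀ i, |δ i| ≤ 1) (p : ι → Rn d) (n : ℕ) :
    ∀ (G : Type) [NormedAddCommGroup G] [NormedSpace ℝ G] (A : Rn d × Rn d → G),
      (UnifLe (fun _ : ι => A) fun _ _ => 1) → ∃ C, 0 ≤ C ∧ ∀ i z,
      ‖iteratedFDeriv ℝ n (fun z => A (shiftMap F (δ i) z) - A (z + (δ i • F (p i), 0))) z‖ ≤
        C * (|δ i| * (1 + ‖F z.1 - F (p i)‖)) := by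
  induction n with
  | zero =>
    intro G _ _ A hA
    obtain ⟨C, hC0, hC⟩ := hA.bound 1
    refine ⟨C, hC0, fun i z => ?_⟩
    rw [norm_iteratedFDeriv_zero]
    have hd : Differentiable ℝ A := (hA.smooth i).differentiable (by simp)
    have h1 := Convex.norm_image_sub_le_of_norm_fderiv_le (𝕜 := ℝ) (f := A)
      (s := Set.univ) (C := C) (x := z + (δ i • F (p i), 0)) (y := shiftMap F (δ i) z)
      (fun x _ => hd x) (fun x _ => by
        have := hC i x
        rwa [← zero_add 1, ← norm_iteratedFDeriv_fderiv, norm_iteratedFDeriv_zero, mul_one] at this)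
      convex_univ (Set.mem_univ _) (Set.mem_univ _)
    refine h1.trans ?_
    have h2 : shiftMap F (δ i) z - (z + (δ i • F (p i), 0)) = (δ i • (F z.1 - F (p i)), 0) := by
      ext1
      · simp only [shiftMap, Prod.fst_sub, Prod.fst_add]; module
      · simp [shiftMap]
    rw [h2, Prod.norm_def, norm_zero, max_eq_left (norm_nonneg _), norm_smul, Real.norm_eq_abs]
    gcongr
    linarith
  | succ n ih =>
    intro G _ _ A hA
    have hD := hA.fderiv
    obtain ⟨C, hC0, hC⟩ := ih (Rn d × Rn d →L[ℝ] G) (fderiv ℝ A) hD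
    have h1 := UnifLe.bilin (ContinuousLinearMap.compL ℝ (Rn d × Rn d) (Rn d × Rn d) G)
      (unifLe_comp_shiftMap hF hδ hD) (unifLe_liftDeriv (ι := ι) hF)
    have h2 := UnifLe.bilin (ContinuousLinearMap.lsmul ℝ ℝ)
      (UnifLe.const (c := δ) (v := fun i => |δ i|) fun _ => le_rfl) h1
    obtain ⟨C', hC0', hC'⟩ := h2.bound n
    refine ⟨C + C', by positivity, fun i z => ?_⟩
    have hAd : Differentiable ℝ A := (hA.smooth i).differentiable (by simp)
    have e : fderiv ℝ (fun z => A (shiftMap F (δ i) z) - A (z + (δ i • F (p i), 0))) =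
        (fun z => fderiv ℝ A (shiftMap F (δ i) z) - fderiv ℝ A (z + (δ i • F (p i), 0))) +
        (fun z => ContinuousLinearMap.lsmul ℝ ℝ (δ i) (ContinuousLinearMap.compL ℝ (Rn d × Rn d)
          (Rn d × Rn d) G (fderiv ℝ A (shiftMap F (δ i) z)) (liftDeriv F z))) := by
      funext z
      have h3 := (hAd (shiftMap F (δ i) z)).hasFDerivAt.comp z
        (hasFDerivAt_shiftMap hF.smooth (δ i) z)
      have h4 := (hAd (z + (δ i • F (p i), 0))).hasFDerivAt.comp z
        ((hasFDerivAt_id (𝕜 := ℝ) z).add_const (δ i • F (p i), (0 : Rn d)))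
      refine (h3.sub h4).fderiv.trans ?_
      simp only [Pi.add_apply]
      refine ContinuousLinearMap.ext fun v => ?_
      simp
      abel
    rw [← norm_iteratedFDeriv_fderiv, e]
    have s1 : ContDiff ℝ n fun z =>
        fderiv ℝ A (shiftMap F (δ i) z) - fderiv ℝ A (z + (δ i • F (p i), 0)) :=
      (((hD.smooth i).comp (contDiff_shiftMap hF.smooth (δ i))).sub
        ((hD.smooth i).comp (contDiff_id.add contDiff_const))).of_le (by exact_mod_cast le_top)
    rw [iteratedFDeriv_add_apply s1.contDiffAt
      ((h2.smooth i).of_le (by exact_mod_cast le_top)).contDiffAt]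
    refine (norm_add_le _ _).trans ?_
    rw [add_mul]
    refine add_le_add (hC i z) ((hC' i z).trans ?_)
    rw [mul_one, mul_one]
    gcongr
    exact le_mul_of_one_le_right (abs_nonneg _) (by linarith [norm_nonneg (F z.1 - F (p i))])

theorem unifLe_shiftMap_sub {F : Rn d → Rn d} (hF : IsCInftyOne F) {δ : ι → ℝ}
    (hδ : ∀ i, |δ i| ≤ 1) (p : ι → Rn d) {A : Rn d × Rn d → ℂ}
    (hA : UnifLe (fun _ : ι => A) fun _ _ => 1) :
    UnifLe (fun i z => A (shiftMap F (δ i) z) - A (z + (δ i • F (p i), 0)))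
      (fun i z => |δ i| * (1 + ‖F z.1 - F (p i)‖)) :=
  ⟨fun i => ((hA.smooth i).comp (contDiff_shiftMap hF.smooth (δ i))).sub
      ((hA.smooth i).comp (contDiff_id.add contDiff_const)), fun i z => by positivity,
    fun n => norm_iteratedFDeriv_shiftMap_sub_le hF hδ p n ℂ A hA⟩

/-- Using the indicator of the support as weight records that all derivatives vanish outside it, so
that a growing factor can be controlled after multiplication. -/
theorem unifLe_cutoff (θ : 𝓢(Rn d, ℂ)) {R : ℝ} (hθ : tsupport θ ⊆ Metric.closedBall 0 R)
    {ε : ι → ℝ} (hε : ∀ i, |ε i| ≤ 1) (s : ι → Rn d) :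
    UnifLe (fun i (z : Rn d × Rn d) => θ (ε i • z.1 - s i))
      (fun i z => Set.indicator (Metric.closedBall 0 R) 1 (ε i • z.1 - s i)) := by
  refine ⟨fun i => θ.smooth'.comp ((contDiff_fst.const_smul (ε i)).sub contDiff_const),
    fun i z => Set.indicator_nonneg (fun _ _ => zero_le_one) _, fun n => ?_⟩
  refine ⟨SchwartzMap.seminorm ℝ 0 n θ, by positivity, fun i z => ?_⟩
  have hL : ‖ε i • ContinuousLinearMap.fst ℝ (Rn d) (Rn d)‖ ≤ 1 := by
    rw [norm_smul]
    exact mul_le_one₀ (hε i) (norm_nonneg _) (ContinuousLinearMap.norm_fst_le ..)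
  have h1 := norm_iteratedFDeriv_comp_clm_le (f := fun x => θ (x - s i))
    (θ.smooth'.comp (contDiff_id.sub contDiff_const)) _ hL n z
  rw [iteratedFDeriv_comp_sub] at h1
  refine le_trans h1 ?_
  change ‖iteratedFDeriv ℝ n θ (ε i • z.1 - s i)‖ ≤ _
  by_cases h : ε i • z.1 - s i ∈ Metric.closedBall (0 : Rn d) R
  · rw [Set.indicator_of_mem h, Pi.one_apply, mul_one]
    simpa using θ.le_seminorm ℝ 0 n (ε i • z.1 - s i)
  · rw [Set.indicator_of_notMem h, mul_zero, norm_le_zero_iff]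
    by_contra h'
    exact h (hθ (support_iteratedFDeriv_subset n h'))

theorem IsCInftyOne.exists_lipschitz {F : Rn d → Rn d} (hF : IsCInftyOne F) :
    ∃ L, 0 ≤ L ∧ ∀ x y, ‖F x - F y‖ ≤ L * ‖x - y‖ := by
  obtain ⟨C, hC⟩ := hF.bounded 1 le_rfl
  refine ⟨C, (norm_nonneg _).trans (hC 0), fun x y => ?_⟩
  have hd : Differentiable ℝ F := hF.smooth.differentiable (by simp)
  exact Convex.norm_image_sub_le_of_norm_fderiv_le (𝕜 := ℝ) (f := F) (s := Set.univ) (C := C)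
    (fun x _ => hd x) (fun x _ => by
      have := hC x
      rwa [← zero_add 1, ← norm_iteratedFDeriv_fderiv, norm_iteratedFDeriv_zero] at this)
    convex_univ (Set.mem_univ _) (Set.mem_univ _)

/-- The localized difference between the perturbed symbol and a translate of the original one is
`O(√|δ|)` with all derivatives. -/
theorem unifLe_cutoff_mul_shiftMap_sub {F : Rn d → Rn d} (hF : IsCInftyOne F) {δ : ι → ℝ}
    (hδ : ∀ i, |δ i| ≤ 1) (p : ι → Rn d) {A : Rn d × Rn d → ℂ}
    (hA : UnifLe (fun _ : ι => A) fun _ _ => 1) (θ : 𝓢(Rn d, ℂ)) {R : ℝ}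
    (hθ : tsupport θ ⊆ Metric.closedBall 0 R) (hR : 0 ≤ R) :
    UnifLe (fun i z => θ (√|δ i| • z.1 - √|δ i| • p i) *
        (A (shiftMap F (δ i) z) - A (z + (δ i • F (p i), 0))))
      (fun i _ => √|δ i|) := by
  obtain ⟨L, hL0, hL⟩ := hF.exists_lipschitz
  have hsq : ∀ i, √|δ i| * √|δ i| = |δ i| := fun i => Real.mul_self_sqrt (abs_nonneg _)
  have h1 : ∀ i, √|δ i| ≤ 1 := fun i => Real.sqrt_le_one.2 (hδ i)
  have := UnifLe.bilin (ContinuousLinearMap.mul ℝ ℂ)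
    (unifLe_cutoff θ hθ (ε := fun i => √|δ i|)
      (fun i => by rw [abs_of_nonneg (Real.sqrt_nonneg _)]; exact h1 i) (fun i => √|δ i| • p i))
    (unifLe_shiftMap_sub hF hδ p hA)
  refine this.mono (c := 1 + L * R) (by positivity) (fun _ _ => Real.sqrt_nonneg _) fun i z => ?_
  by_cases h : √|δ i| • z.1 - √|δ i| • p i ∈ Metric.closedBall (0 : Rn d) R
  · rw [Set.indicator_of_mem h, Pi.one_apply, one_mul]
    rw [mem_closedBall_zero_iff, ← smul_sub, norm_smul,
      Real.norm_of_nonneg (Real.sqrt_nonneg _)] at h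
    have h2 := hL z.1 (p i)
    have h0 := Real.sqrt_nonneg |δ i|
    -- On the support `√|δ| * ‖z.1 - p‖ ≤ R`: one factor √|δ| compensates the linear growth of F and
    -- the other remains.
    calc |δ i| * (1 + ‖F z.1 - F (p i)‖) ≤ |δ i| * (1 + L * ‖z.1 - p i‖) := by gcongr
      _ = √|δ i| * √|δ i| * (1 + L * ‖z.1 - p i‖) := by rw [hsq]
      _ = √|δ i| * (√|δ i| * 1 + L * (√|δ i| * ‖z.1 - p i‖)) := by ring
      _ ≤ √|δ i| * (1 * 1 + L * R) := by gcongr; exact h1 i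
      _ = _ := by ring
  · rw [Set.indicator_of_notMem h, zero_mul]
    positivity

end Perturbation


/-! ### Translations -/

section Translation

variable {d : ℕ}

/-- The translation `u ↦ u (· - b)`. -/
def translOp (b : Rn d) : L2 d →ₗᵢ[ℂ] L2 d :=
  Lp.compMeasurePreservingₗᵢ ℂ (fun x => x - b) (measurePreserving_sub_right volume b)

theorem translOp_coeFn (b : Rn d) (u : L2 d) : translOp b u =ᵐ[volume] fun x => u (x - b) :=
  Lp.coeFn_compMeasurePreserving u (measurePreserving_sub_right volume b)

theorem ae_comp_sub {p : Rn d → Prop} (h : ∀ᵐ x, p x) (b : Rn d) : ∀ᵐ x, p (x - b) :=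
  (measurePreserving_sub_right volume b).quasiMeasurePreserving.ae h

theorem translOp_translOp_neg (b : Rn d) (u : L2 d) : translOp b (translOp (-b) u) = u := by
  refine Lp.ext ?_
  filter_upwards [translOp_coeFn b (translOp (-b) u), ae_comp_sub (translOp_coeFn (-b) u) b]
    with x h1 h2
  rw [h1, h2]
  congr 1
  abel

/-- The translation as a unit of the algebra of bounded operators. -/
def translUnit (b : Rn d) : (L2 d →L[ℂ] L2 d)ˣ where
  val := (translOp b).toContinuousLinearMap
  inv := (translOp (-b)).toContinuousLinearMap
  val_inv := ContinuousLinearMap.ext (translOp_translOp_neg b)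
  inv_val := ContinuousLinearMap.ext fun u => by
    have := translOp_translOp_neg (-b) u
    rwa [neg_neg] at this

/-- The conjugate of `K` by a translation. -/
def translConj (b : Rn d) (K : L2 d →L[ℂ] L2 d) : L2 d →L[ℂ] L2 d :=
  ((translUnit b)⁻¹ : (L2 d →L[ℂ] L2 d)ˣ) * K * translUnit b

theorem translConj_apply (b : Rn d) (K : L2 d →L[ℂ] L2 d) (u : L2 d) :
    translConj b K u = translOp (-b) (K (translOp b u)) := rfl

theorem spectrum_translConj (b : Rn d) (K : L2 d →L[ℂ] L2 d) :
    spectrum ℂ (translConj b K) = spectrum ℂ K :=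
  spectrum.units_conjugate'

theorem toLp_compSubConst (b : Rn d) (φ : 𝓢(Rn d, ℂ)) :
    (SchwartzMap.compSubConstCLM ℂ b φ).toLp 2 volume = translOp b (φ.toLp 2 volume) := by
  refine Lp.ext ?_
  filter_upwards [(SchwartzMap.compSubConstCLM ℂ b φ).coeFn_toLp 2 volume,
    ae_comp_sub (φ.coeFn_toLp 2 volume) b, translOp_coeFn b (φ.toLp 2 volume)] with x h1 h2 h3
  rw [h1, h3, h2, SchwartzMap.compSubConstCLM_apply]

theorem IsOp.translConj {a : Rn d × Rn d → ℂ} {K : L2 d →L[ℂ] L2 d} (hK : IsOp a K) (b : Rn d) :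
    IsOp (fun z => a (z + (b, 0))) (translConj b K) := by
  intro φ ψ
  rw [translConj_apply, ← (translOp b).inner_map_map, translOp_translOp_neg, ← toLp_compSubConst,
    ← toLp_compSubConst, hK, ← integral_add_right_eq_self _ ((b, 0) : Rn d × Rn d)]
  refine integral_congr_ae (Eventually.of_forall fun z => ?_)
  simp only
  congr 1
  have h1 := wig_translate b φ ψ (z + (b, 0))
  have h2 : ((z + (b, 0)).1 - b, (z + (b, 0)).2) = z := by ext1 <;> simp
  rw [h2] at h1
  rw [← h1]
  rfl

theorem mulOp_cutoff_translOp (θ : 𝓢(Rn d, ℂ)) (ε : ℝ) (s b : Rn d) (u : L2 d) :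
    mulOp (cutoff θ ε s) (translOp b u) = translOp b (mulOp (cutoff θ ε (s - ε • b)) u) := by
  refine Lp.ext ?_
  filter_upwards [mulOp_coeFn (cutoff θ ε s) (translOp b u), translOp_coeFn b u,
    translOp_coeFn b (mulOp (cutoff θ ε (s - ε • b)) u),
    ae_comp_sub (mulOp_coeFn (cutoff θ ε (s - ε • b)) u) b] with x h1 h2 h3 h4
  rw [h1, h2, h3, h4, cutoff_apply, cutoff_apply]
  congr 2
  module

end Translation

/-! ### Nested cut-offs -/

section Bump

variable {d : ℕ}

/-- A smooth compactly supported cut-off as a Schwartz function. -/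
def bumpSM (f : ContDiffBump (0 : Rn d)) : 𝓢(Rn d, ℂ) :=
  (f.hasCompactSupport.comp_left (g := Complex.ofReal) rfl).toSchwartzMap
    (Complex.ofRealCLM.contDiff.comp f.contDiff)

theorem bumpSM_apply (f : ContDiffBump (0 : Rn d)) (x : Rn d) : bumpSM f x = (f x : ℂ) := rfl

theorem tsupport_bumpSM (f : ContDiffBump (0 : Rn d)) :
    tsupport (bumpSM f) ⊆ Metric.closedBall 0 f.rOut := by
  rw [← f.tsupport_eq]
  refine closure_mono fun x hx => ?_
  rw [Function.mem_support, bumpSM_apply] at hx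
  exact fun h => hx (by rw [h, Complex.ofReal_zero])

/-- The wider cut-off equals 1 on the support of the narrower one, so a localized vector is fixed by
the wider one. The comparison estimate takes this as its definition of localized. -/
theorem cutoff_mul_cutoff (f g : ContDiffBump (0 : Rn d)) (h : f.rOut ≤ g.rIn) (ε : ℝ)
    (s : Rn d) : cutoff (bumpSM g) ε s * cutoff (bumpSM f) ε s = cutoff (bumpSM f) ε s := by
  ext x
  rw [BoundedContinuousFunction.mul_apply, cutoff_apply, cutoff_apply, bumpSM_apply, bumpSM_apply]
  by_cases hx : ε • x - s ∈ Metric.closedBall (0 : Rn d) g.rIn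
  · rw [g.one_of_mem_closedBall hx, Complex.ofReal_one, one_mul]
  · rw [f.zero_of_le_dist (h.trans (le_of_lt (by simpa using hx))), Complex.ofReal_zero, mul_zero]

theorem lintegral_enorm_sq_bumpSM_ne_zero (f : ContDiffBump (0 : Rn d)) :
    ∫⁻ x, ‖bumpSM f x‖ₑ ^ 2 ≠ 0 := by
  intro h
  have hc : Continuous fun x => ‖bumpSM f x‖ₑ ^ 2 := by
    have := (bumpSM f).continuous
    fun_prop
  rw [lintegral_eq_zero_iff hc.measurable] at h
  have h1 := (Continuous.ae_eq_iff_eq volume hc continuous_zero).1 h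
  have h2 := congrFun h1 0
  simp [bumpSM_apply, f.one_of_mem_closedBall (Metric.mem_closedBall_self f.rIn_pos.le)] at h2

theorem lintegral_enorm_sq_schwartz_ne_top (χ : 𝓢(Rn d, ℂ)) : ∫⁻ x, ‖χ x‖ₑ ^ 2 ≠ ⊤ := by
  have h := eLpNorm_schwartz_ne_top χ
  rw [eLpNorm_two_eq] at h
  intro h'
  rw [h'] at h
  simp at h

end Bump

/-! ### Localized approximate eigenvectors -/

section Packets

variable {d : ℕ}

theorem enorm_add_sq_le {E : Type*} [NormedAddCommGroup E] (u v : E) :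
    ‖u + v‖ₑ ^ 2 ≤ 2 * ‖u‖ₑ ^ 2 + 2 * ‖v‖ₑ ^ 2 := by
  rw [← ofReal_norm, ← ofReal_norm, ← ofReal_norm, ← ENNReal.ofReal_pow (norm_nonneg _),
    ← ENNReal.ofReal_pow (norm_nonneg _), ← ENNReal.ofReal_pow (norm_nonneg _),
    ← ENNReal.ofReal_ofNat 2, ← ENNReal.ofReal_mul (by norm_num),
    ← ENNReal.ofReal_mul (by norm_num), ← ENNReal.ofReal_add (by positivity) (by positivity)]
  refine ENNReal.ofReal_le_ofReal ?_
  have h1 := norm_add_le u v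
  nlinarith [sq_nonneg (‖u‖ - ‖v‖), norm_nonneg (u + v)]

theorem aemeasurable_enorm_sq_mulOp_cutoff (χ : 𝓢(Rn d, ℂ)) (ε : ℝ) (u : L2 d) :
    AEMeasurable fun s => ‖mulOp (cutoff χ ε s) u‖ₑ ^ 2 := by
  simp_rw [enorm_sq_mulOp_cutoff]
  have m1 : Measurable fun w : Rn d × Rn d => ‖χ (ε • w.2 - w.1)‖ₑ ^ 2 :=
    Continuous.measurable (by have := χ.continuous; fun_prop)
  exact (m1.aemeasurable.mul
    (((Lp.aestronglyMeasurable u).enorm.pow_const 2).comp_snd)).lintegral_prod_right'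

/-- Approximate eigenvectors can be localized at scale `1 / ε` with an error `O(ε)`. -/
theorem exists_localized_approx_eigenvector (χ : 𝓢(Rn d, ℂ)) (hχ : ∫⁻ x, ‖χ x‖ₑ ^ 2 ≠ 0) {κ : ℝ}
    (hκ : 0 ≤ κ) : ∃ C, 0 ≤ C ∧ ∀ (ε : ℝ), 0 < ε → ∀ K : L2 d →L[ℂ] L2 d, CommBound K κ →
      ∀ (t : ℂ) (u : L2 d), u ≠ 0 → ‖K u - t • u‖ ≤ ε * ‖u‖ →
      ∃ s, mulOp (cutoff χ ε s) u ≠ 0 ∧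
        ‖K (mulOp (cutoff χ ε s) u) - t • mulOp (cutoff χ ε s) u‖ ≤
          C * ε * ‖mulOp (cutoff χ ε s) u‖ := by
  set X := ∫⁻ x, ‖χ x‖ₑ ^ 2
  set J := ∫⁻ p : Rn d, (‖p‖ₑ * ‖𝓕 χ p‖ₑ) ^ 2
  have hX : X ≠ ⊤ := lintegral_enorm_sq_schwartz_ne_top χ
  have hJ : J ≠ ⊤ := (lintegral_enorm_fourier_moment_lt_top χ).ne
  have hX0 : 0 < X.toReal := ENNReal.toReal_pos hχ hX
  have hJ0 : 0 ≤ J.toReal := ENNReal.toReal_nonneg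
  set B := 2 * κ ^ 2 * J.toReal + 2 * X.toReal
  have hB : 0 ≤ B := by positivity
  -- If every centre failed, averaging over `s` would give `C ^ 2 * X ≤ B`; this choice has `C ≥ 1`
  -- and `C * X = X + B`, hence `C ^ 2 * X > B`.
  refine ⟨1 + B / X.toReal, by positivity, fun ε hε K hK t u hu hKu => ?_⟩
  set C := 1 + B / X.toReal
  have hC1 : 1 ≤ C := le_add_of_nonneg_right (by positivity)
  by_contra! hcon
  set M : Rn d → L2 d →L[ℂ] L2 d := fun s => mulOp (cutoff χ ε s)
  have h1 : ∀ s, ENNReal.ofReal (C * ε) ^ 2 * ‖M s u‖ₑ ^ 2 ≤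
      2 * ‖K (M s u) - M s (K u)‖ₑ ^ 2 + 2 * ‖M s (K u - t • u)‖ₑ ^ 2 := by
    intro s
    -- The error splits into the commutator with the cut-off and the localized original error; both
    -- are O(ε) in mean square over `s`.
    have e1 : K (M s u) - t • M s u = (K (M s u) - M s (K u)) + M s (K u - t • u) := by
      rw [map_sub, map_smul]; abel
    refine le_trans ?_ (enorm_add_sq_le _ _)
    rw [← e1, ← mul_pow]
    gcongr
    rw [← ofReal_norm, ← ofReal_norm, ← ENNReal.ofReal_mul (by positivity)]
    refine ENNReal.ofReal_le_ofReal ?_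
    by_cases h0 : M s u = 0
    · rw [h0]; simp
    · exact (hcon s h0).le
  have h2 := lintegral_mono h1 (μ := (volume : Measure (Rn d)))
  rw [lintegral_const_mul' _ _ (by finiteness), lintegral_enorm_sq_mulOp_cutoff,
    lintegral_add_right' _ ((aemeasurable_enorm_sq_mulOp_cutoff χ ε _).const_mul 2),
    lintegral_const_mul' _ _ (by finiteness), lintegral_const_mul' _ _ (by finiteness),
    lintegral_enorm_sq_mulOp_cutoff] at h2
  have h3 := hK.lintegral_commutator_le χ hκ hε.le u
  have h4 : ‖K u - t • u‖ₑ ≤ ENNReal.ofReal ε * ‖u‖ₑ := by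
    rw [← ofReal_norm, ← ofReal_norm, ← ENNReal.ofReal_mul hε.le]
    exact ENNReal.ofReal_le_ofReal hKu
  have h5 : ENNReal.ofReal (C * ε) ^ 2 * (X * ‖u‖ₑ ^ 2) ≤
      2 * ((ENNReal.ofReal (κ * ε) * ‖u‖ₑ) ^ 2 * J) + 2 * (X * (ENNReal.ofReal ε * ‖u‖ₑ) ^ 2) := by
    refine h2.trans ?_
    gcongr
  have hu0 : 0 < ‖u‖ := norm_pos_iff.2 hu
  have h6 := ENNReal.toReal_mono (by finiteness) h5
  rw [ENNReal.toReal_add (by finiteness) (by finiteness)] at h6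
  simp only [ENNReal.toReal_mul, ENNReal.toReal_pow, toReal_enorm, ENNReal.toReal_ofNat] at h6
  rw [ENNReal.toReal_ofReal (by positivity), ENNReal.toReal_ofReal (by positivity),
    ENNReal.toReal_ofReal (by positivity)] at h6
  have h7 : (C ^ 2 * X.toReal) * (ε ^ 2 * ‖u‖ ^ 2) ≤ B * (ε ^ 2 * ‖u‖ ^ 2) := by
    refine le_trans (le_of_eq (by ring)) (h6.trans (le_of_eq ?_))
    simp only [B]
    ring
  have h8 := le_of_mul_le_mul_right h7 (by positivity)
  have h9 : C * X.toReal = X.toReal + B := by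
    simp only [C]
    field_simp
  have h10 : C * X.toReal ≤ C ^ 2 * X.toReal := by
    refine mul_le_mul_of_nonneg_right ?_ hX0.le
    nlinarith
  linarith

end Packets


/-! ### Comparison of the spectra -/

section Comparison

variable {d : ℕ}

/-- The symbol `(x, ξ) ↦ a (x, 2πξ)`, complex-valued. -/
def scaledSymbol (a : Rn d × Rn d → ℝ) (z : Rn d × Rn d) : ℂ := (a (z.1, (2 * Real.pi) • z.2) : ℂ)

theorem conj_scaledSymbol (a : Rn d × Rn d → ℝ) (z : Rn d × Rn d) :
    conj (scaledSymbol a z) = scaledSymbol a z := Complex.conj_ofReal _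

theorem IsRealSymbol.unifLe_scaledSymbol {a : Rn d × Rn d → ℝ} (ha : IsRealSymbol a) (ι : Type*) :
    UnifLe (fun _ : ι => scaledSymbol a) fun _ _ => 1 := by
  let L : Rn d × Rn d →L[ℝ] Rn d × Rn d := (ContinuousLinearMap.fst ℝ (Rn d) (Rn d)).prod
    ((2 * Real.pi) • ContinuousLinearMap.snd ℝ (Rn d) (Rn d))
  have hL : ContDiff ℝ ∞ fun z => a (L z) := ha.smooth.comp L.contDiff
  refine ⟨fun _ => Complex.ofRealCLM.contDiff.comp hL, fun _ _ => zero_le_one, fun n => ?_⟩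
  obtain ⟨C, hC⟩ := ha.bounded n
  have hC0 : 0 ≤ C := (norm_nonneg _).trans (hC 0)
  refine ⟨C * ‖L‖ ^ n, by positivity, fun _ z => ?_⟩
  have h1 : ‖iteratedFDeriv ℝ n (scaledSymbol a) z‖ = ‖iteratedFDeriv ℝ n (fun z => a (L z)) z‖ :=
    Complex.ofRealLI.norm_iteratedFDeriv_comp_left hL.contDiffAt (by exact_mod_cast le_top)
  have h2 := L.iteratedFDeriv_comp_right ha.smooth z (i := n) (by exact_mod_cast le_top)
  rw [h1, mul_one]
  change ‖iteratedFDeriv ℝ n (a ∘ L) z‖ ≤ _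
  rw [h2]
  refine (ContinuousMultilinearMap.norm_compContinuousLinearMap_le _ _).trans ?_
  rw [Finset.prod_const, Finset.card_univ, Fintype.card_fin]
  exact mul_le_mul_of_nonneg_right (hC _) (by positivity)

variable {a : Rn d × Rn d → ℝ} {F : Rn d → Rn d}

theorem IsRealSymbol.exists_bound (ha : IsRealSymbol a) (hF : IsCInftyOne F) :
    ∃ M, ∀ δ : ℝ, |δ| ≤ 1 → ContDiff ℝ ∞ (fun z => scaledSymbol a (shiftMap F δ z)) ∧
      ∀ n ≤ 2 * d + 2, ∀ z,
        ‖iteratedFDeriv ℝ n (fun z => scaledSymbol a (shiftMap F δ z)) z‖ ≤ M := by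
  have h := unifLe_comp_shiftMap hF (ι := {δ : ℝ // |δ| ≤ 1}) (δ := Subtype.val)
    (fun i => i.2) (ha.unifLe_scaledSymbol _)
  obtain ⟨C, -, hC⟩ := h.bound_le (2 * d + 2)
  exact ⟨C, fun δ hδ => ⟨h.smooth ⟨δ, hδ⟩, fun n hn z => by simpa using hC n hn ⟨δ, hδ⟩ z⟩⟩

theorem shiftMap_zero (F : Rn d → Rn d) (z : Rn d × Rn d) : shiftMap F 0 z = z := by
  simp [shiftMap]

theorem CommBound.sub {K L : L2 d →L[ℂ] L2 d} {κ κ' : ℝ} (hK : CommBound K κ)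
    (hL : CommBound L κ') : CommBound (K - L) (κ + κ') := by
  intro q u
  have e : (K - L) (modulOp q u) - modulOp q ((K - L) u) =
      (K (modulOp q u) - modulOp q (K u)) - (L (modulOp q u) - modulOp q (L u)) := by
    rw [_root_.sub_apply, _root_.sub_apply, map_sub]
    abel
  rw [e]
  refine (norm_sub_le _ _).trans ((add_le_add (hK q u) (hL q u)).trans (le_of_eq ?_))
  ring

/-- On functions localized near `p` at scale `|δ|^(-1/2)`, the quantization of the perturbed
symbol is `O(√|δ|)`-close to a translate of the quantization of the original symbol. -/
theorem exists_norm_sub_translConj_le (ha : IsRealSymbol a) (hF : IsCInftyOne F)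
    (g : ContDiffBump (0 : Rn d)) :
    ∃ C, 0 ≤ C ∧ ∀ δ : ℝ, |δ| ≤ 1 → ∀ (p : Rn d) (K L : L2 d →L[ℂ] L2 d),
      IsOp (fun z => scaledSymbol a (shiftMap F δ z)) K → IsOp (scaledSymbol a) L →
      ∀ v, mulOp (cutoff (bumpSM g) (√|δ|) (√|δ| • p)) v = v →
        ‖K v - translConj (δ • F p) L v‖ ≤ C * √|δ| * ‖v‖ := by
  obtain ⟨M, hM⟩ := ha.exists_bound hF
  have hM0 : 0 ≤ M := (norm_nonneg _).trans ((hM 0 (by simp)).2 0 (Nat.zero_le _) 0)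
  have hloc := unifLe_cutoff_mul_shiftMap_sub hF (ι := {δ : ℝ // |δ| ≤ 1} × Rn d)
    (δ := fun i => i.1) (fun i => i.1.2) (fun i => i.2) (ha.unifLe_scaledSymbol _) (bumpSM g)
    (tsupport_bumpSM g) g.rOut_pos.le
  obtain ⟨B, hB0, hB⟩ := hloc.bound_le (2 * d + 1)
  have hcv := cvConst_nonneg d
  set κ := cvConst d * M + cvConst d * M
  set I := ∫ p : Rn d, ‖p‖ * ‖𝓕 (bumpSM g) p‖
  have hI : 0 ≤ I := integral_nonneg fun _ => by positivity
  refine ⟨κ * I + cvConst d * B, by positivity, fun δ hδ p K L hK hL v hv => ?_⟩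
  set ε := √|δ|
  have h0 := hM 0 (by simp)
  simp only [shiftMap_zero] at h0
  have sK : SymbolBound (fun z => scaledSymbol a (shiftMap F δ z)) M :=
    ⟨(hM δ hδ).1, fun n hn => (hM δ hδ).2 n (by omega)⟩
  have sL : ContDiff ℝ ∞ (fun z => scaledSymbol a (z + (δ • F p, 0))) ∧ ∀ n ≤ 2 * d + 2, ∀ z,
      ‖iteratedFDeriv ℝ n (fun z => scaledSymbol a (z + (δ • F p, 0))) z‖ ≤ M := by
    refine ⟨h0.1.comp (contDiff_id.add contDiff_const), fun n hn z => ?_⟩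
    rw [iteratedFDeriv_comp_add_right]
    exact h0.2 n hn _
  have sL' : SymbolBound (fun z => scaledSymbol a (z + (δ • F p, 0))) M :=
    ⟨sL.1, fun n hn => sL.2 n (by omega)⟩
  have hL' := hL.translConj (δ • F p)
  have hD := hK.sub hL' sK sL'
  have hDC : CommBound (K - translConj (δ • F p) L) κ :=
    (hK.commBound (hM δ hδ).1 (hM δ hδ).2).sub (hL'.commBound sL.1 sL.2)
  have sT : SymbolBound (fun z => bumpSM g (ε • z.1 - ε • p) *
      (scaledSymbol a (shiftMap F δ z) - scaledSymbol a (z + (δ • F p, 0)))) (B * ε) :=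
    ⟨hloc.smooth (⟨δ, hδ⟩, p), fun n hn z => hB n hn (⟨δ, hδ⟩, p) z⟩
  -- `T` quantizes the cut-off times the symbol difference, so its norm is O(ε). Since `v` is fixed
  -- by the cut-off, the operator difference applied to `v` agrees with `T v` up to O(ε).
  obtain ⟨T, hT⟩ := sT.exists_isOp
  have h1 := hD.norm_apply_cutoff_sub_le (M := M + M)
    (sK.smooth.continuous.sub sL'.smooth.continuous)
    (fun z => (norm_sub_le _ _).trans (add_le_add (sK.norm_le z) (sL'.norm_le z)))
    (by positivity) hDC (bumpSM g) (Real.sqrt_nonneg |δ|) (ε • p) hT v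
  rw [hv] at h1
  have h2 := (T.le_opNorm v).trans (mul_le_mul_of_nonneg_right (hT.norm_le sT) (norm_nonneg v))
  rw [← _root_.sub_apply]
  calc ‖(K - translConj (δ • F p) L) v‖
      ≤ ‖(K - translConj (δ • F p) L) v - T v‖ + ‖T v‖ := by
        simpa using norm_add_le ((K - translConj (δ • F p) L) v - T v) (T v)
    _ ≤ κ * ε * I * ‖v‖ + cvConst d * (B * ε) * ‖v‖ := add_le_add h1 h2
    _ = _ := by ring

/-- The solution is a fixed point of `p ↦ c - δ • F p`, a contraction for small |δ|. -/
theorem IsCInftyOne.exists_solution (hF : IsCInftyOne F) :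
    ∃ L, 0 < L ∧ ∀ δ : ℝ, |δ| * L < 1 → ∀ c, ∃ p, p + δ • F p = c := by
  obtain ⟨L, hL0, hL⟩ := hF.exists_lipschitz
  -- The 1 is added because the Lipschitz constant may be zero while the threshold has to be
  -- positive.
  refine ⟨L + 1, by positivity, fun δ hδ c => ?_⟩
  have hc : ContractingWith (Real.toNNReal (|δ| * L)) fun x => c - δ • F x := by
    refine ⟨?_, LipschitzWith.of_dist_le_mul fun x y => ?_⟩
    · rw [Real.toNNReal_lt_one]
      nlinarith [abs_nonneg δ]
    · rw [Real.coe_toNNReal _ (by positivity), dist_sub_left, dist_eq_norm, dist_eq_norm, ← smul_sub,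
        norm_smul, Real.norm_eq_abs, mul_assoc]
      exact mul_le_mul_of_nonneg_left (hL x y) (abs_nonneg δ)
  refine ⟨ContractingWith.fixedPoint _ hc, ?_⟩
  have h1 := hc.fixedPoint_isFixedPt
  rw [Function.IsFixedPt] at h1
  nth_rewrite 1 [← h1]
  abel

/-- An approximate eigenvector `v` of `K` stays one for an operator that is close to `K` on `v`. -/
theorem norm_sub_smul_le_of_close {K L : L2 d →L[ℂ] L2 d} {v : L2 d} {t : ℂ} {x y : ℝ}
    (h : ‖K v - t • v‖ ≤ x * ‖v‖) (h' : ‖L v - K v‖ ≤ y * ‖v‖) :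
    ‖L v - t • v‖ ≤ (x + y) * ‖v‖ := by
  have : L v - t • v = (K v - t • v) + (L v - K v) := by abel
  rw [this, add_mul]
  exact (norm_add_le _ _).trans (add_le_add h h')

theorem exists_spectrum_close (ha : IsRealSymbol a) (hF : IsCInftyOne F) :
    ∃ C, 0 < C ∧ ∀ δ : ℝ, |δ| ≤ 1 → δ ≠ 0 → ∀ K L : L2 d →L[ℂ] L2 d,
      IsOp (fun z => scaledSymbol a (shiftMap F δ z)) K → IsOp (scaledSymbol a) L →
      (∀ t ∈ spectrum ℂ K, ∃ t' ∈ spectrum ℂ L, ‖t' - t‖ ≤ C * √|δ|) ∧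
      (∀ t ∈ spectrum ℂ L, ∃ t' ∈ spectrum ℂ K, ‖t' - t‖ ≤ C * √|δ|) := by
  let f : ContDiffBump (0 : Rn d) := ⟨1, 2, by norm_num, by norm_num⟩
  let g : ContDiffBump (0 : Rn d) := ⟨2, 3, by norm_num, by norm_num⟩
  obtain ⟨M, hM⟩ := ha.exists_bound hF
  have hM0 : 0 ≤ M := (norm_nonneg _).trans ((hM 0 (by simp)).2 0 (Nat.zero_le _) 0)
  have hcv := cvConst_nonneg d
  obtain ⟨C₁, hC₁, h₁⟩ := exists_localized_approx_eigenvector (bumpSM f)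
    (lintegral_enorm_sq_bumpSM_ne_zero f) (mul_nonneg hcv hM0)
  obtain ⟨C₂, hC₂, h₂⟩ := exists_norm_sub_translConj_le ha hF g
  obtain ⟨R, hR, hsol⟩ := hF.exists_solution
  -- Covers the large-δ case: 1 bounds the relative error ε of the eigenvector and the rest bounds
  -- `‖K‖ + ‖L‖`.
  set N := 1 + (cvConst d * M + cvConst d * M)
  refine ⟨C₁ + C₂ + N * √R + 1, by positivity, fun δ hδ hδ0 K L hK hL => ?_⟩
  set ε := √|δ|
  have hε : 0 < ε := Real.sqrt_pos.2 (abs_pos.2 hδ0)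
  have h0 := hM 0 (by simp)
  simp only [shiftMap_zero] at h0
  have hδM := hM δ hδ
  have sK : IsSelfAdjoint K := hK.isSelfAdjoint fun z => conj_scaledSymbol a _
  have sL : IsSelfAdjoint L := hL.isSelfAdjoint fun z => conj_scaledSymbol a _
  have hKC : CommBound K (cvConst d * M) := hK.commBound hδM.1 hδM.2
  have hLC : CommBound L (cvConst d * M) := hL.commBound h0.1 h0.2
  have hfg : ∀ (s : Rn d) (u : L2 d), mulOp (cutoff (bumpSM g) ε s)
      (mulOp (cutoff (bumpSM f) ε s) u) = mulOp (cutoff (bumpSM f) ε s) u := fun s u => by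
    rw [mulOp_mulOp, cutoff_mul_cutoff f g le_rfl]
  have hle : C₁ * ε + C₂ * ε ≤ (C₁ + C₂ + N * √R + 1) * ε := by
    have : 0 ≤ (N * √R + 1) * ε := by positivity
    linarith
  constructor
  · intro t ht
    obtain ⟨u, hu, hut⟩ := exists_approx_eigenvector sK ht hε
    obtain ⟨s, hs, hst⟩ := h₁ ε hε K hKC t u hu hut
    set v := mulOp (cutoff (bumpSM f) ε s) u
    have hp : ε • (ε⁻¹ • s) = s := by rw [smul_smul, mul_inv_cancel₀ hε.ne', one_smul]
    have h3 := h₂ δ hδ (ε⁻¹ • s) K L hK hL v (by rw [hp]; exact hfg s u)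
    rw [norm_sub_rev] at h3
    have h4 := norm_sub_smul_le_of_close hst h3
    have sL' : IsSelfAdjoint (translConj (δ • F (ε⁻¹ • s)) L) :=
      (hL.translConj _).isSelfAdjoint fun z => conj_scaledSymbol a _
    have htr := sK.mem_spectrum_eq_re ht
    rw [htr] at h4 ⊢
    obtain ⟨t', ht', htt⟩ := exists_mem_spectrum_of_approx_eigenvector sL' hs h4
    rw [spectrum_translConj] at ht'
    exact ⟨t', ht', htt.trans hle⟩
  · intro t ht
    obtain ⟨u, hu, hut⟩ := exists_approx_eigenvector sL ht hε
    have htr := sL.mem_spectrum_eq_re ht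
    by_cases hδR : |δ| * R < 1
    · obtain ⟨s, hs, hst⟩ := h₁ ε hε L hLC t u hu hut
      set v := mulOp (cutoff (bumpSM f) ε s) u with hv
      -- The vector `v` lives near `c = ε⁻¹ • s`, and its translate by `-b` must live near the very
      -- point `p` at which `b = δ • F p` is evaluated; hence the equation `p + δ • F p = c`.
      obtain ⟨p, hp⟩ := hsol δ hδR (ε⁻¹ • s)
      set b := δ • F p
      set w := translOp (-b) v
      have hw : ‖w‖ = ‖v‖ := (translOp (-b)).norm_map v
      have hw0 : w ≠ 0 := by
        rw [← norm_pos_iff, hw]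
        exact norm_pos_iff.2 hs
      have hsp : ε • p - ε • -b = s := by
        rw [smul_neg, sub_neg_eq_add, ← smul_add, hp, smul_smul, mul_inv_cancel₀ hε.ne', one_smul]
      have hcut : mulOp (cutoff (bumpSM g) ε (ε • p)) w = w := by
        simp only [w]
        rw [mulOp_cutoff_translOp, hsp, hv, hfg]
      have h3 := h₂ δ hδ p K L hK hL w hcut
      have h4 : ‖translConj b L w - t • w‖ ≤ C₁ * ε * ‖w‖ := by
        have e : translConj b L w - t • w = translOp (-b) (L v - t • v) := by
          rw [translConj_apply, translOp_translOp_neg, map_sub, map_smul]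
        rw [e, (translOp (-b)).norm_map, hw]
        exact hst
      have h5 := norm_sub_smul_le_of_close h4 h3
      rw [htr] at h5 ⊢
      obtain ⟨t', ht', htt⟩ := exists_mem_spectrum_of_approx_eigenvector sK hw0 h5
      exact ⟨t', ht', htt.trans hle⟩
    -- Here |δ| is bounded below, so `√R * ε ≥ 1` and the trivial norm bound is already of the
    -- required size.
    · push Not at hδR
      have nK := hK.norm_le (M := M) ⟨hδM.1, fun n hn => hδM.2 n (by omega)⟩
      have nL := hL.norm_le (M := M) ⟨h0.1, fun n hn => h0.2 n (by omega)⟩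
      have h3 : ‖K u - L u‖ ≤ (cvConst d * M + cvConst d * M) * ‖u‖ := by
        rw [add_mul]
        refine (norm_sub_le _ _).trans (add_le_add ?_ ?_)
        · exact (K.le_opNorm u).trans (by gcongr)
        · exact (L.le_opNorm u).trans (by gcongr)
      have h4 := norm_sub_smul_le_of_close hut h3
      rw [htr] at h4 ⊢
      obtain ⟨t', ht', htt⟩ := exists_mem_spectrum_of_approx_eigenvector sK hu h4
      refine ⟨t', ht', htt.trans ?_⟩
      have hε1 : ε ≤ 1 := Real.sqrt_le_one.2 hδ
      have h5 : 1 ≤ √R * ε := by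
        rw [← Real.sqrt_mul hR.le, mul_comm]
        exact Real.one_le_sqrt.2 hδR
      have h6 : 0 ≤ (C₁ + C₂ + 1) * ε := by positivity
      have h7 : N * 1 ≤ N * (√R * ε) := mul_le_mul_of_nonneg_left h5 (by positivity)
      simp only [N] at h7 ⊢
      nlinarith

/-- The operator built from the form satisfies the pointwise definition, so the default value 0 in
`weylOp` is not taken; uniqueness transfers the weak description to the chosen operator. -/
theorem isWeylQuantization_weylOp {a : Rn d × Rn d → ℝ} {M : ℝ} (h : SymbolBound (scaledSymbol a) M) :
    IsWeylQuantization a (weylOp a) ∧ IsOp (scaledSymbol a) (weylOp a) := by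
  obtain ⟨K, hK⟩ := h.exists_isOp
  have hKw : IsWeylQuantization a K := hK.isWeylQuantization h
  have he : ∃ K : L2 d →L[ℂ] L2 d, IsWeylQuantization a K := ⟨K, hKw⟩
  have hw : IsWeylQuantization a (weylOp a) := by
    rw [weylOp, dif_pos he]
    exact he.choose_spec
  exact ⟨hw, by rwa [hw.unique hKw]⟩

end Comparison

end WeylSpectrum

end

theorem theorem1 (d : ℕ)
    (a : WeylSpectrum.Rn d × WeylSpectrum.Rn d → ℝ) (ha : WeylSpectrum.IsRealSymbol a)
    (F : WeylSpectrum.Rn d → WeylSpectrum.Rn d) (hF : WeylSpectrum.IsCInftyOne F) :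
    (∀ δ : ℝ, |δ| ≤ 1 →
      WeylSpectrum.IsWeylQuantization (WeylSpectrum.perturbedSymbol a F δ)
        (WeylSpectrum.weylOp (WeylSpectrum.perturbedSymbol a F δ))) ∧
    ∃ C : ℝ, 0 < C ∧ ∀ δ : ℝ, |δ| ≤ 1 →
      Metric.hausdorffEDist
        (spectrum ℂ (WeylSpectrum.weylOp (WeylSpectrum.perturbedSymbol a F δ)))
        (spectrum ℂ (WeylSpectrum.weylOp (WeylSpectrum.perturbedSymbol a F 0)))
          ≤ ENNReal.ofReal (C * Real.sqrt |δ|) := by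
  obtain ⟨M, hM⟩ := ha.exists_bound hF
  -- The perturbation acts on x and the rescaling on ξ, so scaling the perturbed symbol is by
  -- definition the scaled symbol composed with `shiftMap`.
  have hw : ∀ δ : ℝ, |δ| ≤ 1 → _ := fun δ hδ =>
    WeylSpectrum.isWeylQuantization_weylOp (a := WeylSpectrum.perturbedSymbol a F δ) (M := M)
      ⟨(hM δ hδ).1, fun n hn => (hM δ hδ).2 n (by omega)⟩
  refine ⟨fun δ hδ => (hw δ hδ).1, ?_⟩
  obtain ⟨C, hC, h⟩ := WeylSpectrum.exists_spectrum_close ha hF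
  refine ⟨C, hC, fun δ hδ => ?_⟩
  -- The localization scale 1/√|δ| needs δ ≠ 0; at δ = 0 the two spectra coincide.
  rcases eq_or_ne δ 0 with rfl | hδ0
  · rw [Metric.hausdorffEDist_self]
    exact zero_le
  have e0 : WeylSpectrum.perturbedSymbol a F 0 = a := by
    funext z
    simp [WeylSpectrum.perturbedSymbol]
  have h0 := (hw 0 (by simp)).2
  rw [e0] at h0
  rw [e0]
  obtain ⟨h1, h2⟩ := h δ hδ hδ0 _ _ (hw δ hδ).2 h0
  refine Metric.hausdorffEDist_le_of_mem_edist (fun t ht => ?_) fun t ht => ?_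
  · obtain ⟨t', ht', htt⟩ := h1 t ht
    refine ⟨t', ht', ?_⟩
    rw [edist_comm, edist_dist, dist_eq_norm]
    exact ENNReal.ofReal_le_ofReal htt
  · obtain ⟨t', ht', htt⟩ := h2 t ht
    refine ⟨t', ht', ?_⟩
    rw [edist_comm, edist_dist, dist_eq_norm]
    exact ENNReal.ofReal_le_ofReal htt
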